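/- **Setting.** Let $d\ge 2$ and let a *perfect tensor* be a tensor with $2m$ legs of dimension $d$ which is a unitary from any $m$ of its legs to the other $m$. Consider a network of perfect tensors, each with one of its legs designated as logical leg (bulk input), which grows by a finite layer at each step $\Lambda\to\Lambda+1$, starting from the empty network, together with a bipartition of its boundary legs into $A$ and $A^c$ at each step. Assume that a cut $\gamma$ through bonds of the network (the RT surface) splits it into two wedges $a$, $a^c$, adjacent to $A$ and $A^c$, with complementary recovery in the following sense. In each wedge, the part of every layer in that wedge becomes, when its bonds across $\gamma$ and some of its internal bonds are opened, an acyclic circuit in which every tensor is used as a unitary from $m$ in-legs, its logical leg among them, to $m$ out-legs; the inputs of the circuit are the previous boundary legs, the logical legs, and all the ends in this wedge of the opened bonds, and its outputs are the new boundary legs. (Each opened bond end is attached to a tensor of the layer; previous boundary legs may pass through.) Thus for $A$ one has unitaries $$U_A^{\Lambda}:\mathcal H_A^{\Lambda}\otimes\mathcal H_{\delta a}\otimes\mathcal H_{\chi_{\delta a}}\otimes\mathcal H_{\delta\gamma_A}\to\mathcal H_A^{\Lambda+1},$$ where $\mathcal H_{\delta a}$, $\mathcal H_{\chi_{\delta a}}$,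 $\mathcal H_{\delta\gamma_A}$ belong to the new logical legs in $a$, the ends of the internal bonds opened in $a$, and the $A$-side ends of the new bonds across $\gamma$, and likewise for $A^c$. Assume that new bonds across $\gamma$ are added in infinitely many steps. Choose unit vectors $|i_{\delta a}\rangle\in\mathcal H_{\delta a}$, $|j_{\delta a^c}\rangle\in\mathcal H_{\delta a^c}$ as reference states of the new bulk inputs of every layer, and let $|\chi_{\delta a}\rangle,|\chi_{\delta a^c}\rangle,|\chi_{\delta\gamma}\rangle$ be the products of maximally entangled pairs, one for each opened bond. Let $\mathcal H=\varinjlim\mathcal H_A^\Lambda\otimes\mathcal H_{A^c}^\Lambda$ be the inductive limit Hilbert space along the isometries $$|\psi\rangle\mapsto U^\Lambda_AU^\Lambda_{A^c}\,|\psi\rangle|i_{\delta a}\rangle|j_{\delta a^c}\rangle|\chi_{\delta a}\rangle|\chi_{\delta a^c}\rangle|\chi_{\delta\gamma}\rangle .$$ Let $\hat{\mathcal A}_A=\varinjlim B(\mathcal H_A^\Lambda)$ be the inductive limit $C^*$-algebra along $O\mapsto U^\Lambda_A(O\otimes 1)U_A^{\Lambda\dagger}$, let $\pi$ be its representation on $\mathcal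 H$ given by $[O]\,[\psi]=[(O\otimes 1_{A^c})\psi]$, and let $\mathcal A_A=\pi(\hat{\mathcal A}_A)''$. Let $\mathcal A_{a,\chi_a}\subset\mathcal A_A$ and $\mathcal A_{\gamma_A}\subset\mathcal A_A$ be the von Neumann subalgebras generated, over all $\Lambda$, by the images of the operators $U_A^\Lambda OU_A^{\Lambda\dagger}$ with $O$ acting on $\mathcal H_{\delta a}\otimes\mathcal H_{\chi_{\delta a}}$ and with $O$ acting on $\mathcal H_{\delta\gamma_A}$, respectively (bulk and ancilla algebra, and RT-surface algebra). **Theorem.** $\mathcal H$ is separable, and $\mathcal A_A=\mathcal A_{a,\chi_a}\,\overline\otimes\,\mathcal A_{\gamma_A}$, where $\mathcal A_{a,\chi_a}$ is a factor of type I and $\mathcal A_{\gamma_A}$ is a factor of type II$_1$. More precisely, there are Hilbert spaces $\mathcal K$, $\mathcal L$ with $\mathcal K$ infinite-dimensional, a factor $R\subset B(\mathcal L)$ of type II$_1$ and a unitary identification $\mathcal H\cong\mathcal K\otimes\mathcal L$ under which $$\mathcal A_{a,\chi_a}=B(\mathcal K)\otimes 1,\qquad \mathcal A_{\gamma_A}=1\otimes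 R,\qquad \mathcal A_A=B(\mathcal K)\,\overline\otimes\,R .$$ Moreover $\mathcal A_A$ is a factor of type II$_\infty$ and is hyperfinite, that is, generated by an increasing sequence of finite-dimensional $*$-subalgebras; so it is the hyperfinite type II$_\infty$ factor. -/

import Mathlib

open scoped TensorProduct

/-! ### Inductive limits of Hilbert spaces -/

namespace IndLim
variable {E : ℕ → Type} [∀ n, NormedAddCommGroup (E n)] [∀ n, InnerProductSpace ℂ (E n)]

/-- For a sequence of Hilbert spaces `E 0 → E 1 → ⋯` with isometric embeddings `g n`, the vector
space of eventually coherent sequences: from some stage `N` on, `x (n + 1) = g n (x n)`. Such a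
sequence represents the class `[x N]` in which a vector is identified with its images. -/
def threads (g : ∀ n, E n →ₗᵢ[ℂ] E (n + 1)) : Submodule ℂ (∀ n, E n) where
  carrier := {x | ∃ N, ∀ n, N ≤ n → x (n + 1) = g n (x n)}
  zero_mem' := ⟨0, fun n _ => by simp⟩
  add_mem' := by
    rintro x y ⟨N, hN⟩ ⟨M, hM⟩
    exact ⟨max N M, fun n hn => by
      simp [hN n (le_trans (le_max_left _ _) hn), hM n (le_trans (le_max_right _ _) hn)]⟩
  smul_mem' := by
    rintro c x ⟨N, hN⟩
    exact ⟨N, fun n hn => by simp [hN n hn]⟩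

/-- The eventually coherent sequences, to be given the (semi-definite) inner product of the
inductive limit. Sequences with the same tail are at distance zero and get identified by the
completion below. -/
def PreLimit (g : ∀ n, E n →ₗᵢ[ℂ] E (n + 1)) : Type := threads g

variable (g : ∀ n, E n →ₗᵢ[ℂ] E (n + 1))

noncomputable instance : AddCommGroup (PreLimit g) := inferInstanceAs (AddCommGroup (threads g))
noncomputable instance : Module ℂ (PreLimit g) := inferInstanceAs (Module ℂ (threads g))

variable {g}

lemma inner_const (x y : PreLimit g) :
    ∃ N, ∀ n, N ≤ n → inner ℂ (x.1 n) (y.1 n) = inner ℂ (x.1 N) (y.1 N) := by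
  obtain ⟨N, hN⟩ := x.2
  obtain ⟨M, hM⟩ := y.2
  refine ⟨max N M, fun n hn => ?_⟩
  induction n, hn using Nat.le_induction with
  | base => rfl
  | succ n hn ih =>
    rw [hN n (le_trans (le_max_left _ _) hn), hM n (le_trans (le_max_right _ _) hn),
      LinearIsometry.inner_map_map, ih]

/-- `⟨[x], [y]⟩` is the eventually constant value of `⟨x n, y n⟩`. -/
noncomputable instance : Inner ℂ (PreLimit g) where
  inner x y := Filter.limUnder Filter.atTop fun n => inner ℂ (x.1 n) (y.1 n)

lemma inner_eq (x y : PreLimit g) :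
    ∀ᶠ n in Filter.atTop, inner ℂ x y = inner ℂ (x.1 n) (y.1 n) := by
  obtain ⟨N, hN⟩ := inner_const x y
  have h : inner ℂ x y = inner ℂ (x.1 N) (y.1 N) :=
    (tendsto_atTop_of_eventually_const hN).limUnder_eq
  filter_upwards [Filter.eventually_ge_atTop N] with n hn
  rw [h, hN n hn]

noncomputable instance core : PreInnerProductSpace.Core ℂ (PreLimit g) where
  conj_inner_symm x y := by
    obtain ⟨n, h1, h2⟩ := ((inner_eq x y).and (inner_eq y x)).exists
    rw [h1, h2, inner_conj_symm]
  re_inner_nonneg x := by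
    obtain ⟨n, h⟩ := (inner_eq x x).exists
    rw [h]; exact inner_self_nonneg
  add_left x y z := by
    obtain ⟨n, h1, h2, h3⟩ :=
      ((inner_eq (x + y) z).and ((inner_eq x z).and (inner_eq y z))).exists
    rw [h1, h2, h3, ← inner_add_left]; rfl
  smul_left x y c := by
    obtain ⟨n, h1, h2⟩ := ((inner_eq (c • x) y).and (inner_eq x y)).exists
    rw [h1, h2, ← inner_smul_left]; rfl

noncomputable instance : SeminormedAddCommGroup (PreLimit g) :=
  InnerProductSpace.Core.toSeminormedAddCommGroup (𝕜 := ℂ)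
noncomputable instance : InnerProductSpace ℂ (PreLimit g) := InnerProductSpace.ofCore core

variable (g) in
/-- The inductive limit Hilbert space of `E 0 → E 1 → ⋯`. -/
abbrev Limit : Type := UniformSpace.Completion (PreLimit g)

lemma norm_eq (x : PreLimit g) : ∀ᶠ n in Filter.atTop, ‖x‖ = ‖x.1 n‖ := by
  filter_upwards [inner_eq x x] with n h
  rw [norm_eq_sqrt_re_inner (𝕜 := ℂ) x, norm_eq_sqrt_re_inner (𝕜 := ℂ) (x.1 n), ← h]

/-- A uniformly bounded family of operators which from some stage on is compatible with the
embeddings acts on classes by `[v] ↦ [T n v]`. -/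
noncomputable def preOp (T : ∀ n, E n →L[ℂ] E n)
    (hT : ∃ N, ∀ n, N ≤ n → ∀ v, T (n + 1) (g n v) = g n (T n v))
    (hb : ∃ C, ∀ n, ‖T n‖ ≤ C) : PreLimit g →L[ℂ] PreLimit g :=
  LinearMap.mkContinuousOfExistsBound
    { toFun := fun x => ⟨fun n => T n (x.1 n), by
        obtain ⟨N, hN⟩ := hT
        obtain ⟨M, hM⟩ := x.2
        refine ⟨max N M, fun n hn => ?_⟩
        simp only
        rw [hM n (le_trans (le_max_right _ _) hn), hN n (le_trans (le_max_left _ _) hn)]⟩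
      map_add' := fun x y => Subtype.ext (funext fun n => map_add (T n) (x.1 n) (y.1 n))
      map_smul' := fun c x => Subtype.ext (funext fun n => map_smul (T n) c (x.1 n)) }
    (by
      obtain ⟨C, hC⟩ := hb
      refine ⟨C, fun x => ?_⟩
      obtain ⟨n, h1, h2⟩ := ((norm_eq x).and (norm_eq (g := g) ⟨fun n => T n (x.1 n), _⟩)).exists
      exact (h2.le.trans ((T n).le_of_opNorm_le (hC n) _)).trans_eq (by rw [h1]))

/-- The extension by continuity of `[v] ↦ [T n v]` to the inductive limit Hilbert space. -/
noncomputable def op (T : ∀ n, E n →L[ℂ] E n)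
    (hT : ∃ N, ∀ n, N ≤ n → ∀ v, T (n + 1) (g n v) = g n (T n v))
    (hb : ∃ C, ∀ n, ‖T n‖ ≤ C) : Limit g →L[ℂ] Limit g :=
  (preOp T hT hb).completion
end IndLim

/-! ### Perfect tensors and networks -/

namespace Happy

/-- The matrix of a tensor with `2 * m` legs of dimension `d`, read as a map from `m` of its legs
(the in-legs `e (inl j)`) to the other `m` legs (the out-legs `e (inr j)`). -/
def tensorMatrix {d m : ℕ} (T : (Fin (2 * m) → Fin d) → ℂ) (e : Fin m ⊕ Fin m ≃ Fin (2 * m)) :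
    Matrix (Fin m → Fin d) (Fin m → Fin d) ℂ :=
  fun o i => T (fun l => Sum.elim i o (e.symm l))

/-- A perfect tensor: every bipartition of its legs into two sets of `m` legs gives a unitary. -/
def IsPerfect {d m : ℕ} (T : (Fin (2 * m) → Fin d) → ℂ) : Prop :=
  ∀ e : Fin m ⊕ Fin m ≃ Fin (2 * m),
    (tensorMatrix T e).conjTranspose * tensorMatrix T e = 1

/-- The contraction of a network of `v` tensors, each read as a matrix `M u` from `m` in-legs to
`m` out-legs. The legs where a value enters the network are `I`, its dangling legs are `B`. The
bijection `plug` says where each in-leg `(u, j)` and each dangling leg is connected: to an entering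
leg or to an out-leg of some tensor. The value at `y, x` is the sum, over all values `s` of the
out-legs that agree with `y` at the dangling legs, of the product of the tensors. -/
noncomputable def contract {d m v : ℕ} {I B : Type} [Fintype B] [DecidableEq B]
    (M : Fin v → Matrix (Fin m → Fin d) (Fin m → Fin d) ℂ)
    (plug : (Fin v × Fin m) ⊕ B ≃ I ⊕ (Fin v × Fin m)) (y : B → Fin d) (x : I → Fin d) : ℂ :=
  ∑ s : Fin v × Fin m → Fin d,
    if (fun c => Sum.elim x s (plug (Sum.inr c))) = y then
      ∏ u, M u (fun j => s (u, j)) (fun j => Sum.elim x s (plug (Sum.inl (u, j))))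
    else 0

section unitarity
/-! The contraction is an isometry if the tensors are and if the connections are acyclic. -/

variable {d m v : ℕ} {I B : Type} [Fintype B] [DecidableEq B] [DecidableEq I]

/-- Replace the values at the out-legs of the tensor `u` by `o`. -/
def upd (s : Fin v × Fin m → Fin d) (u : Fin v) (o : Fin m → Fin d) : Fin v × Fin m → Fin d :=
  fun p => if p.1 = u then o p.2 else s p

lemma sum_upd (hd : 0 < d) (u : Fin v) (f : (Fin v × Fin m → Fin d) → ℂ) :
    ∑ s, f s = ((d : ℂ) ^ m)⁻¹ * ∑ s, ∑ o : Fin m → Fin d, f (upd s u o) := by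
  have h : ∑ p : (Fin v × Fin m → Fin d) × (Fin m → Fin d), f (upd p.1 u p.2)
      = ∑ p : (Fin v × Fin m → Fin d) × (Fin m → Fin d), f p.1 := by
    refine Finset.sum_bij' (fun p _ => (upd p.1 u p.2, fun j => p.1 (u, j)))
      (fun p _ => (upd p.1 u p.2, fun j => p.1 (u, j))) (by simp) (by simp) ?_ ?_ (by simp)
    all_goals
      rintro ⟨s, o⟩ -
      refine Prod.ext ?_ ?_
      · funext ⟨a, b⟩
        by_cases hab : a = u
        · subst hab; simp [upd]
        · simp [upd, hab]
      · funext j; simp [upd]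
  rw [Fintype.sum_prod_type, Fintype.sum_prod_type] at h
  rw [h]
  have : (d : ℂ) ^ m ≠ 0 := pow_ne_zero _ (by exact_mod_cast hd.ne')
  simp [← Finset.mul_sum]
  rw [inv_mul_cancel_left₀ this]

/-- Weight of a tensor in the doubled network, when the tensors in `S` are already cancelled. -/
noncomputable def wt (M : Fin v → Matrix (Fin m → Fin d) (Fin m → Fin d) ℂ)
    (plug : (Fin v × Fin m) ⊕ B ≃ I ⊕ (Fin v × Fin m)) (x x' : I → Fin d) (S : Finset (Fin v))
    (s s' : Fin v × Fin m → Fin d) (u : Fin v) : ℂ :=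
  if u ∈ S then ((d : ℂ) ^ m)⁻¹ else
    star (M u (fun j => s (u, j)) (fun j => Sum.elim x s (plug (Sum.inl (u, j))))) *
    M u (fun j => s' (u, j)) (fun j => Sum.elim x' s' (plug (Sum.inl (u, j))))

/-- The two copies of the network agree at the dangling legs and at the in-legs of `S`. -/
def Agree (plug : (Fin v × Fin m) ⊕ B ≃ I ⊕ (Fin v × Fin m)) (x x' : I → Fin d)
    (S : Finset (Fin v)) (s s' : Fin v × Fin m → Fin d) : Prop :=
  (∀ c, Sum.elim x s (plug (Sum.inr c)) = Sum.elim x' s' (plug (Sum.inr c))) ∧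
  ∀ u ∈ S, ∀ j, Sum.elim x s (plug (Sum.inl (u, j))) = Sum.elim x' s' (plug (Sum.inl (u, j)))

instance (plug : (Fin v × Fin m) ⊕ B ≃ I ⊕ (Fin v × Fin m)) (x x' : I → Fin d)
    (S : Finset (Fin v)) (s s' : Fin v × Fin m → Fin d) : Decidable (Agree plug x x' S s s') := by
  unfold Agree; infer_instance

/-- The doubled network when the tensors in `S` are already cancelled. -/
noncomputable def dbl (M : Fin v → Matrix (Fin m → Fin d) (Fin m → Fin d) ℂ)
    (plug : (Fin v × Fin m) ⊕ B ≃ I ⊕ (Fin v × Fin m)) (x x' : I → Fin d) (S : Finset (Fin v)) : ℂ :=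
  ∑ s, ∑ s', if Agree plug x x' S s s' then ∏ u, wt M plug x x' S s s' u else 0

lemma dbl_insert (hd : 0 < d) (M : Fin v → Matrix (Fin m → Fin d) (Fin m → Fin d) ℂ)
    (hM : ∀ u, (M u).conjTranspose * M u = 1)
    (plug : (Fin v × Fin m) ⊕ B ≃ I ⊕ (Fin v × Fin m)) (x x' : I → Fin d) (S : Finset (Fin v))
    (u : Fin v) (hu : u ∉ S)
    (hS : ∀ a l j, plug (Sum.inl (a, l)) = Sum.inr (u, j) → a ∈ S) :
    dbl M plug x x' (insert u S) = dbl M plug x x' S := by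
  have hd0 : (d : ℂ) ^ m ≠ 0 := pow_ne_zero _ (by exact_mod_cast hd.ne')
  have key : ∀ s s' : Fin v × Fin m → Fin d,
      (∑ o, ∑ o', if Agree plug x x' (insert u S) (upd s u o) (upd s' u o') then
        ∏ a, wt M plug x x' (insert u S) (upd s u o) (upd s' u o') a else 0) =
      ∑ o, ∑ o', if Agree plug x x' S (upd s u o) (upd s' u o') then
        ∏ a, wt M plug x x' S (upd s u o) (upd s' u o') a else 0 := by
    intro s s'
    -- input legs outside `S` do not see the outputs of `u`
    have hin : ∀ (z : I → Fin d) (t : Fin v × Fin m → Fin d) (o : Fin m → Fin d) a, a ∉ S → ∀ j,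
        Sum.elim z (upd t u o) (plug (Sum.inl (a, j))) = Sum.elim z t (plug (Sum.inl (a, j))) := by
      intro z t o a ha j
      rcases hp : plug (Sum.inl (a, j)) with i | ⟨b, l⟩
      · rfl
      · have : b ≠ u := by
          rintro rfl; exact ha (hS _ _ _ hp)
        simp [upd, this]
    let P : ℂ := ∏ a ∈ Finset.univ.erase u, wt M plug x x' S s s' a
    let i : Fin m → Fin d := fun j => Sum.elim x s (plug (Sum.inl (u, j)))
    let i' : Fin m → Fin d := fun j => Sum.elim x' s' (plug (Sum.inl (u, j)))
    let Q : Prop := ∀ p : (Fin v × Fin m) ⊕ B, (∀ a l, p = Sum.inl (a, l) → a ∈ S) →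
      (∀ j, plug p ≠ Sum.inr (u, j)) → Sum.elim x s (plug p) = Sum.elim x' s' (plug p)
    have hother : ∀ (z : I → Fin d) (t : Fin v × Fin m → Fin d) (o : Fin m → Fin d) p,
        (∀ j, plug p ≠ Sum.inr (u, j)) → Sum.elim z (upd t u o) (plug p) = Sum.elim z t (plug p) := by
      intro z t o p hp
      rcases hq : plug p with i | ⟨b, l⟩
      · rfl
      · have : b ≠ u := by
          rintro rfl; exact hp _ hq
        simp [upd, this]
    have hA : ∀ o o', Agree plug x x' S (upd s u o) (upd s' u o') ↔ o = o' ∧ Q := by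
      intro o o'
      constructor
      · intro h
        have h' : ∀ p : (Fin v × Fin m) ⊕ B, (∀ a l, p = Sum.inl (a, l) → a ∈ S) →
            Sum.elim x (upd s u o) (plug p) = Sum.elim x' (upd s' u o') (plug p) := by
          rintro (⟨a, l⟩ | c) hp
          · exact h.2 a (hp a l rfl) l
          · exact h.1 c
        refine ⟨?_, ?_⟩
        · funext j
          have := h' (plug.symm (Sum.inr (u, j))) (by
            intro a l hal
            exact hS a l j (by rw [← hal]; simp))
          simpa [upd] using this
        · intro p hp hpu
          have := h' p hp
          rwa [hother _ _ _ _ hpu, hother _ _ _ _ hpu] at this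
      · rintro ⟨rfl, hQ⟩
        have h' : ∀ p : (Fin v × Fin m) ⊕ B, (∀ a l, p = Sum.inl (a, l) → a ∈ S) →
            Sum.elim x (upd s u o) (plug p) = Sum.elim x' (upd s' u o) (plug p) := by
          intro p hp
          by_cases hpu : ∀ j, plug p ≠ Sum.inr (u, j)
          · rw [hother _ _ _ _ hpu, hother _ _ _ _ hpu]; exact hQ p hp hpu
          · push Not at hpu
            obtain ⟨j, hj⟩ := hpu
            rw [hj]; simp [upd]
        exact ⟨fun c => h' _ (by simp), fun a ha j => h' _ (by
          intro b l hbl; cases hbl; exact ha)⟩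
    have hA' : ∀ o o', Agree plug x x' (insert u S) (upd s u o) (upd s' u o') ↔
        o = o' ∧ Q ∧ i = i' := by
      intro o o'
      have : Agree plug x x' (insert u S) (upd s u o) (upd s' u o') ↔
          Agree plug x x' S (upd s u o) (upd s' u o') ∧ i = i' := by
        unfold Agree
        simp only [Finset.mem_insert, forall_eq_or_imp]
        have : (∀ j, Sum.elim x (upd s u o) (plug (Sum.inl (u, j))) =
            Sum.elim x' (upd s' u o') (plug (Sum.inl (u, j)))) ↔ i = i' := by
          rw [funext_iff]
          refine forall_congr' fun j => ?_
          rw [hin _ _ _ _ hu, hin _ _ _ _ hu]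
        rw [this]; tauto
      rw [this, hA]; tauto
    have hP : ∀ o o' (S' : Finset (Fin v)), (∀ a, a ≠ u → (a ∈ S' ↔ a ∈ S)) →
        ∏ a, wt M plug x x' S' (upd s u o) (upd s' u o') a =
        wt M plug x x' S' (upd s u o) (upd s' u o') u * P := by
      intro o o' S' hS'
      rw [← Finset.mul_prod_erase Finset.univ _ (Finset.mem_univ u)]
      congr 1
      refine Finset.prod_congr rfl fun a ha => ?_
      have hau : a ≠ u := Finset.ne_of_mem_erase ha
      unfold wt
      by_cases haS : a ∈ S
      · simp [haS, hS' a hau]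
      · simp only [hS' a hau, haS, if_false]
        simp only [hin _ _ _ _ haS]
        simp [upd, hau]
    have hw : ∀ o o', wt M plug x x' S (upd s u o) (upd s' u o') u = star (M u o i) * M u o' i' := by
      intro o o'
      unfold wt
      simp only [hu, if_false, hin _ _ _ _ hu]
      simp [upd, i, i']
    have hMi : ∑ o, star (M u o i) * M u o i' = if i = i' then 1 else 0 := by
      have := congrFun (congrFun (hM u) i) i'
      rw [Matrix.mul_apply, Matrix.one_apply] at this
      simpa [Matrix.conjTranspose_apply] using this
    classical
    have hL : ∀ o o', (if Agree plug x x' (insert u S) (upd s u o) (upd s' u o') then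
        ∏ a, wt M plug x x' (insert u S) (upd s u o) (upd s' u o') a else 0) =
        if o = o' then (if Q ∧ i = i' then ((d : ℂ) ^ m)⁻¹ * P else 0) else 0 := by
      intro o o'
      rw [hP o o' (insert u S) (by intro a ha; simp [ha])]
      have : wt M plug x x' (insert u S) (upd s u o) (upd s' u o') u = ((d : ℂ) ^ m)⁻¹ := by
        simp [wt]
      rw [this, ← ite_and]
      exact if_congr (hA' o o') rfl rfl
    have hR : ∀ o o', (if Agree plug x x' S (upd s u o) (upd s' u o') then
        ∏ a, wt M plug x x' S (upd s u o) (upd s' u o') a else 0) =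
        if o = o' then (if Q then star (M u o i) * M u o i' * P else 0) else 0 := by
      intro o o'
      rw [hP o o' S (by intro a ha; rfl), hw, ← ite_and]
      by_cases h : o = o' ∧ Q
      · rw [if_pos ((hA o o').2 h), if_pos h, h.1]
      · rw [if_neg (fun hh => h ((hA o o').1 hh)), if_neg h]
    simp only [hL, hR, Finset.sum_ite_eq, Finset.mem_univ, if_true]
    by_cases hQ : Q
    · simp only [hQ, if_true, true_and]
      rw [← Finset.sum_mul, hMi]
      by_cases hii : i = i'
      · simp [hii, hd0]
      · simp [hii]
    · simp [hQ]
  unfold dbl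
  rw [sum_upd hd u]
  conv_rhs => rw [sum_upd hd u]
  refine congrArg (_ * ·) (Finset.sum_congr rfl fun s _ => ?_)
  have e : ∀ S' : Finset (Fin v), (∑ o : Fin m → Fin d, ∑ s' : Fin v × Fin m → Fin d, if Agree plug x x' S' (upd s u o) s' then
      ∏ a, wt M plug x x' S' (upd s u o) s' a else 0) = ((d : ℂ) ^ m)⁻¹ *
        ∑ s' : Fin v × Fin m → Fin d, ∑ o : Fin m → Fin d, ∑ o' : Fin m → Fin d,
        if Agree plug x x' S' (upd s u o) (upd s' u o') then
        ∏ a, wt M plug x x' S' (upd s u o) (upd s' u o') a else 0 := by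
    intro S'
    conv_rhs => rw [Finset.sum_comm, Finset.mul_sum]
    refine Finset.sum_congr rfl fun o _ => ?_
    rw [sum_upd hd u]
  rw [e, e]
  exact congrArg (_ * ·) (Finset.sum_congr rfl fun s' _ => key s s')

lemma dbl_eq (hd : 0 < d) (M : Fin v → Matrix (Fin m → Fin d) (Fin m → Fin d) ℂ)
    (hM : ∀ u, (M u).conjTranspose * M u = 1)
    (plug : (Fin v × Fin m) ⊕ B ≃ I ⊕ (Fin v × Fin m)) (x x' : I → Fin d)
    (rank : Fin v → ℕ)
    (hr : ∀ u j a l, plug (Sum.inl (u, j)) = Sum.inr (a, l) → rank a < rank u) :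
    ∀ (n : ℕ) (S : Finset (Fin v)), Sᶜ.card = n →
      (∀ u ∈ S, ∀ a l j, plug (Sum.inl (a, l)) = Sum.inr (u, j) → a ∈ S) →
      dbl M plug x x' S = dbl M plug x x' Finset.univ := by
  intro n
  induction n with
  | zero =>
    intro S hS _
    have : S = Finset.univ := by simpa using hS
    rw [this]
  | succ n ih =>
    intro S hS hcl
    have hne : Sᶜ.Nonempty := by rw [← Finset.card_pos]; omega
    obtain ⟨u, hu, hmax⟩ := Finset.exists_max_image Sᶜ rank hne
    have huS : u ∉ S := by simpa using hu
    have hs : ∀ a l j, plug (Sum.inl (a, l)) = Sum.inr (u, j) → a ∈ S := by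
      intro a l j h
      by_contra ha
      have h1 := hmax a (by simpa using ha)
      have h2 := hr _ _ _ _ h
      omega
    rw [← dbl_insert hd M hM plug x x' S u huS hs]
    refine ih _ ?_ ?_
    · rw [Finset.compl_insert, Finset.card_erase_of_mem hu]; omega
    · intro w hw a l j h
      rcases Finset.mem_insert.1 hw with rfl | hw
      · exact Finset.mem_insert_of_mem (hs a l j h)
      · exact Finset.mem_insert_of_mem (hcl w hw a l j h)

theorem contract_isometry [Fintype I] (hd : 0 < d)
    (M : Fin v → Matrix (Fin m → Fin d) (Fin m → Fin d) ℂ)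
    (hM : ∀ u, (M u).conjTranspose * M u = 1)
    (plug : (Fin v × Fin m) ⊕ B ≃ I ⊕ (Fin v × Fin m)) 
    (hr : ∃ rank : Fin v → ℕ, ∀ u j a l, plug (Sum.inl (u, j)) = Sum.inr (a, l) → rank a < rank u)
    (x x' : I → Fin d) :
    ∑ y, star (contract M plug y x) * contract M plug y x' = if x = x' then 1 else 0 := by
  obtain ⟨rank, hr⟩ := hr
  have hd0 : (d : ℂ) ^ m ≠ 0 := pow_ne_zero _ (by exact_mod_cast hd.ne')
  have h1 : ∑ y, star (contract M plug y x) * contract M plug y x' = dbl M plug x x' ∅ := by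
    unfold contract dbl
    simp only [star_sum, Finset.sum_mul_sum]
    rw [Finset.sum_comm]
    refine Finset.sum_congr rfl fun s _ => ?_
    rw [Finset.sum_comm]
    refine Finset.sum_congr rfl fun s' _ => ?_
    have : ∀ y : B → Fin d, (star (if (fun c => Sum.elim x s (plug (Sum.inr c))) = y then
        ∏ u, M u (fun j => s (u, j)) (fun j => Sum.elim x s (plug (Sum.inl (u, j)))) else 0) *
        if (fun c => Sum.elim x' s' (plug (Sum.inr c))) = y then
        ∏ u, M u (fun j => s' (u, j)) (fun j => Sum.elim x' s' (plug (Sum.inl (u, j)))) else 0) =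
        if (fun c => Sum.elim x s (plug (Sum.inr c))) = y then
          (if Agree plug x x' ∅ s s' then ∏ u, wt M plug x x' ∅ s s' u else 0) else 0 := by
      intro y
      have hag : Agree plug x x' ∅ s s' ↔ (fun c => Sum.elim x s (plug (Sum.inr c))) =
          (fun c => Sum.elim x' s' (plug (Sum.inr c))) := by
        simp [Agree, funext_iff]
      by_cases h : (fun c => Sum.elim x s (plug (Sum.inr c))) = y
      · by_cases h' : (fun c => Sum.elim x' s' (plug (Sum.inr c))) = y
        · rw [if_pos h, if_pos h', if_pos h, if_pos (hag.2 (h.trans h'.symm))]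
          simp [wt, Finset.prod_mul_distrib, star_prod]
        · rw [if_pos h, if_neg h', if_pos h, if_neg (fun hh => h' ((hag.1 hh).symm.trans h))]
          simp
      · rw [if_neg h, if_neg h]; simp
    simp only [this]
    simp
  rw [h1, dbl_eq hd M hM plug x x' rank hr _ ∅ rfl (by simp)]
  unfold dbl
  have hag : ∀ s s' : Fin v × Fin m → Fin d, Agree plug x x' Finset.univ s s' ↔ x = x' ∧ s = s' := by
    intro s s'
    constructor
    · intro h
      have h' : ∀ p, Sum.elim x s (plug p) = Sum.elim x' s' (plug p) := by
        rintro (⟨a, l⟩ | c)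
        · exact h.2 a (by simp) l
        · exact h.1 c
      refine ⟨funext fun i => ?_, funext fun p => ?_⟩
      · simpa using h' (plug.symm (Sum.inl i))
      · simpa using h' (plug.symm (Sum.inr p))
    · rintro ⟨rfl, rfl⟩
      simp [Agree]
  have : ∀ s s' : Fin v × Fin m → Fin d, (if Agree plug x x' Finset.univ s s' then
      ∏ u, wt M plug x x' Finset.univ s s' u else 0) =
      if s = s' then (if x = x' then (((d : ℂ) ^ m)⁻¹) ^ v else 0) else 0 := by
    intro s s'
    rw [← ite_and]
    refine if_congr (by rw [hag]; tauto) ?_ rfl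
    simp [wt]
  simp only [this, Finset.sum_ite_eq, Finset.mem_univ, if_true]
  by_cases hx : x = x'
  · simp only [hx, if_true]
    simp
    rw [mul_comm v m, pow_mul]
    exact mul_inv_cancel₀ (pow_ne_zero _ hd0)
  · simp [hx]

end unitarity
end Happy

namespace Happy

/-! ### Von Neumann algebras -/

section vonNeumann
variable {H : Type} [NormedAddCommGroup H] [InnerProductSpace ℂ H] [CompleteSpace H]

/-- The von Neumann algebra generated by a set of operators: the double commutant of `S ∪ S*`. -/
noncomputable def vnGen (S : Set (H →L[ℂ] H)) : VonNeumannAlgebra H where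
  toStarSubalgebra := StarSubalgebra.centralizer ℂ (StarSubalgebra.centralizer ℂ S : Set (H →L[ℂ] H))
  centralizer_centralizer' := by
    change Set.centralizer (Set.centralizer
      ((StarSubalgebra.centralizer ℂ (StarSubalgebra.centralizer ℂ S : Set (H →L[ℂ] H)) :
        StarSubalgebra ℂ (H →L[ℂ] H)) : Set (H →L[ℂ] H))) =
      ((StarSubalgebra.centralizer ℂ (StarSubalgebra.centralizer ℂ S : Set (H →L[ℂ] H)) :
        StarSubalgebra ℂ (H →L[ℂ] H)) : Set (H →L[ℂ] H))
    rw [StarSubalgebra.coe_centralizer, Set.centralizer_centralizer_centralizer]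

lemma coe_vnGen (S : Set (H →L[ℂ] H)) :
    (vnGen S : Set (H →L[ℂ] H)) = Set.centralizer (Set.centralizer (S ∪ star S)) :=
  StarSubalgebra.coe_centralizer_centralizer ℂ S

variable (A : VonNeumannAlgebra H)

/-- `A` is a factor: `A ∩ A' = ℂ 1`. -/
def IsFactor : Prop := ∀ x ∈ A, x ∈ A.commutant → ∃ c : ℂ, x = c • 1

/-- `p` is a projection in `A`. -/
def IsProj (p : H →L[ℂ] H) : Prop := p ∈ A ∧ IsStarProjection p

/-- Murray-von Neumann equivalence of projections in `A`. -/
def MvNEquiv (p q : H →L[ℂ] H) : Prop := ∃ u ∈ A, star u * u = p ∧ u * star u = q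

/-- `p` is a minimal projection of `A`. (The condition `p * q = q` means `q ≤ p`.) -/
def IsMinimalProj (p : H →L[ℂ] H) : Prop :=
  IsProj A p ∧ p ≠ 0 ∧ ∀ q, IsProj A q → p * q = q → q = 0 ∨ q = p

/-- `p` is a finite projection of `A`: it is not equivalent to a proper subprojection. -/
def IsFiniteProj (p : H →L[ℂ] H) : Prop :=
  IsProj A p ∧ ∀ q, IsProj A q → p * q = q → MvNEquiv A p q → q = p

/-- `A` is a type I factor. -/
def IsTypeI : Prop := IsFactor A ∧ ∃ p, IsMinimalProj A p

/-- `A` is a type II factor: no minimal projection, but a nonzero finite projection. -/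
def IsTypeII : Prop :=
  IsFactor A ∧ (∀ p, ¬ IsMinimalProj A p) ∧ ∃ p, p ≠ 0 ∧ IsFiniteProj A p

/-- `A` is a type II₁ factor. -/
def IsTypeIIOne : Prop := IsTypeII A ∧ IsFiniteProj A 1

/-- `A` is a type II_∞ factor. -/
def IsTypeIIInfty : Prop := IsTypeII A ∧ ¬ IsFiniteProj A 1

/-- `A` is hyperfinite: generated by an increasing sequence of finite-dimensional *-subalgebras. -/
def IsHyperfinite : Prop :=
  ∃ F : ℕ → StarSubalgebra ℂ (H →L[ℂ] H), Monotone F ∧ (∀ n, FiniteDimensional ℂ (F n)) ∧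
    A = vnGen (⋃ n, (F n : Set (H →L[ℂ] H)))

/-- If the isometry `W` with dense range identifies `H` with the Hilbert space tensor product of `K`
and `L`, this says that `S` is the operator `x ⊗ y`. -/
def IsTensorOp {K L : Type} [NormedAddCommGroup K] [InnerProductSpace ℂ K]
    [NormedAddCommGroup L] [InnerProductSpace ℂ L] (W : K ⊗[ℂ] L →ₗᵢ[ℂ] H)
    (x : K →L[ℂ] K) (y : L →L[ℂ] L) (S : H →L[ℂ] H) : Prop :=
  ∀ k l, S (W (k ⊗ₜ[ℂ] l)) = W (x k ⊗ₜ[ℂ] y l)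

end vonNeumann

end Happy

/-! ### Layered codes -/

namespace Happy

section matrixHoms
variable {X Z : Type} [Fintype X] [DecidableEq X] [Fintype Z] [DecidableEq Z]

/-- `O ↦ O ⊗ 1`. -/
noncomputable def ampLeft (X Z : Type) [Fintype X] [DecidableEq X] [Fintype Z] [DecidableEq Z] :
    Matrix X X ℂ →⋆ₐ[ℂ] Matrix (X × Z) (X × Z) ℂ where
  toFun O := Matrix.kroneckerMap (· * ·) O 1
  map_one' := Matrix.one_kronecker_one
  map_mul' O O' := by rw [← Matrix.mul_kronecker_mul, one_mul]
  map_zero' := by simp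
  map_add' O O' := Matrix.add_kronecker _ _ _
  commutes' c := by
    rw [Algebra.algebraMap_eq_smul_one, Matrix.smul_kronecker, Matrix.one_kronecker_one,
      Algebra.algebraMap_eq_smul_one]
  map_star' O := by
    simp [Matrix.star_eq_conjTranspose, Matrix.conjTranspose_kronecker]

/-- `O ↦ 1 ⊗ O`. -/
noncomputable def ampRight (X Z : Type) [Fintype X] [DecidableEq X] [Fintype Z] [DecidableEq Z] :
    Matrix Z Z ℂ →⋆ₐ[ℂ] Matrix (X × Z) (X × Z) ℂ where
  toFun O := Matrix.kroneckerMap (· * ·) 1 O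
  map_one' := Matrix.one_kronecker_one
  map_mul' O O' := by rw [← Matrix.mul_kronecker_mul, one_mul]
  map_zero' := by simp
  map_add' O O' := Matrix.kronecker_add _ _ _
  commutes' c := by
    rw [Algebra.algebraMap_eq_smul_one, Matrix.kronecker_smul, Matrix.one_kronecker_one,
      Algebra.algebraMap_eq_smul_one]
  map_star' O := by
    simp [Matrix.star_eq_conjTranspose, Matrix.conjTranspose_kronecker]

/-- `O ↦ U O U†`. -/
noncomputable def conjBy (U : Matrix X Z ℂ) (h : U.conjTranspose * U = 1)
    (h' : U * U.conjTranspose = 1) : Matrix Z Z ℂ →⋆ₐ[ℂ] Matrix X X ℂ where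
  toFun O := U * O * U.conjTranspose
  map_one' := by rw [Matrix.mul_one, h']
  map_mul' O O' := by
    calc U * (O * O') * U.conjTranspose
        = U * O * (1 : Matrix Z Z ℂ) * O' * U.conjTranspose := by
          simp only [Matrix.mul_one, Matrix.mul_assoc]
      _ = U * O * U.conjTranspose * (U * O' * U.conjTranspose) := by
          rw [← h]; simp only [Matrix.mul_assoc]
  map_zero' := by simp
  map_add' O O' := by rw [Matrix.mul_add, Matrix.add_mul]
  commutes' c := by
    simp [Algebra.algebraMap_eq_smul_one, h']
  map_star' O := by
    simp [Matrix.star_eq_conjTranspose, Matrix.conjTranspose_mul, Matrix.mul_assoc]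
end matrixHoms

/-- One new layer of the network in one wedge (on one side of the cut), with all its data: a finite
network of perfect tensors with `2 * m` legs of dimension `d`, in the opened-up form in which it is
a unitary circuit.
`b`, `b'` are the numbers of boundary legs of this side before and after the layer, `r` is the number
of new bonds across the cut; `Sum.inl`, `Sum.inr` below select the following legs where a value
enters the opened-up layer: `Fin b` (the previous boundary), `Fin nV` (bulk inputs, one per tensor),
`Fin nK × Bool` (the two ends of each opened internal bond), `Fin r` (this side of the new bonds
across the cut). -/
structure WedgeLayer (d m b r b' : ℕ) where
  /-- number of tensors -/
  nV : ℕ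
  /-- number of opened internal bonds -/
  nK : ℕ
  /-- the tensors -/
  tensor : Fin nV → (Fin (2 * m) → Fin d) → ℂ
  perfect : ∀ v, IsPerfect (tensor v)
  /-- which legs of each tensor are used as in-legs and which as out-legs -/
  legs : Fin nV → (Fin m ⊕ Fin m ≃ Fin (2 * m))
  /-- the connections: every in-leg of a tensor and every new boundary leg is connected to exactly one
  entering leg or out-leg of a tensor, and conversely -/
  plug : (Fin nV × Fin m) ⊕ Fin b' ≃
    (Fin b ⊕ ((Fin nV ⊕ (Fin nK × Bool)) ⊕ Fin r)) ⊕ (Fin nV × Fin m)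
  /-- the logical leg of each tensor, which is one of its in-legs and carries the bulk input -/
  logical : Fin nV → Fin m
  plug_logical : ∀ v, plug (Sum.inl (v, logical v)) = Sum.inl (Sum.inr (Sum.inl (Sum.inl v)))
  /-- both ends of an opened internal bond are legs of tensors of the layer -/
  anc_used : ∀ k, ∃ p, plug (Sum.inl p) = Sum.inl (Sum.inr (Sum.inl (Sum.inr k)))
  /-- a bond across the cut ends in a leg of a tensor of the layer -/
  rt_used : ∀ k, ∃ p, plug (Sum.inl p) = Sum.inl (Sum.inr (Sum.inr k))
  /-- the flow from in-legs to out-legs has no cycle -/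
  causal : ∃ rank : Fin nV → ℕ, ∀ v j u l,
    plug (Sum.inl (v, j)) = Sum.inr (u, l) → rank u < rank v

namespace WedgeLayer
variable {d m b r b' : ℕ} (L : WedgeLayer d m b r b')

/-- Basis labels of the bulk inputs and of the ancillas of the layer. -/
abbrev Fresh : Type := (Fin L.nV → Fin d) × (Fin L.nK × Bool → Fin d)
/-- Basis labels of (previous boundary) ⊗ (bulk inputs and ancillas) ⊗ (bonds across the cut). -/
abbrev Inp : Type := (Fin b → Fin d) × L.Fresh × (Fin r → Fin d)

instance : DecidableEq L.Fresh := inferInstance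
instance : DecidableEq (L.Fresh × (Fin r → Fin d)) := instDecidableEqProd
instance : DecidableEq L.Inp := instDecidableEqProd

/-- The values at the entering legs. -/
def legValue (x : L.Inp) : Fin b ⊕ ((Fin L.nV ⊕ (Fin L.nK × Bool)) ⊕ Fin r) → Fin d :=
  Sum.elim x.1 (Sum.elim (Sum.elim x.2.1.1 x.2.1.2) x.2.2)

/-- The matrix of the opened-up layer, from the entering legs to the new boundary. -/
noncomputable def network : Matrix (Fin b' → Fin d) L.Inp ℂ := fun y x =>
  contract (fun v => tensorMatrix (L.tensor v) (L.legs v)) L.plug y (L.legValue x)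

lemma legValue_injective : Function.Injective L.legValue := by
  rintro ⟨x, ⟨i, k⟩, p⟩ ⟨x', ⟨i', k'⟩, p'⟩ h
  have h1 : x = x' := funext fun a => congrFun h (Sum.inl a)
  have h2 : i = i' := funext fun a => congrFun h (Sum.inr (Sum.inl (Sum.inl a)))
  have h3 : k = k' := funext fun a => congrFun h (Sum.inr (Sum.inl (Sum.inr a)))
  have h4 : p = p' := funext fun a => congrFun h (Sum.inr (Sum.inr a))
  rw [h1, h2, h3, h4]

theorem network_isometry (hd : 0 < d) : L.network.conjTranspose * L.network = 1 := by
  ext x x'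
  rw [Matrix.mul_apply, Matrix.one_apply]
  have := contract_isometry hd (fun v => tensorMatrix (L.tensor v) (L.legs v))
    (fun v => L.perfect v (L.legs v)) L.plug L.causal (L.legValue x) (L.legValue x')
  rw [if_congr L.legValue_injective.eq_iff rfl rfl] at this
  exact this

theorem network_unitary (hd : 0 < d) : L.network * L.network.conjTranspose = 1 := by
  have hc : Fintype.card L.Inp = Fintype.card (Fin b' → Fin d) := by
    have h := Fintype.card_congr L.plug
    simp only [Fintype.card_sum, Fintype.card_prod, Fintype.card_fin, Fintype.card_bool] at h
    simp only [Fintype.card_prod, Fintype.card_fun, Fintype.card_fin,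
      Fintype.card_bool, ← pow_add]
    congr 1
    omega
  exact (Matrix.mul_eq_one_comm_of_equiv (Fintype.equivOfCardEq hc)).1 (L.network_isometry hd)

/-- The ancilla state: a maximally entangled pair in the two ends of each opened bond. -/
noncomputable def ancilla (k : Fin L.nK × Bool → Fin d) : ℂ :=
  ∏ a, if k (a, false) = k (a, true) then ((Real.sqrt d : ℝ) : ℂ)⁻¹ else 0

lemma inv_sqrt_sq (d : ℕ) :
    (starRingEnd ℂ) ((Real.sqrt d : ℝ) : ℂ)⁻¹ * ((Real.sqrt d : ℝ) : ℂ)⁻¹ = (d : ℂ)⁻¹ := by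
  rw [map_inv₀, Complex.conj_ofReal, ← mul_inv, ← Complex.ofReal_mul,
    Real.mul_self_sqrt (Nat.cast_nonneg d), Complex.ofReal_natCast]

lemma ancilla_norm (hd : 0 < d) : ∑ k, (starRingEnd ℂ) (L.ancilla k) * L.ancilla k = 1 := by
  have hd0 : (d : ℂ) ≠ 0 := by exact_mod_cast hd.ne'
  have h1 : ∀ k : Fin L.nK × Bool → Fin d, (starRingEnd ℂ) (L.ancilla k) * L.ancilla k =
      ∏ a, if k (a, false) = k (a, true) then (d : ℂ)⁻¹ else 0 := by
    intro k
    rw [ancilla, map_prod, ← Finset.prod_mul_distrib]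
    refine Finset.prod_congr rfl fun a _ => ?_
    split_ifs
    · exact inv_sqrt_sq d
    · simp
  simp only [h1]
  rw [← (Equiv.curry (Fin L.nK) Bool (Fin d)).symm.sum_comp]
  have h2 := Finset.prod_univ_sum (fun _ : Fin L.nK => (Finset.univ : Finset (Bool → Fin d)))
    (fun _ f => if f false = f true then (d : ℂ)⁻¹ else 0)
  rw [Fintype.piFinset_univ] at h2
  refine (h2.symm.trans ?_)
  refine Finset.prod_eq_one fun a _ => ?_
  rw [← (Equiv.boolArrowEquivProd (Fin d)).symm.sum_comp, Fintype.sum_prod_type]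
  simp [hd0]

end WedgeLayer

/-- The state of the bonds across the cut: a maximally entangled pair for each of them. -/
noncomputable def rtState {d r : ℕ} (p p' : Fin r → Fin d) : ℂ :=
  ∏ a, if p a = p' a then ((Real.sqrt d : ℝ) : ℂ)⁻¹ else 0

lemma rtState_norm {d r : ℕ} (hd : 0 < d) :
    ∑ p : Fin r → Fin d, ∑ p', (starRingEnd ℂ) (rtState p p') * rtState p p' = 1 := by
  have hd0 : (d : ℂ) ≠ 0 := by exact_mod_cast hd.ne'
  have h1 : ∀ p p' : Fin r → Fin d, (starRingEnd ℂ) (rtState p p') * rtState p p' =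
      if p = p' then ((d : ℂ)⁻¹) ^ r else 0 := by
    intro p p'
    rw [rtState, map_prod, ← Finset.prod_mul_distrib]
    by_cases h : p = p'
    · subst h; simp [← mul_inv, ← Complex.ofReal_mul]
    · rw [if_neg h]
      obtain ⟨a, ha⟩ := Function.ne_iff.1 h
      exact Finset.prod_eq_zero (Finset.mem_univ a) (by simp [ha])
  simp [h1, hd0]

/-- An infinite layered network of perfect tensors with a bipartition of the boundary into a region
`A` and its complement `B`, such that the network splits along a cut into two wedges, both of which
are unitary circuits at every layer when the bonds of the cut and some internal bonds are opened;
together with the reference states of the bulk inputs, which are product states between the wedges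
and between the layers. -/
structure LayeredCode (d m : ℕ) where
  two_le : 2 ≤ d
  /-- number of boundary legs in `A` after `n` layers -/
  bA : ℕ → ℕ
  /-- number of boundary legs in `B` after `n` layers -/
  bB : ℕ → ℕ
  bA_zero : bA 0 = 0
  bB_zero : bB 0 = 0
  /-- number of bonds by which the `n`-th growth step (from `n` to `n + 1` layers) extends the cut -/
  r : ℕ → ℕ
  wedgeA : ∀ n, WedgeLayer d m (bA n) (r n) (bA (n + 1))
  wedgeB : ∀ n, WedgeLayer d m (bB n) (r n) (bB (n + 1))
  /-- reference state of the new bulk inputs in the wedge of `A` -/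
  inA : ∀ n, EuclideanSpace ℂ (Fin (wedgeA n).nV → Fin d)
  /-- reference state of the new bulk inputs in the wedge of `B` -/
  inB : ∀ n, EuclideanSpace ℂ (Fin (wedgeB n).nV → Fin d)
  norm_inA : ∀ n, ‖inA n‖ = 1
  norm_inB : ∀ n, ‖inB n‖ = 1

namespace LayeredCode
variable {d m : ℕ} (C : LayeredCode d m)

lemma d_pos (C : LayeredCode d m) : 0 < d := lt_of_lt_of_le Nat.zero_lt_two C.two_le

/-- Basis labels of the boundary region `A` after `n` layers. -/
abbrev XA (n : ℕ) : Type := Fin (C.bA n) → Fin d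
/-- Basis labels of the boundary region `B` after `n` layers. -/
abbrev XB (n : ℕ) : Type := Fin (C.bB n) → Fin d
/-- The boundary Hilbert space after `n` layers. -/
abbrev Hilb (n : ℕ) : Type := EuclideanSpace ℂ (C.XA n × C.XB n)

/-- The coefficients of the state of all new degrees of freedom: bulk inputs, ancillas and bonds of the
cut, in both wedges. -/
noncomputable def freshState (n : ℕ) (x : (C.wedgeA n).Inp × (C.wedgeB n).Inp) : ℂ :=
  (C.inA n x.1.2.1.1 * C.inB n x.2.2.1.1) *
    ((C.wedgeA n).ancilla x.1.2.1.2 * (C.wedgeB n).ancilla x.2.2.1.2) * rtState x.1.2.2 x.2.2.2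

/-- The matrix of `ψ ↦ ψ ⊗ (state of the new degrees of freedom)`. -/
noncomputable def insertFresh (n : ℕ) :
    Matrix ((C.wedgeA n).Inp × (C.wedgeB n).Inp) (C.XA n × C.XB n) ℂ :=
  fun x a => if (x.1.1, x.2.1) = a then C.freshState n x else 0

/-- The matrix of the layer-to-layer map
`ψ ↦ (U_A ⊗ U_B) (ψ ⊗ (state of the new degrees of freedom))`. -/
noncomputable def growMatrix (n : ℕ) :
    Matrix (C.XA (n + 1) × C.XB (n + 1)) (C.XA n × C.XB n) ℂ :=
  Matrix.kroneckerMap (· * ·) (C.wedgeA n).network (C.wedgeB n).network * C.insertFresh n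

lemma sum_norm_sq {ι : Type} [Fintype ι] (v : EuclideanSpace ℂ ι) (hv : ‖v‖ = 1) :
    ∑ i, (starRingEnd ℂ) (v i) * v i = 1 := by
  have := EuclideanSpace.norm_sq_eq v
  rw [hv] at this
  have h : ∀ i, (starRingEnd ℂ) (v i) * v i = ((‖v i‖ ^ 2 : ℝ) : ℂ) := by
    intro i; rw [mul_comm, Complex.mul_conj, Complex.normSq_eq_norm_sq]
  simp only [h, ← Complex.ofReal_sum, ← this]
  simp

lemma sum_insert {P Q P' Q' : Type} [Fintype P] [Fintype Q] [Fintype P'] [Fintype Q']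
    [DecidableEq P] [DecidableEq P'] (a : P) (c : P') (F : (P × Q) × (P' × Q') → ℂ) :
    ∑ x : (P × Q) × (P' × Q'), (if (x.1.1, x.2.1) = (a, c) then F x else 0) =
      ∑ q, ∑ q', F ((a, q), (c, q')) := by
  simp only [Fintype.sum_prod_type, Prod.mk.injEq]
  rw [Fintype.sum_eq_single a]
  · refine Finset.sum_congr rfl fun q _ => ?_
    rw [Fintype.sum_eq_single c]
    · simp
    · intro x hx; simp [hx]
  · intro x hx; simp [hx]

lemma sum_triple {I K R : Type} [Fintype I] [Fintype K] [Fintype R]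
    (f : I → ℂ) (g : K → ℂ) (h : R → ℂ) :
    ∑ q : (I × K) × R, f q.1.1 * g q.1.2 * h q.2 = (∑ i, f i) * (∑ k, g k) * ∑ p, h p := by
  simp only [Fintype.sum_prod_type, ← Finset.mul_sum, ← Finset.sum_mul]

lemma sum_factor {I I' K K' R : Type} [Fintype I] [Fintype I'] [Fintype K] [Fintype K'] [Fintype R]
    (f : I → ℂ) (f' : I' → ℂ) (g : K → ℂ) (g' : K' → ℂ) (h : R → R → ℂ) :
    ∑ q : (I × K) × R, ∑ q' : (I' × K') × R,
      (f q.1.1 * f' q'.1.1) * (g q.1.2 * g' q'.1.2) * h q.2 q'.2 =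
    (∑ i, f i) * (∑ i, f' i) * (∑ k, g k) * (∑ k, g' k) * ∑ p, ∑ p', h p p' := by
  have h1 : ∀ q : (I × K) × R, ∑ q' : (I' × K') × R,
      (f q.1.1 * f' q'.1.1) * (g q.1.2 * g' q'.1.2) * h q.2 q'.2 =
      f q.1.1 * g q.1.2 * ((∑ i, f' i) * (∑ k, g' k) * ∑ p', h q.2 p') := by
    intro q
    rw [← sum_triple, Finset.mul_sum]
    exact Finset.sum_congr rfl fun q' _ => by ring
  simp only [h1]
  have h2 : ∀ q : (I × K) × R, f q.1.1 * g q.1.2 * ((∑ i, f' i) * (∑ k, g' k) * ∑ p', h q.2 p') =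
      ((∑ i, f' i) * (∑ k, g' k)) * (f q.1.1 * g q.1.2 * ∑ p', h q.2 p') := fun q => by ring
  simp only [h2]
  rw [← Finset.mul_sum, sum_triple f g (fun p => ∑ p', h p p')]
  ring

lemma insertFresh_isometry (n : ℕ) : (C.insertFresh n).conjTranspose * C.insertFresh n = 1 := by
  ext a a'
  rw [Matrix.mul_apply, Matrix.one_apply]
  have h1 : ∀ x, (C.insertFresh n).conjTranspose a x * C.insertFresh n x a' =
      if (x.1.1, x.2.1) = a then (if a = a' then
        (starRingEnd ℂ) (C.freshState n x) * C.freshState n x else 0) else 0 := by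
    intro x
    simp only [Matrix.conjTranspose_apply, insertFresh]
    by_cases h : (x.1.1, x.2.1) = a
    · subst h; by_cases h' : (x.1.1, x.2.1) = a' <;> simp [h']
    · simp [h]
  simp only [h1]
  by_cases haa : a = a'
  swap
  · simp [haa]
  subst haa
  obtain ⟨a, c⟩ := a
  simp only [if_true]
  rw [sum_insert]
  simp only [freshState, map_mul]
  have hA := sum_norm_sq _ (C.norm_inA n)
  have hB := sum_norm_sq _ (C.norm_inB n)
  have hKA := (C.wedgeA n).ancilla_norm C.d_pos
  have hKB := (C.wedgeB n).ancilla_norm C.d_pos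
  have hR := rtState_norm (r := C.r n) C.d_pos
  have := sum_factor (fun i => (starRingEnd ℂ) (C.inA n i) * C.inA n i)
    (fun i => (starRingEnd ℂ) (C.inB n i) * C.inB n i)
    (fun k => (starRingEnd ℂ) ((C.wedgeA n).ancilla k) * (C.wedgeA n).ancilla k)
    (fun k => (starRingEnd ℂ) ((C.wedgeB n).ancilla k) * (C.wedgeB n).ancilla k)
    (fun p p' : Fin (C.r n) → Fin d => (starRingEnd ℂ) (rtState p p') * rtState p p')
  rw [hA, hB, hKA, hKB, hR] at this
  simp only [mul_one] at this
  rw [← this]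
  refine Finset.sum_congr rfl fun q _ => Finset.sum_congr rfl fun q' _ => ?_
  ring

lemma growMatrix_isometry (n : ℕ) : (C.growMatrix n).conjTranspose * C.growMatrix n = 1 := by
  rw [growMatrix, Matrix.conjTranspose_mul, Matrix.conjTranspose_kronecker]
  calc _ = (C.insertFresh n).conjTranspose * (Matrix.kroneckerMap (· * ·)
        ((C.wedgeA n).network.conjTranspose * (C.wedgeA n).network)
        ((C.wedgeB n).network.conjTranspose * (C.wedgeB n).network)) * C.insertFresh n := by
        rw [Matrix.mul_kronecker_mul]; simp only [Matrix.mul_assoc]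
    _ = 1 := by
        rw [(C.wedgeA n).network_isometry C.d_pos, (C.wedgeB n).network_isometry C.d_pos,
          Matrix.one_kronecker_one, Matrix.mul_one, C.insertFresh_isometry]

/-- The layer-to-layer isometry. -/
noncomputable def grow (n : ℕ) : C.Hilb n →ₗᵢ[ℂ] C.Hilb (n + 1) where
  toLinearMap := (C.growMatrix n).toEuclideanLin
  norm_map' v := by
    have h : (C.growMatrix n).toEuclideanLin.adjoint ∘ₗ (C.growMatrix n).toEuclideanLin
        = LinearMap.id := by
      rw [← Matrix.toEuclideanLin_conjTranspose_eq_adjoint]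
      ext v : 1
      simp [Matrix.toLpLin_apply, Matrix.mulVec_mulVec, C.growMatrix_isometry]
    rw [norm_eq_sqrt_re_inner (𝕜 := ℂ), norm_eq_sqrt_re_inner (𝕜 := ℂ) v,
      ← LinearMap.adjoint_inner_left]
    have := congrArg (fun f => f v) h
    simp only [LinearMap.comp_apply, LinearMap.id_apply] at this
    rw [this]

/-- Operator pushing by one layer for operators on `A`: `O ↦ U_A (O ⊗ 1) U_A†`. -/
noncomputable def push (n : ℕ) :
    Matrix (C.XA n) (C.XA n) ℂ →⋆ₐ[ℂ] Matrix (C.XA (n + 1)) (C.XA (n + 1)) ℂ :=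
  (conjBy (C.wedgeA n).network ((C.wedgeA n).network_isometry C.d_pos)
    ((C.wedgeA n).network_unitary C.d_pos)).comp
    (ampLeft (C.XA n) ((C.wedgeA n).Fresh × (Fin (C.r n) → Fin d)))

/-- Operator pushing for operators on `A` from `n` layers to `k` layers. -/
noncomputable def pushFrom (n k : ℕ) (h : n ≤ k) :
    Matrix (C.XA n) (C.XA n) ℂ →⋆ₐ[ℂ] Matrix (C.XA k) (C.XA k) ℂ :=
  Nat.leRec (motive := fun k _ => Matrix (C.XA n) (C.XA n) ℂ →⋆ₐ[ℂ] Matrix (C.XA k) (C.XA k) ℂ)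
    (StarAlgHom.id ℂ _) (fun k _ f => (C.push k).comp f) h

/-- Operators on `A` as operators on the boundary Hilbert space: `O ↦ O ⊗ 1`. -/
noncomputable def localOp (n : ℕ) : Matrix (C.XA n) (C.XA n) ℂ →⋆ₐ[ℂ] (C.Hilb n →L[ℂ] C.Hilb n) :=
  (Matrix.toEuclideanCLM (n := C.XA n × C.XB n) (𝕜 := ℂ) : _ →⋆ₐ[ℂ] _).comp
    (ampLeft (C.XA n) (C.XB n))

lemma insertFresh_comm (n : ℕ) (O : Matrix (C.XA n) (C.XA n) ℂ) :
    Matrix.kroneckerMap (· * ·) (ampLeft (C.XA n) ((C.wedgeA n).Fresh × (Fin (C.r n) → Fin d)) O)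
      (1 : Matrix (C.wedgeB n).Inp (C.wedgeB n).Inp ℂ) * C.insertFresh n =
    C.insertFresh n * ampLeft (C.XA n) (C.XB n) O := by
  ext x a
  obtain ⟨⟨x, q⟩, ⟨y, q'⟩⟩ := x
  obtain ⟨a, c⟩ := a
  have hf : ∀ z z', C.freshState n ((z, q), (z', q')) = C.freshState n ((x, q), (y, q')) :=
    fun _ _ => rfl
  rw [Matrix.mul_apply, Matrix.mul_apply]
  rw [Fintype.sum_eq_single ((a, q), (c, q')), Fintype.sum_eq_single (x, y)]
  · simp only [insertFresh, if_true, Matrix.kroneckerMap_apply, ampLeft, StarAlgHom.coe_mk',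
      AlgHom.coe_mk, RingHom.coe_mk, MonoidHom.coe_mk, OneHom.coe_mk, Matrix.one_apply, hf a c,
      Prod.mk.injEq, and_true]
    ring
  · rintro ⟨z, z'⟩ hz
    have : ¬ (x, y) = (z, z') := fun h => hz h.symm
    simp only [insertFresh]
    rw [if_neg this, zero_mul]
  · rintro ⟨⟨z, p⟩, ⟨z', p'⟩⟩ hz
    simp only [insertFresh]
    by_cases h : (z, z') = (a, c)
    · obtain ⟨rfl, rfl⟩ := Prod.mk.inj h
      simp only [Matrix.kroneckerMap_apply, ampLeft, StarAlgHom.coe_mk',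
        AlgHom.coe_mk, RingHom.coe_mk, MonoidHom.coe_mk, OneHom.coe_mk, Matrix.one_apply]
      by_cases hq : q = p
      · by_cases hq' : (y, q') = (z', p')
        · obtain ⟨-, rfl⟩ := Prod.mk.inj hq'
          exact absurd (by rw [hq]) hz
        · rw [if_neg hq']; simp
      · rw [if_neg hq]; simp
    · rw [if_neg h, mul_zero]

lemma push_growMatrix (n : ℕ) (O : Matrix (C.XA n) (C.XA n) ℂ) :
    ampLeft (C.XA (n + 1)) (C.XB (n + 1)) (C.push n O) * C.growMatrix n =
      C.growMatrix n * ampLeft (C.XA n) (C.XB n) O := by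
  have h1 : ampLeft (C.XA (n + 1)) (C.XB (n + 1)) (C.push n O) =
      Matrix.kroneckerMap (· * ·) ((C.wedgeA n).network *
        ampLeft (C.XA n) ((C.wedgeA n).Fresh × (Fin (C.r n) → Fin d)) O *
        (C.wedgeA n).network.conjTranspose) (1 : Matrix (C.XB (n + 1)) (C.XB (n + 1)) ℂ) := rfl
  rw [h1, growMatrix, ← Matrix.mul_assoc, ← Matrix.mul_kronecker_mul, Matrix.mul_assoc _ _ (C.wedgeA n).network,
    (C.wedgeA n).network_isometry C.d_pos, Matrix.mul_one, Matrix.one_mul,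
    Matrix.mul_assoc, ← C.insertFresh_comm n O, ← Matrix.mul_assoc, ← Matrix.mul_kronecker_mul,
    Matrix.mul_one]

lemma push_grow (n : ℕ) (O : Matrix (C.XA n) (C.XA n) ℂ) (v : C.Hilb n) :
    C.localOp (n + 1) (C.push n O) (C.grow n v) = C.grow n (C.localOp n O v) := by
  have h := congrArg (fun M => Matrix.mulVec M v.ofLp) (C.push_growMatrix n O)
  simp only [← Matrix.mulVec_mulVec] at h
  exact congrArg (WithLp.toLp 2) h

/-- An operator on `A` after `n` layers, pushed to all later layers. -/
noncomputable def family (n : ℕ) (O : Matrix (C.XA n) (C.XA n) ℂ) (k : ℕ) :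
    C.Hilb k →L[ℂ] C.Hilb k :=
  if h : n ≤ k then C.localOp k (C.pushFrom n k h O) else 0

lemma family_compat (n : ℕ) (O : Matrix (C.XA n) (C.XA n) ℂ) :
    ∃ N, ∀ k, N ≤ k → ∀ v, C.family n O (k + 1) (C.grow k v) = C.grow k (C.family n O k v) := by
  refine ⟨n, fun k hk v => ?_⟩
  have h1 : C.pushFrom n (k + 1) (Nat.le_succ_of_le hk) = (C.push k).comp (C.pushFrom n k hk) :=
    Nat.leRec_succ _ _ _
  rw [family, family, dif_pos (Nat.le_succ_of_le hk), dif_pos hk, h1, ← C.push_grow]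
  rfl

open scoped Matrix.Norms.L2Operator in
lemma family_bound (n : ℕ) (O : Matrix (C.XA n) (C.XA n) ℂ) : ∃ B, ∀ k, ‖C.family n O k‖ ≤ B := by
  refine ⟨‖O‖, fun k => ?_⟩
  unfold family
  split_ifs with h
  · exact NonUnitalStarAlgHom.norm_apply_le ((C.localOp k).comp (C.pushFrom n k h)) O
  · simp

/-- The limit Hilbert space of the network. -/
abbrev LimitSpace : Type := IndLim.Limit C.grow

/-- The action on the limit Hilbert space of (the class of) an operator on `A` after `n` layers:
`[ψ] ↦ [O ψ]`, where `O` is pushed to the layer of `ψ` or `ψ` is embedded into the layer of `O`. -/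
noncomputable def limitOp (n : ℕ) (O : Matrix (C.XA n) (C.XA n) ℂ) :
    C.LimitSpace →L[ℂ] C.LimitSpace :=
  IndLim.op (C.family n O) (C.family_compat n O) (C.family_bound n O)

/-- The limit C*-algebra of the region `A`, represented on the limit Hilbert space: the norm closure
of the union of the algebras of operators on `A` after finitely many layers. -/
def regionCStar : Set (C.LimitSpace →L[ℂ] C.LimitSpace) := closure (⋃ n, Set.range (C.limitOp n))

/-- The von Neumann algebra of the boundary region `A` on the limit Hilbert space. -/
noncomputable def regionAlgebra : VonNeumannAlgebra C.LimitSpace := vnGen C.regionCStar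

/-- The boundary representation of an operator acting on the bulk inputs and ancillas which are added
in the wedge of `A` by the `n`-th growth step: `O ↦ U_A (1 ⊗ O ⊗ 1) U_A†`. -/
noncomputable def wedgeOp (n : ℕ) :
    Matrix (C.wedgeA n).Fresh (C.wedgeA n).Fresh ℂ →⋆ₐ[ℂ] Matrix (C.XA (n + 1)) (C.XA (n + 1)) ℂ :=
  (conjBy (C.wedgeA n).network ((C.wedgeA n).network_isometry C.d_pos)
    ((C.wedgeA n).network_unitary C.d_pos)).comp
    ((ampRight (C.XA n) ((C.wedgeA n).Fresh × (Fin (C.r n) → Fin d))).comp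
      (ampLeft (C.wedgeA n).Fresh (Fin (C.r n) → Fin d)))

/-- The boundary representation of an operator acting on the `A`-ends of the bonds which are added to
the cut by the `n`-th growth step: `O ↦ U_A (1 ⊗ 1 ⊗ O) U_A†`. -/
noncomputable def rtOp (n : ℕ) :
    Matrix (Fin (C.r n) → Fin d) (Fin (C.r n) → Fin d) ℂ →⋆ₐ[ℂ]
      Matrix (C.XA (n + 1)) (C.XA (n + 1)) ℂ :=
  (conjBy (C.wedgeA n).network ((C.wedgeA n).network_isometry C.d_pos)
    ((C.wedgeA n).network_unitary C.d_pos)).comp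
    ((ampRight (C.XA n) ((C.wedgeA n).Fresh × (Fin (C.r n) → Fin d))).comp
      (ampRight (C.wedgeA n).Fresh (Fin (C.r n) → Fin d)))

/-- The von Neumann algebra of the bulk inputs and ancillas in the wedge of `A`. -/
noncomputable def wedgeAlgebra : VonNeumannAlgebra C.LimitSpace :=
  vnGen (⋃ n, Set.range fun O => C.limitOp (n + 1) (C.wedgeOp n O))

/-- The von Neumann algebra of the cut (the RT surface), on the side of `A`. -/
noncomputable def rtAlgebra : VonNeumannAlgebra C.LimitSpace :=
  vnGen (⋃ n, Set.range fun O => C.limitOp (n + 1) (C.rtOp n O))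

end LayeredCode
end Happy

/-! Write Ω for `vac`, the product of all reference states, M for the bulk and ancilla algebra, N
for the algebra of the cut, A for the algebra that both generate. Two facts about Ω drive the proof.
In every layer a rank-one projection on the bulk and ancilla legs of A fixes Ω (`refProj_grow`),
because the state of these legs is pure. An operator at the A-ends of the bonds across the cut acts
on Ω like its transpose at the other ends (`rtOp_grow`), because the bonds are maximally entangled,
and this mirror operator commutes with A. Together with irreducibility of all operators on both
regions (`eq_smul_one_of_comm`) this is all that is needed; `LocalSystem` records it, and the
operator algebra is done there.

Factors: a central element commutes with bulk, cut and complementary region, so it is a scalar.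

Type I and the splitting: let p project onto L, the vectors fixed by all the rank-one projections.
Each p x p with x in M is a scalar multiple of p (`p_mul_mul_p`), so p is minimal in M. Moreover x ↦
x Ω is isometric on the left ideal M p; its image is K. Sending x Ω ⊗ l to x l for x in M p, l in L
preserves inner products (`inner_preW`) and has dense range (`denseRange_W`). Then M acts as B(K) ⊗
1, and the commutant of M, which contains N, acts on L alone.

Type II: mirroring yields ‖x* Ω‖ = ‖x Ω‖ for x in N and for x in p A p, and Ω separates both, so Ω
gives a faithful trace. Such a trace excludes equivalence with a proper subprojection. Since
infinitely many layers add bonds, matrix units of the cut split 1 into projections of arbitrarily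
small trace, and in a factor this excludes minimal projections. The criterion `isTypeII_of_trace`
gives type II₁ for N below the unit and type II for A below p. As K is infinite-dimensional, B(K)
contains a non-unitary isometry, so the unit of A is infinite.

Hyperfiniteness and separability come from the construction: A is generated by an increasing
sequence of images of matrix algebras, and the Hilbert space is a limit of finite-dimensional ones.
-/

namespace Happy
-- Von Neumann algebras: double commutants, invariant subspaces, minimal projections.
section vonNeumannLemmas
variable {H : Type} [NormedAddCommGroup H] [InnerProductSpace ℂ H] [CompleteSpace H]

lemma inner_star_left (T : H →L[ℂ] H) (x y : H) : inner ℂ (star T x) y = inner ℂ x (T y) :=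
  ContinuousLinearMap.adjoint_inner_left T y x

lemma inner_star_right (T : H →L[ℂ] H) (x y : H) : inner ℂ x (star T y) = inner ℂ (T x) y :=
  ContinuousLinearMap.adjoint_inner_right T x y

lemma norm_apply_sq (T : H →L[ℂ] H) (x : H) :
    ((‖T x‖ ^ 2 : ℝ) : ℂ) = inner ℂ x ((star T * T) x) := by
  rw [mul_apply_eq_comp, inner_star_right, inner_self_eq_norm_sq_to_K]
  push_cast; rfl

lemma norm_apply_eq_of_star_mul_self {T S : H →L[ℂ] H} (h : star T * T = star S * S) (x : H) :
    ‖T x‖ = ‖S x‖ := by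
  have h1 := norm_apply_sq T x
  rw [h, ← norm_apply_sq] at h1
  have h2 : ‖T x‖ ^ 2 = ‖S x‖ ^ 2 := by exact_mod_cast h1
  exact (sq_eq_sq₀ (norm_nonneg _) (norm_nonneg _)).1 h2

lemma mem_vnGen_iff {S : Set (H →L[ℂ] H)} {x : H →L[ℂ] H} :
    x ∈ vnGen S ↔ ∀ t, (∀ s ∈ S, s * t = t * s ∧ star s * t = t * star s) → t * x = x * t := by
  rw [← SetLike.mem_coe, coe_vnGen, Set.mem_centralizer_iff]
  refine forall_congr' fun t => ?_
  refine imp_congr_left ?_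
  rw [Set.mem_centralizer_iff]
  constructor
  · intro h s hs
    exact ⟨h s (Or.inl hs), h _ (Or.inr (by simpa using hs))⟩
  · rintro h s (hs | hs)
    · exact (h s hs).1
    · have := (h _ hs).2
      rwa [star_star] at this

lemma subset_vnGen (S : Set (H →L[ℂ] H)) : S ⊆ vnGen S := fun _ hx =>
  mem_vnGen_iff.2 fun _ ht => (ht _ hx).1.symm

lemma mem_commutant_vnGen_iff {S : Set (H →L[ℂ] H)} {t : H →L[ℂ] H} :
    t ∈ (vnGen S).commutant ↔ ∀ s ∈ S, s * t = t * s ∧ star s * t = t * star s := by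
  rw [VonNeumannAlgebra.mem_commutant_iff]
  constructor
  · exact fun h s hs => ⟨h s (subset_vnGen S hs), h _ (star_mem (subset_vnGen S hs))⟩
  · exact fun h g hg => (mem_vnGen_iff.1 hg t h).symm

lemma mem_of_commute_commutant {A : VonNeumannAlgebra H} {x : H →L[ℂ] H}
    (h : ∀ t ∈ A.commutant, t * x = x * t) : x ∈ A := by
  rw [← A.commutant_commutant, VonNeumannAlgebra.mem_commutant_iff]
  exact h

lemma smul_mem_vn {A : VonNeumannAlgebra H} (c : ℂ) {x : H →L[ℂ] H} (hx : x ∈ A) : c • x ∈ A :=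
  A.toStarSubalgebra.smul_mem hx c

/-- The C*-identity applies: (u - u p)* (u - u p) expands to p - p - p + p = 0. -/
lemma isStarProjection_of_star_mul_self_eq {u p : H →L[ℂ] H} (hp : IsStarProjection p)
    (h : star u * u = p) : u * p = u := by
  have h1 : star (u - u * p) * (u - u * p) = 0 := by
    have hpp : p * p = p := hp.isIdempotentElem
    rw [star_sub, star_mul, hp.isSelfAdjoint.star_eq]
    calc (star u - p * star u) * (u - u * p)
        = star u * u - star u * u * p - p * (star u * u) + p * (star u * u) * p := by noncomm_ring
      _ = 0 := by rw [h, hpp, hpp]; abel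
  exact (sub_eq_zero.1 (CStarRing.star_mul_self_eq_zero_iff _ |>.1 h1)).symm

lemma starProjection_mem {A : VonNeumannAlgebra H} (V : Submodule ℂ H) [V.HasOrthogonalProjection]
    (h : ∀ t ∈ A.commutant, ∀ v ∈ V, t v ∈ V) : V.starProjection ∈ A := by
  rw [VonNeumannAlgebra.IsStarProjection.mem_iff isStarProjection_starProjection]
  intro t ht
  have : V.starProjection.range = V := by simp
  rw [this]
  exact fun v hv => h t ht v hv

/-- A closed subspace which is invariant under a star-closed set of operators is invariant under the
von Neumann algebra that it generates. -/
lemma vnGen_invariant {S : Set (H →L[ℂ] H)} {V : Submodule ℂ H} (hV : IsClosed (V : Set H))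
    (h : ∀ s ∈ S, ∀ v ∈ V, s v ∈ V ∧ star s v ∈ V) {x : H →L[ℂ] H} (hx : x ∈ vnGen S)
    {v : H} (hv : v ∈ V) : x v ∈ V := by
  have : CompleteSpace V := hV.completeSpace_coe
  have hp : V.starProjection ∈ (vnGen S).commutant := by
    rw [mem_commutant_vnGen_iff]
    intro s hs
    have key : ∀ s : H →L[ℂ] H, (∀ v ∈ V, s v ∈ V ∧ star s v ∈ V) →
        s * V.starProjection = V.starProjection * s := by
      intro s hs
      -- Invariance of V under s reads P s P = s P for the projection P onto V. The same for s*,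
      -- after taking adjoints, reads P s P = P s, and the two together give commutation.
      have h1 : ∀ s : H →L[ℂ] H, (∀ v ∈ V, s v ∈ V) →
          V.starProjection * s * V.starProjection = s * V.starProjection := by
        intro s hs
        ext w
        exact Submodule.starProjection_eq_self_iff.2 (hs _ (V.starProjection_apply_mem w))
      have h2 := h1 s fun v hv => (hs v hv).1
      have h3 := congrArg star (h1 (star s) fun v hv => (hs v hv).2)
      simp only [star_mul, star_star, (isSelfAdjoint_starProjection V).star_eq] at h3
      rw [← h2, mul_assoc, h3]
    exact ⟨key s (h s hs), key (star s) fun v hv => by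
      rw [star_star]; exact (h s hs v hv).symm⟩
  have := (mem_vnGen_iff.1 hx _ (mem_commutant_vnGen_iff.1 hp))
  have h2 := congrArg (fun T : H →L[ℂ] H => T v) this
  simp only [mul_apply_eq_comp] at h2
  rw [Submodule.starProjection_eq_self_iff.2 hv] at h2
  exact Submodule.starProjection_eq_self_iff.1 h2

/-- If every vector is an eigenvector, the eigenvalue cannot depend on the vector. This turns
scalars found vector by vector into one scalar for an operator, as in p x p = c p. -/
lemma exists_eq_smul_of_forall_eigenvector (V : Submodule ℂ H) (T : H →L[ℂ] H)
    (h : ∀ v ∈ V, ∃ c : ℂ, T v = c • v) : ∃ c : ℂ, ∀ v ∈ V, T v = c • v := by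
  let f : V →ₗ[ℂ] V := T.toLinearMap.restrict (p := V) (q := V) (by
    intro v hv
    obtain ⟨c, hc⟩ := h v hv
    change T v ∈ V
    rw [hc]; exact V.smul_mem c hv)
  obtain ⟨a, ha⟩ := LinearMap.exists_eq_smul_id_of_forall_notLinearIndependent (f := f) (by
    intro v hli
    obtain ⟨c, hc⟩ := h v v.2
    have := LinearIndependent.pair_iff.1 hli c (-1) (by
      apply Subtype.ext
      change c • (v : H) + (-1 : ℂ) • T v = 0
      rw [hc]; simp)
    simp at this)
  refine ⟨a, fun v hv => ?_⟩
  have := congrArg Subtype.val (congrArg (fun g : V →ₗ[ℂ] V => g ⟨v, hv⟩) ha)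
  exact this

/-- With T = s* s the hypothesis says ‖s v‖² = 0. -/
lemma apply_eq_zero_of_nonneg {T : H →L[ℂ] H} (hT : 0 ≤ T) {v : H} (h : inner ℂ v (T v) = 0) :
    T v = 0 := by
  obtain ⟨s, rfl⟩ := CStarAlgebra.nonneg_iff_eq_star_mul_self.1 hT
  rw [← norm_apply_sq] at h
  have : s v = 0 := by simpa using h
  rw [mul_apply_eq_comp, this, map_zero]

/-- Whatever commutes with z commutes with its functional calculus; the double commutant does the
rest. -/
lemma posPart_mem {A : VonNeumannAlgebra H} {z : H →L[ℂ] H} (hz : z ∈ A) : z⁺ ∈ A := by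
  refine mem_of_commute_commutant fun t ht => ?_
  have h1 : Commute z t := VonNeumannAlgebra.mem_commutant_iff.1 ht z hz
  exact (h1.cfcₙ_real _).symm

/-- From z z⁺ = (z⁺)² one gets (1 - e)(z⁺)² = 0, which the C*-identity for z⁺ (1 - e) improves to (1
- e) z⁺ = 0. -/
lemma mul_posPart_eq {e z : H →L[ℂ] H} (he : IsStarProjection e) (hz : IsSelfAdjoint z)
    (h : e * z = z) : e * z⁺ = z⁺ := by
  have h1 : z * z⁺ = z⁺ * z⁺ := by
    have h0 := CFC.posPart_sub_negPart z hz
    calc z * z⁺ = (z⁺ - z⁻) * z⁺ := by rw [h0]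
      _ = z⁺ * z⁺ := by rw [sub_mul, CFC.negPart_mul_posPart, sub_zero]
  have h2 : (1 - e) * (z⁺ * z⁺) = 0 := by
    rw [← h1, ← mul_assoc, sub_mul, one_mul, h, sub_self, zero_mul]
  have hsa : star (z⁺) = z⁺ := (CFC.posPart_nonneg z).isSelfAdjoint.star_eq
  have h3 : star (z⁺ * (1 - e)) * (z⁺ * (1 - e)) = 0 := by
    rw [star_mul, hsa, star_sub, star_one, he.isSelfAdjoint.star_eq]
    calc (1 - e) * z⁺ * (z⁺ * (1 - e)) = (1 - e) * (z⁺ * z⁺) * (1 - e) := by noncomm_ring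
      _ = 0 := by rw [h2, zero_mul]
  have h4 := congrArg star ((CStarRing.star_mul_self_eq_zero_iff _).1 h3)
  rw [star_mul, hsa, star_sub, star_one, he.isSelfAdjoint.star_eq, star_zero, sub_mul, one_mul,
    sub_eq_zero] at h4
  exact h4.symm

/-- Below a minimal projection, one of the positive and negative parts vanishes. -/
lemma IsMinimalProj.posPart_eq_zero_or {A : VonNeumannAlgebra H} {e z : H →L[ℂ] H}
    (he : IsMinimalProj A e) (hzA : z ∈ A) (hz : IsSelfAdjoint z) (h : e * z = z) :
    z⁺ = 0 ∨ z⁻ = 0 := by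
  by_contra! hne
  have hp := mul_posPart_eq he.1.2 hz h
  have hn : e * z⁻ = z⁻ := by
    rw [← CFC.posPart_neg]
    exact mul_posPart_eq he.1.2 hz.neg (by rw [mul_neg, h])
  -- The projection onto V, the range projection of z⁺, lies in A and below e, so minimality makes
  -- it 0 or e. In the first case z⁺ = 0. In the second, z⁻ z⁺ = 0 gives z⁻ e = 0, hence z⁻ = 0.
  let V : Submodule ℂ H := (z⁺).range.topologicalClosure
  have : CompleteSpace V := (Submodule.isClosed_topologicalClosure _).completeSpace_coe
  have hVA : V.starProjection ∈ A := by
    refine starProjection_mem V fun t ht => ?_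
    have hc : ∀ v, t (z⁺ v) = z⁺ (t v) := fun v =>
      (congrArg (fun T : H →L[ℂ] H => T v)
        (VonNeumannAlgebra.mem_commutant_iff.1 ht _ (posPart_mem hzA))).symm
    have : V ≤ V.comap t.toLinearMap := by
      refine Submodule.topologicalClosure_minimal _ ?_ ?_
      · rintro _ ⟨v, rfl⟩
        exact Submodule.le_topologicalClosure _ ⟨t v, (hc v).symm⟩
      · exact (Submodule.isClosed_topologicalClosure _).preimage t.continuous
    exact this
  have hVe : e * V.starProjection = V.starProjection := by
    have : V ≤ (LinearMap.ker (e - 1 : H →L[ℂ] H).toLinearMap) := by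
      refine Submodule.topologicalClosure_minimal _ ?_ ?_
      · rintro _ ⟨v, rfl⟩
        have := congrArg (fun T : H →L[ℂ] H => T v) hp
        simpa [sub_eq_zero] using this
      · exact (e - 1 : H →L[ℂ] H).isClosed_ker
    ext v
    have h1 := this (V.starProjection_apply_mem v)
    simpa [sub_eq_zero] using h1
  rcases he.2.2 _ ⟨hVA, isStarProjection_starProjection⟩ hVe with h0 | h1
  · apply hne.1
    ext v
    have h2 : z⁺ v ∈ V := Submodule.le_topologicalClosure _ ⟨v, rfl⟩
    rw [← Submodule.starProjection_eq_self_iff.2 h2, h0]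
    rfl
  · apply hne.2
    have h2 : V ≤ LinearMap.ker (z⁻).toLinearMap := by
      refine Submodule.topologicalClosure_minimal _ ?_ (z⁻).isClosed_ker
      rintro _ ⟨v, rfl⟩
      exact congrArg (fun T : H →L[ℂ] H => T v) (CFC.negPart_mul_posPart z)
    have h3 : z⁻ * e = 0 := by
      ext v
      rw [← h1]
      exact h2 (V.starProjection_apply_mem v)
    have h4 := congrArg star h3
    rwa [star_mul, (CFC.negPart_nonneg z).isSelfAdjoint.star_eq, he.1.2.isSelfAdjoint.star_eq, hn,
      star_zero] at h4

/-- A minimal projection compresses the algebra to the scalars. -/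
lemma IsMinimalProj.exists_eq_smul {A : VonNeumannAlgebra H} {e x : H →L[ℂ] H}
    (he : IsMinimalProj A e) (hx : x ∈ A) : ∃ c : ℂ, e * x * e = c • e := by
  have hee : e * e = e := he.1.2.isIdempotentElem
  have hes : star e = e := he.1.2.isSelfAdjoint.star_eq
  have key : ∀ x ∈ A, IsSelfAdjoint x → ∃ c : ℂ, e * x * e = c • e := by
    intro x hx hxs
    have hyA : e * x * e ∈ A := mul_mem (mul_mem he.1.1 hx) he.1.1
    have hys : IsSelfAdjoint (e * x * e) := by
      rw [isSelfAdjoint_iff, star_mul, star_mul, hes, hxs.star_eq, mul_assoc]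
    have h1 : ∀ v ∈ e.range, ∃ c : ℂ, (e * x * e) v = c • v := by
      rintro v ⟨w, rfl⟩
      change ∃ c : ℂ, (e * x * e) (e w) = c • e w
      by_cases hv0 : e w = 0
      · exact ⟨0, by simp [hv0]⟩
      set v := e w with hv
      have hev : e v = v := congrArg (fun T : H →L[ℂ] H => T w) hee
      -- The Rayleigh quotient at v. It makes the expectation of z = e x e - c e at v vanish; as z
      -- has a definite sign below the minimal projection, z v = 0, so v is an eigenvector.
      let c : ℝ := (inner ℂ v ((e * x * e) v)).re / ‖v‖ ^ 2
      have hcc : inner ℂ v ((e * x * e) v) = ((c * ‖v‖ ^ 2 : ℝ) : ℂ) := by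
        have h0 : ‖v‖ ^ 2 ≠ 0 := by simpa using hv0
        have him : (inner ℂ v ((e * x * e) v)).im = 0 := by
          have : (starRingEnd ℂ) (inner ℂ v ((e * x * e) v)) = inner ℂ v ((e * x * e) v) := by
            rw [inner_conj_symm, ← inner_star_right, hys.star_eq]
          exact Complex.conj_eq_iff_im.1 this
        apply Complex.ext
        · rw [Complex.ofReal_re, div_mul_cancel₀ _ h0]
        · rw [Complex.ofReal_im, him]
      let z := e * x * e - (c : ℂ) • e
      have hzA : z ∈ A := sub_mem hyA (smul_mem_vn _ he.1.1)
      have hzs : IsSelfAdjoint z := by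
        rw [isSelfAdjoint_iff, star_sub, hys.star_eq, star_smul, hes]
        simp [z]
      have hez : e * z = z := by
        simp only [z, mul_sub, mul_smul_comm, hee, ← mul_assoc]
      have hz0 : inner ℂ v (z v) = 0 := by
        simp only [z, sub_apply, inner_sub_right, hcc,
          smul_apply, hev, inner_smul_right, inner_self_eq_norm_sq_to_K]
        push_cast
        exact sub_self _
      have hzv : z v = 0 := by
        have hd := CFC.posPart_sub_negPart z hzs
        rcases he.posPart_eq_zero_or hzA hzs hez with h | h
        · rw [h, zero_sub] at hd
          have h5 : z⁻ v = 0 := apply_eq_zero_of_nonneg (CFC.negPart_nonneg z) (by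
            rw [← hd] at hz0
            simpa using hz0)
          rw [← hd]; simp [h5]
        · rw [h, sub_zero] at hd
          rw [← hd]
          exact apply_eq_zero_of_nonneg (CFC.posPart_nonneg z) (by rw [hd]; exact hz0)
      refine ⟨c, ?_⟩
      have : (e * x * e) v - (c : ℂ) • e v = 0 := hzv
      rw [hev] at this
      exact sub_eq_zero.1 this
    obtain ⟨c, hc⟩ := exists_eq_smul_of_forall_eigenvector _ _ h1
    refine ⟨c, ?_⟩
    ext w
    have := hc (e w) ⟨w, rfl⟩
    rw [← mul_apply_eq_comp, mul_assoc, hee] at this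
    exact this
  obtain ⟨a, ha⟩ := key (x + star x) (add_mem hx (star_mem hx)) (IsSelfAdjoint.add_star_self x)
  obtain ⟨b, hb⟩ := key (Complex.I • (x - star x)) (smul_mem_vn _ (sub_mem hx (star_mem hx))) (by
    rw [isSelfAdjoint_iff, star_smul, star_sub, star_star]
    simp [smul_sub, neg_add_eq_sub])
  -- The constants a and b belong to the self-adjoint elements x + x* and i(x - x*), and x = ½((x +
  -- x*) - i · i(x - x*)).
  refine ⟨(1 / 2 : ℂ) * (a - Complex.I * b), ?_⟩
  have hx2 : x = (1 / 2 : ℂ) • ((x + star x) - Complex.I • (Complex.I • (x - star x))) := by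
    rw [smul_smul, Complex.I_mul_I, neg_one_smul, sub_neg_eq_add, add_add_sub_cancel, ← two_smul ℂ,
      smul_smul]
    norm_num
  conv_lhs => rw [hx2]
  rw [mul_smul_comm, smul_mul_assoc, mul_sub, sub_mul, ha, mul_smul_comm, smul_mul_assoc, hb,
    smul_smul, ← sub_smul, smul_smul]

/-- In a factor, two nonzero projections are connected by a nonzero element. -/
lemma IsFactor.exists_mul_mul_ne_zero {A : VonNeumannAlgebra H} (hA : IsFactor A)
    {p e : H →L[ℂ] H} (hpA : p ∈ A) (hp : p ≠ 0) (he : e ≠ 0) : ∃ x ∈ A, p * x * e ≠ 0 := by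
  by_contra! h
  -- The closed span of D is invariant under A and under its commutant, so its projection is
  -- central: it is the central support of e. In a factor it must be 1, whereas p A e = 0 would make
  -- p vanish on D.
  let D : Set H := {v | ∃ x ∈ A, ∃ t ∈ A.commutant, ∃ w, v = x (t (e w))}
  let V : Submodule ℂ H := (Submodule.span ℂ D).topologicalClosure
  have : CompleteSpace V := (Submodule.isClosed_topologicalClosure _).completeSpace_coe
  have hinv : ∀ y : H →L[ℂ] H, (∀ v ∈ D, y v ∈ D) → ∀ v ∈ V, y v ∈ V := by
    intro y hy
    have : V ≤ V.comap y.toLinearMap := by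
      refine Submodule.topologicalClosure_minimal _ ?_ ?_
      · rw [Submodule.span_le]
        exact fun v hv => Submodule.le_topologicalClosure _ (Submodule.subset_span (hy v hv))
      · exact (Submodule.isClosed_topologicalClosure _).preimage y.continuous
    exact this
  have hVA : V.starProjection ∈ A := by
    refine starProjection_mem V fun t ht => hinv t ?_
    rintro _ ⟨x, hx, s, hs, w, rfl⟩
    refine ⟨x, hx, t * s, mul_mem ht hs, w, ?_⟩
    exact (congrArg (fun T : H →L[ℂ] H => T (s (e w)))
      (VonNeumannAlgebra.mem_commutant_iff.1 ht x hx)).symm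
  have hVA' : V.starProjection ∈ A.commutant := by
    refine starProjection_mem V fun t ht => hinv t ?_
    rw [VonNeumannAlgebra.commutant_commutant] at ht
    rintro _ ⟨x, hx, s, hs, w, rfl⟩
    exact ⟨t * x, mul_mem ht hx, s, hs, w, rfl⟩
  obtain ⟨c, hc⟩ := hA _ hVA hVA'
  obtain ⟨w, hw⟩ : ∃ w, e w ≠ 0 := by
    by_contra! h0
    exact he (ContinuousLinearMap.ext h0)
  have hwV : e w ∈ V := Submodule.le_topologicalClosure _ (Submodule.subset_span
    ⟨1, one_mem _, 1, one_mem _, w, rfl⟩)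
  have hc1 : c = 1 := by
    have h1 := Submodule.starProjection_eq_self_iff.2 hwV
    rw [hc] at h1
    have h2 : (c - 1) • e w = 0 := by
      rw [sub_smul, one_smul, sub_eq_zero]; exact h1
    exact sub_eq_zero.1 ((smul_eq_zero.1 h2).resolve_right hw)
  have hVp : V ≤ LinearMap.ker p.toLinearMap := by
    refine Submodule.topologicalClosure_minimal _ ?_ p.isClosed_ker
    rw [Submodule.span_le]
    rintro _ ⟨x, hx, s, hs, w, rfl⟩
    have hxs := VonNeumannAlgebra.mem_commutant_iff.1 hs
    have hsx : x (s (e w)) = s (x (e w)) := congrArg (fun T : H →L[ℂ] H => T (e w)) (hxs x hx)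
    have hps : p (s (x (e w))) = s (p (x (e w))) :=
      congrArg (fun T : H →L[ℂ] H => T (x (e w))) (hxs p hpA)
    have hpx : p (x (e w)) = 0 := congrArg (fun T : H →L[ℂ] H => T w) (h x hx)
    change p (x (s (e w))) = 0
    rw [hsx, hps, hpx, map_zero]
  apply hp
  ext v
  apply hVp
  rw [← Submodule.starProjection_eq_self_iff, hc, hc1, one_smul]
  rfl

end vonNeumannLemmas
end Happy

/-! ### A trace criterion for type II. -/

namespace Happy
section typeII
variable {H : Type} [NormedAddCommGroup H] [InnerProductSpace ℂ H] [CompleteSpace H]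

lemma star_mul_self_of_isStarProjection {p : H →L[ℂ] H} (hp : IsStarProjection p) :
    star p * p = p := by
  rw [hp.isSelfAdjoint.star_eq]; exact hp.isIdempotentElem

lemma norm_le_one_of_star_mul_self {u p : H →L[ℂ] H} (hp : IsStarProjection p)
    (h : star u * u = p) : ‖u‖ ≤ 1 := by
  have h1 : ‖p‖ = ‖p‖ * ‖p‖ := by
    rw [← CStarRing.norm_star_mul_self, star_mul_self_of_isStarProjection hp]
  have h2 : ‖p‖ = ‖u‖ * ‖u‖ := by rw [← CStarRing.norm_star_mul_self, h]
  have h3 : ‖p‖ ≤ 1 := by nlinarith [norm_nonneg p]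
  nlinarith [norm_nonneg u]

/-- Testing the relation on a vector v with T v ≠ 0 shows c = (‖T v‖ / ‖e v‖)² > 0, so T can be
rescaled to a partial isometry. For minimal projections this replaces the polar decomposition. -/
lemma exists_smul_star_mul_self {T e : H →L[ℂ] H} {c : ℂ} (he : IsStarProjection e) (hT : T ≠ 0)
    (h : star T * T = c • e) : ∃ r : ℂ, star (r • T) * (r • T) = e := by
  obtain ⟨v, hv⟩ : ∃ v, T v ≠ 0 := by
    by_contra! h0
    exact hT (ContinuousLinearMap.ext h0)
  have h1 : ((‖T v‖ ^ 2 : ℝ) : ℂ) = c * ((‖e v‖ ^ 2 : ℝ) : ℂ) := by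
    rw [norm_apply_sq, norm_apply_sq, star_mul_self_of_isStarProjection he, h, smul_apply,
      inner_smul_right]
  have hTv : ‖T v‖ ≠ 0 := by simpa using hv
  have hev : ‖e v‖ ≠ 0 := by
    intro h0
    rw [h0] at h1
    simp at h1
    exact hv h1
  refine ⟨((‖e v‖ / ‖T v‖ : ℝ) : ℂ), ?_⟩
  have hc : c = (((‖T v‖ / ‖e v‖) ^ 2 : ℝ) : ℂ) := by
    have : ((‖e v‖ ^ 2 : ℝ) : ℂ) ≠ 0 := by exact_mod_cast pow_ne_zero 2 hev
    rw [div_pow, Complex.ofReal_div, h1, mul_div_cancel_right₀ _ this]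
  rw [star_smul, smul_mul_smul_comm, h, smul_smul, hc]
  have h2 : star ((‖e v‖ / ‖T v‖ : ℝ) : ℂ) = ((‖e v‖ / ‖T v‖ : ℝ) : ℂ) := Complex.conj_ofReal _
  rw [h2, ← Complex.ofReal_mul, ← Complex.ofReal_mul]
  have h3 : ‖e v‖ / ‖T v‖ * (‖e v‖ / ‖T v‖) * (‖T v‖ / ‖e v‖) ^ 2 = 1 := by
    field_simp
  rw [h3, Complex.ofReal_one, one_smul]

lemma isStarProjection_mul_star {u e : H →L[ℂ] H} (he : IsStarProjection e)
    (h : star u * u = e) : IsStarProjection (u * star u) := by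
  refine ⟨?_, ?_⟩
  · have := isStarProjection_of_star_mul_self_eq he h
    change u * star u * (u * star u) = u * star u
    calc u * star u * (u * star u) = u * (star u * u) * star u := by noncomm_ring
      _ = u * star u := by rw [h, this]
  · rw [isSelfAdjoint_iff, star_mul, star_star]

/-- A criterion for type II: below a projection `g` of the factor `A` there is a faithful tracial
vector, and the unit is a sum of projections which are small in the trace. -/
theorem isTypeII_of_trace {A : VonNeumannAlgebra H} (hA : IsFactor A) {g : H →L[ℂ] H}
    (hg : IsProj A g) {Ω : H} (hΩ : Ω ≠ 0) (hgΩ : g Ω = Ω)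
    (htr : ∀ x ∈ A, g * x = x → x * g = x → ‖star x Ω‖ = ‖x Ω‖)
    (hsep : ∀ x ∈ A, x * g = x → x Ω = 0 → x = 0)
    (hpart : ∀ ε : ℝ, 0 < ε → ∃ (ι : Type) (_ : Fintype ι) (f : ι → H →L[ℂ] H),
      (∀ i, f i ∈ A ∧ IsStarProjection (f i) ∧ g * f i = f i * g ∧ ‖f i Ω‖ ≤ ε) ∧ ∑ i, f i = 1) :
    IsTypeII A ∧ IsFiniteProj A g := by
  have hg0 : g ≠ 0 := by
    rintro rfl; exact hΩ hgΩ.symm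
  have hgg : g * g = g := hg.2.isIdempotentElem
  have hgs : star g = g := hg.2.isSelfAdjoint.star_eq
  have hfin : IsFiniteProj A g := by
    refine ⟨hg, ?_⟩
    rintro q hq hgq ⟨u, hu, hug, huq⟩
    have h1 : u * g = u := isStarProjection_of_star_mul_self_eq hg.2 hug
    have h2 : q * u = u := by rw [← huq, mul_assoc, hug, h1]
    have h3 : g * u = u := by rw [← h2, ← mul_assoc, hgq]
    have hqg : q * g = q := by
      have := congrArg star hgq
      rwa [star_mul, hgs, hq.2.isSelfAdjoint.star_eq] at this
    -- The trace property along u: ‖q Ω‖ = ‖u* Ω‖ = ‖u Ω‖ = ‖g Ω‖. With q ≤ g this forces (g - q) Ω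
    -- = 0, and Ω separates.
    have h4 : ‖q Ω‖ = ‖g Ω‖ := by
      rw [← norm_apply_eq_of_star_mul_self (T := u) (S := g), ← htr u hu h3 h1]
      · refine norm_apply_eq_of_star_mul_self ?_ _
        rw [star_star, huq, star_mul_self_of_isStarProjection hq.2]
      · rw [hug, star_mul_self_of_isStarProjection hg.2]
    have h5 : star (g - q) * (g - q) = g - q := by
      have hqq : q * q = q := hq.2.isIdempotentElem
      rw [star_sub, hgs, hq.2.isSelfAdjoint.star_eq, mul_sub, sub_mul, sub_mul, hgg, hgq, hqg, hqq]
      abel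
    have h6 := norm_apply_sq (g - q) Ω
    rw [h5, sub_apply, inner_sub_right] at h6
    rw [← star_mul_self_of_isStarProjection hg.2, ← norm_apply_sq, star_mul_self_of_isStarProjection hg.2,
      ← star_mul_self_of_isStarProjection hq.2, ← norm_apply_sq, star_mul_self_of_isStarProjection hq.2,
      h4, sub_self] at h6
    have h7 : (g - q) Ω = 0 := by
      rw [sub_apply]
      simpa using h6
    exact (sub_eq_zero.1 (hsep _ (sub_mem hg.1 hq.1) (by rw [sub_mul, hgg, hqg]) h7)).symm
  refine ⟨⟨hA, ?_, g, hg0, hfin⟩, hfin⟩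
  intro e he
  -- A minimal projection e of the factor is moved below g, where the trace is available: a multiple
  -- u of g x e has u* u = e, and q = u u* again compresses A to scalars.
  obtain ⟨x, hx, hne⟩ := hA.exists_mul_mul_ne_zero hg.1 hg0 he.2.1
  have hes : star e = e := he.1.2.isSelfAdjoint.star_eq
  obtain ⟨c, hc⟩ := he.exists_eq_smul (mul_mem (mul_mem (star_mem hx) hg.1) hx)
  obtain ⟨r, hr⟩ := exists_smul_star_mul_self he.1.2 hne (c := c) (by
    rw [← hc, star_mul, star_mul, hes, hgs]
    calc e * (star x * g) * (g * x * e) = e * (star x * (g * g) * x) * e := by noncomm_ring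
      _ = _ := by rw [hgg])
  set u := r • (g * x * e) with hu
  have huA : u ∈ A := smul_mem_vn _ (mul_mem (mul_mem hg.1 hx) he.1.1)
  have hgu : g * u = u := by
    rw [hu, mul_smul_comm, ← mul_assoc, ← mul_assoc, hgg]
  set q := u * star u with hq
  have hqp : IsStarProjection q := isStarProjection_mul_star he.1.2 hr
  have hqA : q ∈ A := mul_mem huA (star_mem huA)
  have hgq : g * q = q := by rw [hq, ← mul_assoc, hgu]
  have hqg : q * g = q := by
    have := congrArg star hgq
    rwa [star_mul, hgs, hqp.isSelfAdjoint.star_eq] at this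
  have hue : u * e = u := isStarProjection_of_star_mul_self_eq he.1.2 hr
  have hq0 : q ≠ 0 := by
    intro h0
    have : u = 0 := by
      rw [← hue, ← hr, ← mul_assoc, ← hq, h0, zero_mul]
    rw [this, mul_zero] at hr
    exact he.2.1 hr.symm
  have hqmin : ∀ y ∈ A, ∃ c : ℂ, q * y * q = c • q := by
    intro y hy
    obtain ⟨c, hc⟩ := he.exists_eq_smul (mul_mem (mul_mem (star_mem huA) hy) huA)
    refine ⟨c, ?_⟩
    have heu : e * star u = star u := by
      have := congrArg star hue
      rwa [star_mul, hes] at this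
    calc q * y * q = u * star u * y * (u * star u) := rfl
      _ = (u * e) * star u * y * (u * (e * star u)) := by rw [hue, heu]
      _ = u * (e * (star u * y * u) * e) * star u := by noncomm_ring
      _ = c • q := by rw [hc, mul_smul_comm, smul_mul_assoc, hue]
  apply hq0
  refine hsep q hqA hqg ?_
  rw [← norm_le_zero_iff]
  refine le_of_forall_pos_le_add fun ε hε => ?_
  rw [zero_add]
  obtain ⟨ι, _, f, hf, hsum⟩ := hpart ε hε
  -- Some member of the partition meets q. A multiple v of f i * q then has v* v = q, and v lies in
  -- g A g because f i commutes with g. The trace property gives ‖q Ω‖ = ‖v* f i Ω‖ ≤ ε; since ε is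
  -- arbitrary, q Ω = 0.
  obtain ⟨i, hi⟩ : ∃ i, q * f i * q ≠ 0 := by
    by_contra! h0
    have : q = ∑ i, q * f i * q := by
      rw [← Finset.sum_mul, ← Finset.mul_sum, hsum, mul_one]; exact hqp.isIdempotentElem.symm
    rw [this] at hq0
    exact hq0 (Finset.sum_eq_zero fun i _ => h0 i)
  obtain ⟨hfA, hfp, hfg, hfε⟩ := hf i
  have hff : f i * f i = f i := hfp.isIdempotentElem
  have hT : f i * q ≠ 0 := by
    intro h0
    rw [mul_assoc, h0, mul_zero] at hi
    exact hi rfl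
  obtain ⟨c', hc'⟩ := hqmin (f i) hfA
  obtain ⟨r', hr'⟩ := exists_smul_star_mul_self hqp hT (c := c') (by
    rw [← hc', star_mul, hqp.isSelfAdjoint.star_eq, hfp.isSelfAdjoint.star_eq]
    calc q * f i * (f i * q) = q * (f i * f i) * q := by noncomm_ring
      _ = _ := by rw [hff])
  set v := r' • (f i * q) with hv
  have hvA : v ∈ A := smul_mem_vn _ (mul_mem hfA hqA)
  have hgv : g * v = v := by rw [hv, mul_smul_comm, ← mul_assoc, hfg, mul_assoc, hgq]
  have hvg : v * g = v := by rw [hv, smul_mul_assoc, mul_assoc, hqg]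
  have hfv : f i * v = v := by rw [hv, mul_smul_comm, ← mul_assoc, hff]
  have hvf : star v * f i = star v := by
    have := congrArg star hfv
    rwa [star_mul, hfp.isSelfAdjoint.star_eq] at this
  calc ‖q Ω‖ = ‖v Ω‖ := norm_apply_eq_of_star_mul_self (by
        rw [hr', star_mul_self_of_isStarProjection hqp]) _
    _ = ‖star v (f i Ω)‖ := by
        rw [← htr v hvA hgv hvg, ← mul_apply_eq_comp, hvf]
    _ ≤ ‖star v‖ * ‖f i Ω‖ := ContinuousLinearMap.le_opNorm _ _
    _ ≤ 1 * ε := by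
        refine mul_le_mul ?_ hfε (norm_nonneg _) zero_le_one
        rw [norm_star]
        exact norm_le_one_of_star_mul_self hqp hr'
    _ = ε := one_mul ε

end typeII
end Happy

/-! ### Local systems: factors, the minimal projection, and the trace. -/

namespace Happy
section closedSpan
variable {H : Type} [NormedAddCommGroup H] [InnerProductSpace ℂ H]

/-- The closed linear span of a set of vectors. -/
noncomputable def cspan (D : Set H) : Submodule ℂ H := (Submodule.span ℂ D).topologicalClosure

lemma isClosed_cspan (D : Set H) : IsClosed (cspan D : Set H) :=
  Submodule.isClosed_topologicalClosure _

lemma subset_cspan (D : Set H) : D ⊆ cspan D :=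
  Submodule.subset_span.trans (Submodule.le_topologicalClosure _)

lemma cspan_le {D : Set H} {V : Submodule ℂ H} (hV : IsClosed (V : Set H)) (h : D ⊆ V) :
    cspan D ≤ V := Submodule.topologicalClosure_minimal _ (Submodule.span_le.2 h) hV

lemma cspan_map {D : Set H} {V : Submodule ℂ H} (hV : IsClosed (V : Set H)) (y : H →L[ℂ] H)
    (h : ∀ v ∈ D, y v ∈ V) {v : H} (hv : v ∈ cspan D) : y v ∈ V := by
  have : cspan D ≤ V.comap y.toLinearMap := cspan_le (hV.preimage y.continuous) h
  exact this hv

end closedSpan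

/-- Commuting families of star algebras `bulk n`, `cut n` on a Hilbert space with a vector `Ω`. The
algebras `bulk n` have minimal projections that fix `Ω`, the algebras `cut n` are maximally entangled
in `Ω` with the remaining operators `rest`, and all operators together act irreducibly. -/
structure LocalSystem (H : Type) [NormedAddCommGroup H] [InnerProductSpace ℂ H]
    [CompleteSpace H] where
  bulk : ℕ → StarSubalgebra ℂ (H →L[ℂ] H)
  cut : ℕ → StarSubalgebra ℂ (H →L[ℂ] H)
  rest : Set (H →L[ℂ] H)
  Ω : H
  q : ℕ → H →L[ℂ] H
  rest_star : ∀ T ∈ rest, star T ∈ rest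
  bulk_comm : ∀ n k, n ≠ k → ∀ x ∈ bulk n, ∀ y ∈ bulk k, x * y = y * x
  cut_comm : ∀ n k, n ≠ k → ∀ x ∈ cut n, ∀ y ∈ cut k, x * y = y * x
  bulk_cut_comm : ∀ n k, ∀ x ∈ bulk n, ∀ y ∈ cut k, x * y = y * x
  bulk_rest_comm : ∀ n, ∀ x ∈ bulk n, ∀ T ∈ rest, x * T = T * x
  cut_rest_comm : ∀ n, ∀ x ∈ cut n, ∀ T ∈ rest, x * T = T * x
  irreducible : ∀ S : H →L[ℂ] H, (∀ n, ∀ x ∈ bulk n, x * S = S * x) →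
    (∀ n, ∀ x ∈ cut n, x * S = S * x) → (∀ T ∈ rest, T * S = S * T) → ∃ c : ℂ, S = c • 1
  mirror : ∀ n, ∀ y ∈ cut n, ∃ T ∈ rest, T Ω = y Ω ∧ star T Ω = star y Ω
  q_mem : ∀ n, q n ∈ bulk n
  q_proj : ∀ n, IsStarProjection (q n)
  q_min : ∀ n, ∀ x ∈ bulk n, ∃ c : ℂ, q n * x * q n = c • q n
  q_fix : ∀ n, q n Ω = Ω
  norm_Ω : ‖Ω‖ = 1

namespace LocalSystem
variable {H : Type} [NormedAddCommGroup H] [InnerProductSpace ℂ H] [CompleteSpace H]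
variable (S : LocalSystem H)

/-- The von Neumann algebra generated by the bulk algebras. -/
noncomputable def M : VonNeumannAlgebra H := vnGen (⋃ n, (S.bulk n : Set (H →L[ℂ] H)))

/-- The von Neumann algebra generated by the cut algebras. -/
noncomputable def N : VonNeumannAlgebra H := vnGen (⋃ n, (S.cut n : Set (H →L[ℂ] H)))

/-- The von Neumann algebra generated by the bulk and cut algebras. -/
noncomputable def A : VonNeumannAlgebra H :=
  vnGen ((⋃ n, (S.bulk n : Set (H →L[ℂ] H))) ∪ ⋃ n, (S.cut n : Set (H →L[ℂ] H)))

variable {S}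

lemma vnGen_mono {X Y : Set (H →L[ℂ] H)} (h : X ⊆ Y) {x : H →L[ℂ] H} (hx : x ∈ vnGen X) :
    x ∈ vnGen Y :=
  mem_vnGen_iff.2 fun t ht => mem_vnGen_iff.1 hx t fun s hs => ht s (h hs)

lemma M_le_A {x : H →L[ℂ] H} (hx : x ∈ S.M) : x ∈ S.A := vnGen_mono Set.subset_union_left hx
lemma N_le_A {x : H →L[ℂ] H} (hx : x ∈ S.N) : x ∈ S.A := vnGen_mono Set.subset_union_right hx
lemma bulk_le_M {n : ℕ} {x : H →L[ℂ] H} (hx : x ∈ S.bulk n) : x ∈ S.M :=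
  subset_vnGen _ (Set.mem_iUnion.2 ⟨n, hx⟩)
lemma cut_le_N {n : ℕ} {x : H →L[ℂ] H} (hx : x ∈ S.cut n) : x ∈ S.N :=
  subset_vnGen _ (Set.mem_iUnion.2 ⟨n, hx⟩)

lemma mem_M_commutant {t : H →L[ℂ] H} (h : ∀ n, ∀ x ∈ S.bulk n, x * t = t * x) :
    t ∈ S.M.commutant := by
  refine mem_commutant_vnGen_iff.2 fun s hs => ?_
  obtain ⟨n, hn⟩ := Set.mem_iUnion.1 hs
  exact ⟨h n s hn, h n _ (star_mem hn)⟩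

lemma mem_N_commutant {t : H →L[ℂ] H} (h : ∀ n, ∀ x ∈ S.cut n, x * t = t * x) :
    t ∈ S.N.commutant := by
  refine mem_commutant_vnGen_iff.2 fun s hs => ?_
  obtain ⟨n, hn⟩ := Set.mem_iUnion.1 hs
  exact ⟨h n s hn, h n _ (star_mem hn)⟩

lemma mem_A_commutant {t : H →L[ℂ] H} (h : ∀ n, ∀ x ∈ S.bulk n, x * t = t * x)
    (h' : ∀ n, ∀ x ∈ S.cut n, x * t = t * x) : t ∈ S.A.commutant := by
  refine mem_commutant_vnGen_iff.2 fun s hs => ?_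
  rcases hs with hs | hs
  · obtain ⟨n, hn⟩ := Set.mem_iUnion.1 hs
    exact ⟨h n s hn, h n _ (star_mem hn)⟩
  · obtain ⟨n, hn⟩ := Set.mem_iUnion.1 hs
    exact ⟨h' n s hn, h' n _ (star_mem hn)⟩

lemma commutant_comm {B : VonNeumannAlgebra H} {t x : H →L[ℂ] H} (ht : t ∈ B.commutant)
    (hx : x ∈ B) : x * t = t * x := VonNeumannAlgebra.mem_commutant_iff.1 ht x hx

lemma commutant_comm_apply {B : VonNeumannAlgebra H} {t x : H →L[ℂ] H} (ht : t ∈ B.commutant)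
    (hx : x ∈ B) (v : H) : x (t v) = t (x v) :=
  congrArg (fun T : H →L[ℂ] H => T v) (commutant_comm ht hx)

lemma rest_mem_A_commutant {T : H →L[ℂ] H} (hT : T ∈ S.rest) : T ∈ S.A.commutant :=
  mem_A_commutant (fun n x hx => S.bulk_rest_comm n x hx T hT)
    fun n x hx => S.cut_rest_comm n x hx T hT

lemma A_commutant_le_N {t : H →L[ℂ] H} (ht : t ∈ S.A.commutant) : t ∈ S.N.commutant :=
  VonNeumannAlgebra.mem_commutant_iff.2 fun _ hx => commutant_comm ht (N_le_A hx)

lemma A_commutant_le_M {t : H →L[ℂ] H} (ht : t ∈ S.A.commutant) : t ∈ S.M.commutant :=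
  VonNeumannAlgebra.mem_commutant_iff.2 fun _ hx => commutant_comm ht (M_le_A hx)

lemma cut_le_M_commutant {n : ℕ} {y : H →L[ℂ] H} (hy : y ∈ S.cut n) : y ∈ S.M.commutant :=
  mem_M_commutant fun k x hx => S.bulk_cut_comm k n x hx y hy

lemma bulk_le_N_commutant {n : ℕ} {x : H →L[ℂ] H} (hx : x ∈ S.bulk n) : x ∈ S.N.commutant :=
  mem_N_commutant fun k y hy => (S.bulk_cut_comm n k x hx y hy).symm

lemma N_le_M_commutant {y : H →L[ℂ] H} (hy : y ∈ S.N) : y ∈ S.M.commutant :=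
  mem_M_commutant fun _ _ hx => (commutant_comm (bulk_le_N_commutant hx) hy).symm

/-- A central element of B commutes both with B and with its commutant, hence with all operators of
the system, and irreducibility makes it a scalar. -/
lemma isFactor_of {B : VonNeumannAlgebra H} (h1 : ∀ n, ∀ x ∈ S.bulk n, x ∈ B ∨ x ∈ B.commutant)
    (h2 : ∀ n, ∀ x ∈ S.cut n, x ∈ B ∨ x ∈ B.commutant) (h3 : ∀ T ∈ S.rest, T ∈ B.commutant) :
    IsFactor B := by
  intro z hz hz'
  have key : ∀ x, x ∈ B ∨ x ∈ B.commutant → x * z = z * x := by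
    rintro x (hx | hx)
    · exact commutant_comm hz' hx
    · exact (commutant_comm hx hz).symm
  exact S.irreducible z (fun n x hx => key x (h1 n x hx)) (fun n x hx => key x (h2 n x hx))
    fun T hT => key T (Or.inr (h3 T hT))

theorem isFactor_M : IsFactor S.M :=
  isFactor_of (fun _ _ hx => Or.inl (bulk_le_M hx)) (fun _ _ hx => Or.inr (cut_le_M_commutant hx))
    fun _ hT => A_commutant_le_M (rest_mem_A_commutant hT)

theorem isFactor_N : IsFactor S.N :=
  isFactor_of (fun _ _ hx => Or.inr (bulk_le_N_commutant hx)) (fun _ _ hx => Or.inl (cut_le_N hx))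
    fun _ hT => A_commutant_le_N (rest_mem_A_commutant hT)

theorem isFactor_A : IsFactor S.A :=
  isFactor_of (fun _ _ hx => Or.inl (M_le_A (bulk_le_M hx)))
    (fun _ _ hx => Or.inl (N_le_A (cut_le_N hx))) fun _ hT => rest_mem_A_commutant hT

lemma Ω_ne_zero : S.Ω ≠ 0 := by
  intro h
  have := S.norm_Ω
  rw [h, norm_zero] at this
  exact zero_ne_one this

/-- `Ω` is cyclic for all operators of the system. -/
lemma mem_of_invariant {V : Submodule ℂ H} (hV : IsClosed (V : Set H)) (hΩ : S.Ω ∈ V)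
    (h1 : ∀ n, ∀ x ∈ S.bulk n, ∀ v ∈ V, x v ∈ V) (h2 : ∀ n, ∀ x ∈ S.cut n, ∀ v ∈ V, x v ∈ V)
    (h3 : ∀ T ∈ S.rest, ∀ v ∈ V, T v ∈ V) (v : H) : v ∈ V := by
  let X : Set (H →L[ℂ] H) := (⋃ n, (S.bulk n : Set (H →L[ℂ] H))) ∪
    (⋃ n, (S.cut n : Set (H →L[ℂ] H))) ∪ S.rest
  -- This rank-one operator maps Ω to v. By irreducibility the operators of the system have only
  -- scalars in their commutant, so they generate every bounded operator, this one included.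
  let x : H →L[ℂ] H := (innerSL ℂ S.Ω).smulRight v
  have hx : x ∈ vnGen X := by
    refine mem_vnGen_iff.2 fun t ht => ?_
    obtain ⟨c, rfl⟩ := S.irreducible t
      (fun n x hx => (ht x (Or.inl (Or.inl (Set.mem_iUnion.2 ⟨n, hx⟩)))).1)
      (fun n x hx => (ht x (Or.inl (Or.inr (Set.mem_iUnion.2 ⟨n, hx⟩)))).1)
      (fun x hx => (ht x (Or.inr hx)).1)
    rw [smul_mul_assoc, mul_smul_comm, one_mul, mul_one]
  have := vnGen_invariant hV (S := X) (by
    rintro s ((hs | hs) | hs) v hv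
    · obtain ⟨n, hn⟩ := Set.mem_iUnion.1 hs
      exact ⟨h1 n s hn v hv, h1 n _ (star_mem hn) v hv⟩
    · obtain ⟨n, hn⟩ := Set.mem_iUnion.1 hs
      exact ⟨h2 n s hn v hv, h2 n _ (star_mem hn) v hv⟩
    · exact ⟨h3 s hs v hv, h3 _ (S.rest_star s hs) v hv⟩) hx hΩ
  have hxΩ : x S.Ω = v := by
    simp [x, inner_self_eq_norm_sq_to_K, S.norm_Ω]
  rwa [hxΩ] at this

variable (S) in
/-- The vectors that are fixed by all the projections `q n`. -/
noncomputable def L : Submodule ℂ H := ⨅ n, LinearMap.ker (S.q n - 1 : H →L[ℂ] H).toLinearMap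

lemma mem_L {v : H} : v ∈ S.L ↔ ∀ n, S.q n v = v := by
  simp [L, Submodule.mem_iInf, sub_eq_zero]

lemma isClosed_L : IsClosed (S.L : Set H) := by
  rw [L, Submodule.coe_iInf]
  exact isClosed_iInter fun n => (S.q n - 1 : H →L[ℂ] H).isClosed_ker

instance : CompleteSpace S.L := isClosed_L.completeSpace_coe

variable (S) in
/-- The projection onto the vectors fixed by all `q n`. -/
noncomputable def p : H →L[ℂ] H := S.L.starProjection

lemma p_proj : IsStarProjection S.p := isStarProjection_starProjection
lemma p_mul_p : S.p * S.p = S.p := p_proj.isIdempotentElem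
lemma star_p : star S.p = S.p := p_proj.isSelfAdjoint.star_eq
lemma p_apply_mem (v : H) : S.p v ∈ S.L := S.L.starProjection_apply_mem v
lemma p_apply {v : H} (hv : v ∈ S.L) : S.p v = v := Submodule.starProjection_eq_self_iff.2 hv
lemma Ω_mem_L : S.Ω ∈ S.L := mem_L.2 S.q_fix
lemma p_Ω : S.p S.Ω = S.Ω := p_apply Ω_mem_L

/-- The commutant of M commutes with each q n and therefore preserves L. -/
lemma p_mem_M : S.p ∈ S.M := by
  refine starProjection_mem _ fun t ht v hv => mem_L.2 fun n => ?_
  rw [commutant_comm_apply ht (bulk_le_M (S.q_mem n)), mem_L.1 hv n]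

lemma q_mul_p (n : ℕ) : S.q n * S.p = S.p := by
  ext v
  exact mem_L.1 (p_apply_mem v) n

lemma p_mul_q (n : ℕ) : S.p * S.q n = S.p := by
  have := congrArg star (q_mul_p (S := S) n)
  rwa [star_mul, star_p, (S.q_proj n).isSelfAdjoint.star_eq] at this

variable (S) in
/-- Linear combinations of products of elements of the first `n` bulk algebras. -/
noncomputable def word : ℕ → Submodule ℂ (H →L[ℂ] H)
  | 0 => 1
  | n + 1 => word n * Subalgebra.toSubmodule (S.bulk n).toSubalgebra

lemma word_induction {n : ℕ} {C : (H →L[ℂ] H) → Prop} {w : H →L[ℂ] H} (hw : w ∈ S.word (n + 1))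
    (hm : ∀ w ∈ S.word n, ∀ x ∈ S.bulk n, C (w * x)) (ha : ∀ x y, C x → C y → C (x + y)) : C w :=
  Submodule.mul_induction_on hw hm ha

lemma mul_mem_word {n : ℕ} {w x : H →L[ℂ] H} (hw : w ∈ S.word n) (hx : x ∈ S.bulk n) :
    w * x ∈ S.word (n + 1) := Submodule.mul_mem_mul hw hx

lemma word_comm (n : ℕ) : ∀ w ∈ S.word n, ∀ k, n ≤ k → ∀ x ∈ S.bulk k, x * w = w * x := by
  induction n with
  | zero =>
    intro w hw k _ x _
    obtain ⟨c, rfl⟩ := Submodule.mem_one.1 hw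
    exact (Algebra.commutes c x).symm
  | succ n ih =>
    intro w hw k hk x hx
    refine word_induction (C := fun w => x * w = w * x) hw (fun w hw y hy => ?_) fun a b ha hb => ?_
    · rw [← mul_assoc, ih w hw k (by omega) x hx, mul_assoc, mul_assoc,
        S.bulk_comm k n (by omega) x hx y hy]
    · rw [mul_add, add_mul, ha, hb]

lemma word_succ {n : ℕ} {w : H →L[ℂ] H} (hw : w ∈ S.word n) : w ∈ S.word (n + 1) := by
  have := mul_mem_word hw (one_mem (S.bulk n))
  rwa [mul_one] at this

lemma word_mono {n k : ℕ} (h : n ≤ k) {w : H →L[ℂ] H} (hw : w ∈ S.word n) : w ∈ S.word k := by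
  induction k, h using Nat.le_induction with
  | base => exact hw
  | succ k _ ih => exact word_succ ih

/-- Different bulk algebras commute, so a new factor can be moved to its own place in the ordered
product. This makes the vectors w v, with w a word, span an M-invariant subspace. -/
lemma bulk_mul_word (n : ℕ) : ∀ i < n, ∀ x ∈ S.bulk i, ∀ w ∈ S.word n, x * w ∈ S.word n := by
  induction n with
  | zero => intro i hi; omega
  | succ n ih =>
    intro i hi x hx w hw
    refine word_induction (C := fun w => x * w ∈ S.word (n + 1)) hw (fun w hw y hy => ?_)
      fun a b ha hb => ?_
    · rcases Nat.lt_succ_iff_lt_or_eq.1 hi with h | rfl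
      · rw [← mul_assoc]
        exact mul_mem_word (ih i h x hx w hw) hy
      · rw [← mul_assoc, word_comm i w hw i le_rfl x hx, mul_assoc]
        exact mul_mem_word hw (mul_mem hx hy)
    · rw [mul_add]; exact add_mem ha hb

/-- Factors are stripped off from the last one. Since p absorbs q n and q n commutes with the
earlier letters w, p w y p = p w (q n y q n) p, and the bracket is a multiple of q n, which p
absorbs again. -/
lemma p_mul_word_mul_p (n : ℕ) : ∀ w ∈ S.word n, ∃ c : ℂ, S.p * w * S.p = c • S.p := by
  induction n with
  | zero =>
    intro w hw
    obtain ⟨c, rfl⟩ := Submodule.mem_one.1 hw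
    exact ⟨c, by rw [Algebra.algebraMap_eq_smul_one, mul_smul_comm, smul_mul_assoc, mul_one, p_mul_p]⟩
  | succ n ih =>
    intro w hw
    refine word_induction (C := fun w => ∃ c : ℂ, S.p * w * S.p = c • S.p) hw
      (fun w hw y hy => ?_) ?_
    · obtain ⟨c, hc⟩ := ih w hw
      obtain ⟨b, hb⟩ := S.q_min n y hy
      refine ⟨b * c, ?_⟩
      calc S.p * (w * y) * S.p = S.p * S.q n * (w * y) * (S.q n * S.p) := by
            rw [p_mul_q, q_mul_p]
        _ = S.p * (S.q n * w) * y * S.q n * S.p := by noncomm_ring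
        _ = S.p * w * (S.q n * y * S.q n) * S.p := by
            rw [word_comm n w hw n le_rfl _ (S.q_mem n)]; noncomm_ring
        _ = (b * c) • S.p := by
            rw [hb, mul_smul_comm, smul_mul_assoc, mul_assoc _ (S.q n), q_mul_p, hc, smul_smul]
    · rintro x y ⟨a, ha⟩ ⟨b, hb⟩
      exact ⟨a + b, by rw [mul_add, add_mul, ha, hb, add_smul]⟩

/-- Words are extended to M one vector at a time. For v in L the closed span of all w v is
M-invariant, so it contains x v; p sends each w v into the line of v, which is closed, hence also x
v. The eigenvector lemma then makes the scalar independent of v. -/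
lemma p_mul_mul_p {x : H →L[ℂ] H} (hx : x ∈ S.M) : ∃ c : ℂ, S.p * x * S.p = c • S.p := by
  have h1 : ∀ v ∈ S.L, ∃ c : ℂ, (S.p * x) v = c • v := by
    intro v hv
    let D : Set H := {u | ∃ n, ∃ w ∈ S.word n, u = w v}
    have hD : ∀ n, ∀ y ∈ S.bulk n, ∀ u ∈ cspan D, y u ∈ cspan D := by
      intro n y hy u hu
      refine cspan_map (isClosed_cspan D) y ?_ hu
      rintro _ ⟨k, w, hw, rfl⟩
      refine subset_cspan D ⟨max k (n + 1), y * w, ?_, rfl⟩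
      exact bulk_mul_word _ n (by omega) y hy w (word_mono (le_max_left _ _) hw)
    have hxv : x v ∈ cspan D := by
      refine vnGen_invariant (isClosed_cspan D) ?_ hx
        (subset_cspan D ⟨0, 1, Submodule.one_le.1 le_rfl, rfl⟩)
      intro s hs u hu
      obtain ⟨n, hn⟩ := Set.mem_iUnion.1 hs
      exact ⟨hD n s hn u hu, hD n _ (star_mem hn) u hu⟩
    have : S.p (x v) ∈ (ℂ ∙ v) := by
      refine cspan_map (Submodule.closed_of_finiteDimensional _) S.p ?_ hxv
      rintro _ ⟨k, w, hw, rfl⟩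
      obtain ⟨c, hc⟩ := p_mul_word_mul_p k w hw
      have := congrArg (fun T : H →L[ℂ] H => T v) hc
      simp only [mul_apply_eq_comp, smul_apply, p_apply hv] at this
      rw [this]
      exact Submodule.smul_mem _ _ (Submodule.mem_span_singleton_self v)
    obtain ⟨c, hc⟩ := Submodule.mem_span_singleton.1 this
    exact ⟨c, hc.symm⟩
  obtain ⟨c, hc⟩ := exists_eq_smul_of_forall_eigenvector _ _ h1
  refine ⟨c, ?_⟩
  ext v
  exact hc _ (p_apply_mem v)

lemma p_ne_zero : S.p ≠ 0 := by
  intro h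
  have := p_Ω (S := S)
  rw [h] at this
  exact Ω_ne_zero this.symm

theorem isMinimalProj_p : IsMinimalProj S.M S.p := by
  refine ⟨⟨p_mem_M, p_proj⟩, p_ne_zero, fun e he hpe => ?_⟩
  obtain ⟨c, hc⟩ := p_mul_mul_p he.1
  have hep : e * S.p = e := by
    have := congrArg star hpe
    rwa [star_mul, star_p, he.2.isSelfAdjoint.star_eq] at this
  rw [hpe, hep] at hc
  have h1 : e * e = e := he.2.isIdempotentElem
  rw [hc, smul_mul_smul_comm, p_mul_p] at h1
  have h2 : (c * c - c) • S.p = 0 := by rw [sub_smul, h1, sub_self]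
  have h3 : c * (c - 1) = 0 := by
    have := (smul_eq_zero.1 h2).resolve_right p_ne_zero
    linear_combination this
  rcases mul_eq_zero.1 h3 with h | h
  · left; rw [hc, h, zero_smul]
  · right; rw [hc, sub_eq_zero.1 h, one_smul]

theorem isTypeI_M : IsTypeI S.M := ⟨isFactor_M, _, isMinimalProj_p⟩

/-- The vectors m t Ω, with m in M and t in the commutant of A, are total: a cut operator is moved
through m and t to Ω and replaced by its mirror there. On them x m t Ω = x p m p t Ω = c x t Ω = c t
x Ω = 0. -/
lemma eq_zero_of_mem_A {x : H →L[ℂ] H} (hx : x ∈ S.A) (hxp : x * S.p = x) (hxΩ : x S.Ω = 0) :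
    x = 0 := by
  let D : Set H := {v | ∃ m ∈ S.M, ∃ t ∈ S.A.commutant, v = m (t S.Ω)}
  have hall : ∀ v, v ∈ cspan D := by
    refine mem_of_invariant (S := S) (isClosed_cspan D)
      (subset_cspan D ⟨1, one_mem _, 1, one_mem _, rfl⟩) ?_ ?_ ?_
    · intro n y hy v hv
      refine cspan_map (isClosed_cspan D) y ?_ hv
      rintro _ ⟨m, hm, t, ht, rfl⟩
      exact subset_cspan D ⟨y * m, mul_mem (bulk_le_M hy) hm, t, ht, rfl⟩
    · intro n y hy v hv
      refine cspan_map (isClosed_cspan D) y ?_ hv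
      rintro _ ⟨m, hm, t, ht, rfl⟩
      obtain ⟨T, hT, hTΩ, -⟩ := S.mirror n y hy
      refine subset_cspan D ⟨m, hm, t * T, mul_mem ht (rest_mem_A_commutant hT), ?_⟩
      rw [← commutant_comm_apply (cut_le_M_commutant hy) hm,
        commutant_comm_apply ht (N_le_A (cut_le_N hy)), ← hTΩ]
      rfl
    · intro T hT v hv
      refine cspan_map (isClosed_cspan D) T ?_ hv
      rintro _ ⟨m, hm, t, ht, rfl⟩
      refine subset_cspan D ⟨m, hm, T * t, mul_mem (rest_mem_A_commutant hT) ht, ?_⟩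
      rw [← commutant_comm_apply (A_commutant_le_M (rest_mem_A_commutant hT)) hm]
      rfl
  have hle : cspan D ≤ LinearMap.ker x.toLinearMap := by
    refine cspan_le x.isClosed_ker ?_
    rintro _ ⟨m, hm, t, ht, rfl⟩
    obtain ⟨c, hc⟩ := p_mul_mul_p hm
    have h1 : S.p (m (S.p (t S.Ω))) = c • S.p (t S.Ω) :=
      congrArg (fun T : H →L[ℂ] H => T (t S.Ω)) hc
    have h2 : S.p (t S.Ω) = t S.Ω := by
      rw [commutant_comm_apply ht (M_le_A p_mem_M), p_Ω]
    rw [h2] at h1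
    have h3 : ∀ v, x (S.p v) = x v := fun v => congrArg (fun T : H →L[ℂ] H => T v) hxp
    change x (m (t S.Ω)) = 0
    rw [← h3, h1, map_smul, commutant_comm_apply ht hx, hxΩ, map_zero, smul_zero]
  ext v
  exact hle (hall v)

/-- Ω is cyclic for the commutant of N: this contains bulk and rest, and cut operators acting at Ω
can be replaced by mirrors. A cyclic vector of the commutant separates N. -/
lemma eq_zero_of_mem_N {x : H →L[ℂ] H} (hx : x ∈ S.N) (hxΩ : x S.Ω = 0) : x = 0 := by
  let D : Set H := {v | ∃ t ∈ S.N.commutant, v = t S.Ω}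
  have hN' : ∀ y ∈ S.N.commutant, ∀ v ∈ cspan D, y v ∈ cspan D := by
    intro y hy v hv
    refine cspan_map (isClosed_cspan D) y ?_ hv
    rintro _ ⟨t, ht, rfl⟩
    exact subset_cspan D ⟨y * t, mul_mem hy ht, rfl⟩
  have hall : ∀ v, v ∈ cspan D := by
    refine mem_of_invariant (S := S) (isClosed_cspan D)
      (subset_cspan D ⟨1, one_mem _, rfl⟩) ?_ ?_ ?_
    · exact fun n y hy => hN' y (bulk_le_N_commutant hy)
    · intro n y hy v hv
      refine cspan_map (isClosed_cspan D) y ?_ hv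
      rintro _ ⟨t, ht, rfl⟩
      obtain ⟨T, hT, hTΩ, -⟩ := S.mirror n y hy
      refine subset_cspan D ⟨t * T, mul_mem ht (A_commutant_le_N (rest_mem_A_commutant hT)), ?_⟩
      rw [commutant_comm_apply ht (cut_le_N hy), ← hTΩ]
      rfl
    · exact fun T hT => hN' T (A_commutant_le_N (rest_mem_A_commutant hT))
  have hle : cspan D ≤ LinearMap.ker x.toLinearMap := by
    refine cspan_le x.isClosed_ker ?_
    rintro _ ⟨t, ht, rfl⟩
    change x (t S.Ω) = 0
    rw [commutant_comm_apply ht hx, hxΩ, map_zero]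
  ext v
  exact hle (hall v)

variable (S) in
/-- `y` acts on `Ω` in the same way as some operator of the commutant. -/
def Mirrored (y : H →L[ℂ] H) : Prop :=
  y ∈ S.N ∧ ∃ T ∈ S.A.commutant, T S.Ω = y S.Ω ∧ star T S.Ω = star y S.Ω

lemma Mirrored.add {x y : H →L[ℂ] H} (hx : S.Mirrored x) (hy : S.Mirrored y) :
    S.Mirrored (x + y) := by
  obtain ⟨hx, T, hT, h1, h2⟩ := hx
  obtain ⟨hy, T', hT', h1', h2'⟩ := hy
  exact ⟨add_mem hx hy, T + T', add_mem hT hT', by simp [h1, h1'], by simp [h2, h2']⟩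

lemma Mirrored.smul {x : H →L[ℂ] H} (hx : S.Mirrored x) (c : ℂ) : S.Mirrored (c • x) := by
  obtain ⟨hx, T, hT, h1, h2⟩ := hx
  exact ⟨smul_mem_vn c hx, c • T, smul_mem_vn c hT, by simp [h1], by simp [star_smul, h2]⟩

lemma mirrored_one : S.Mirrored 1 := ⟨one_mem _, 1, one_mem _, rfl, rfl⟩

/-- Mirroring reverses the order of products: z y Ω = z T Ω = T z Ω = T T' Ω. -/
lemma Mirrored.cut_mul {y z : H →L[ℂ] H} {n : ℕ} (hz : z ∈ S.cut n) (hy : S.Mirrored y) :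
    S.Mirrored (z * y) := by
  obtain ⟨hy, T, hT, h1, h2⟩ := hy
  obtain ⟨T', hT', h1', h2'⟩ := S.mirror n z hz
  have hT'A := rest_mem_A_commutant hT'
  refine ⟨mul_mem (cut_le_N hz) hy, T * T', mul_mem hT hT'A, ?_, ?_⟩
  · rw [mul_apply_eq_comp, mul_apply_eq_comp, h1', ← h1,
      commutant_comm_apply hT (N_le_A (cut_le_N hz))]
  · rw [star_mul, star_mul, mul_apply_eq_comp, mul_apply_eq_comp, h2, ← h2',
      commutant_comm_apply (star_mem hT'A) (N_le_A (star_mem hy))]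

/-- The trace property at its source: with the mirror T of y, ⟨y Ω, y Ω⟩ = ⟨Ω, y* T Ω⟩ = ⟨Ω, T y* Ω⟩
= ⟨y* Ω, y* Ω⟩. -/
lemma Mirrored.norm_star_apply {y : H →L[ℂ] H} (hy : S.Mirrored y) :
    ‖star y S.Ω‖ = ‖y S.Ω‖ := by
  obtain ⟨hy, T, hT, h1, h2⟩ := hy
  have h3 : inner ℂ (y S.Ω) (y S.Ω) = inner ℂ (star y S.Ω) (star y S.Ω) := by
    calc inner ℂ (y S.Ω) (y S.Ω) = inner ℂ S.Ω (star y (T S.Ω)) := by rw [inner_star_right, h1]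
      _ = inner ℂ (star y S.Ω) (star y S.Ω) := by
        rw [commutant_comm_apply hT (N_le_A (star_mem hy)), ← inner_star_left, h2]
  rw [inner_self_eq_norm_sq_to_K, inner_self_eq_norm_sq_to_K] at h3
  have h4 : ‖star y S.Ω‖ ^ 2 = ‖y S.Ω‖ ^ 2 := by exact_mod_cast h3.symm
  exact (sq_eq_sq₀ (norm_nonneg _) (norm_nonneg _)).1 h4

variable (S) in
/-- The vectors `y Ω` with mirrored `y`. -/
noncomputable def mirrorSpace : Submodule ℂ H where
  carrier := {v | ∃ y, S.Mirrored y ∧ v = y S.Ω}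
  zero_mem' := ⟨0, by simpa using (mirrored_one (S := S)).smul 0, by simp⟩
  add_mem' := by
    rintro _ _ ⟨y, hy, rfl⟩ ⟨z, hz, rfl⟩
    exact ⟨y + z, hy.add hz, rfl⟩
  smul_mem' := by
    rintro c v ⟨y, hy, rfl⟩
    exact ⟨c • y, hy.smul c, rfl⟩

lemma isClosed_mirror (S : LocalSystem H) : IsClosed (S.mirrorSpace.topologicalClosure : Set H) :=
  Submodule.isClosed_topologicalClosure _

/-- The adjoint is not strongly continuous, so the trace property does not pass to limits directly.
Pairing does: for mirrored y, ⟨x* Ω, y Ω⟩ = ⟨y* Ω, x Ω⟩, which is bounded by ‖x Ω‖ ‖y Ω‖. The bound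
extends to the closure of these y Ω and is then evaluated at x* Ω itself. -/
lemma norm_star_apply_le {x : H →L[ℂ] H} (hx : x ∈ S.A)
    (h : star x S.Ω ∈ S.mirrorSpace.topologicalClosure) : ‖star x S.Ω‖ ≤ ‖x S.Ω‖ := by
  have h1 : ∀ v ∈ S.mirrorSpace.topologicalClosure,
      ‖inner ℂ (star x S.Ω) v‖ ≤ ‖x S.Ω‖ * ‖v‖ := by
    have hcl : IsClosed {v : H | ‖inner ℂ (star x S.Ω) v‖ ≤ ‖x S.Ω‖ * ‖v‖} :=
      isClosed_le (by fun_prop) (by fun_prop)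
    refine closure_minimal ?_ hcl
    rintro _ ⟨y, hy, rfl⟩
    have h2 := hy.norm_star_apply
    obtain ⟨-, T, hT, h3, h4⟩ := hy
    have h5 : inner ℂ (star x S.Ω) (y S.Ω) = inner ℂ (star y S.Ω) (x S.Ω) := by
      rw [inner_star_left, ← h3, commutant_comm_apply hT hx, ← inner_star_left, h4]
    change ‖inner ℂ (star x S.Ω) (y S.Ω)‖ ≤ _
    rw [h5, ← h2, mul_comm]
    exact norm_inner_le_norm _ _
  have h2 := h1 _ h
  rw [inner_self_eq_norm_sq_to_K] at h2
  by_contra! hlt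
  have h3 : 0 < ‖star x S.Ω‖ := lt_of_le_of_lt (norm_nonneg _) hlt
  have h4 : ‖star x S.Ω‖ ^ 2 ≤ ‖x S.Ω‖ * ‖star x S.Ω‖ := by simpa using h2
  nlinarith

lemma apply_Ω_mem_of_mem_N {x : H →L[ℂ] H} (hx : x ∈ S.N) :
    x S.Ω ∈ S.mirrorSpace.topologicalClosure := by
  have h1 : ∀ n, ∀ z ∈ S.cut n, ∀ v ∈ S.mirrorSpace.topologicalClosure,
      z v ∈ S.mirrorSpace.topologicalClosure := by
    intro n z hz
    have : S.mirrorSpace.topologicalClosure ≤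
        S.mirrorSpace.topologicalClosure.comap z.toLinearMap := by
      refine Submodule.topologicalClosure_minimal _ ?_ ((isClosed_mirror S).preimage z.continuous)
      rintro _ ⟨y, hy, rfl⟩
      exact Submodule.le_topologicalClosure _ ⟨z * y, hy.cut_mul hz, rfl⟩
    exact this
  refine vnGen_invariant (isClosed_mirror S) ?_ hx
    (Submodule.le_topologicalClosure _ ⟨1, mirrored_one, rfl⟩)
  intro s hs v hv
  obtain ⟨n, hn⟩ := Set.mem_iUnion.1 hs
  exact ⟨h1 n s hn v hv, h1 n _ (star_mem hn) v hv⟩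

/-- The vectors w y Ω, with w in M and y mirrored, span an A-invariant subspace whose closure
contains x Ω. As y Ω lies in L, p w y Ω = p w p y Ω = c y Ω: the projection removes the bulk part.
-/
lemma p_apply_Ω_mem_of_mem_A {x : H →L[ℂ] H} (hx : x ∈ S.A) :
    S.p (x S.Ω) ∈ S.mirrorSpace.topologicalClosure := by
  let D : Set H := {v | ∃ w ∈ S.M, ∃ y, S.Mirrored y ∧ v = w (y S.Ω)}
  have hb : ∀ n, ∀ z ∈ S.bulk n, ∀ v ∈ cspan D, z v ∈ cspan D := by
    intro n z hz v hv
    refine cspan_map (isClosed_cspan D) z ?_ hv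
    rintro _ ⟨w, hw, y, hy, rfl⟩
    exact subset_cspan D ⟨z * w, mul_mem (bulk_le_M hz) hw, y, hy, rfl⟩
  have hc : ∀ n, ∀ z ∈ S.cut n, ∀ v ∈ cspan D, z v ∈ cspan D := by
    intro n z hz v hv
    refine cspan_map (isClosed_cspan D) z ?_ hv
    rintro _ ⟨w, hw, y, hy, rfl⟩
    refine subset_cspan D ⟨w, hw, z * y, hy.cut_mul hz, ?_⟩
    rw [← commutant_comm_apply (cut_le_M_commutant hz) hw]
    rfl
  have hxΩ : x S.Ω ∈ cspan D := by
    refine vnGen_invariant (isClosed_cspan D) ?_ hx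
      (subset_cspan D ⟨1, one_mem _, 1, mirrored_one, rfl⟩)
    rintro s (hs | hs) v hv
    · obtain ⟨n, hn⟩ := Set.mem_iUnion.1 hs
      exact ⟨hb n s hn v hv, hb n _ (star_mem hn) v hv⟩
    · obtain ⟨n, hn⟩ := Set.mem_iUnion.1 hs
      exact ⟨hc n s hn v hv, hc n _ (star_mem hn) v hv⟩
  refine cspan_map (isClosed_mirror S) S.p ?_ hxΩ
  rintro _ ⟨w, hw, y, hy, rfl⟩
  obtain ⟨c, hc⟩ := p_mul_mul_p hw
  have h1 : S.p (w (S.p (y S.Ω))) = c • S.p (y S.Ω) :=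
    congrArg (fun T : H →L[ℂ] H => T (y S.Ω)) hc
  have h2 : S.p (y S.Ω) = y S.Ω := by
    rw [commutant_comm_apply (N_le_M_commutant hy.1) p_mem_M, p_Ω]
  rw [h2] at h1
  rw [h1]
  exact Submodule.smul_mem _ _ (Submodule.le_topologicalClosure _ ⟨y, hy, rfl⟩)

lemma norm_star_apply_of_mem_N {x : H →L[ℂ] H} (hx : x ∈ S.N) : ‖star x S.Ω‖ = ‖x S.Ω‖ := by
  have h1 := norm_star_apply_le (N_le_A hx) (apply_Ω_mem_of_mem_N (star_mem hx))
  have h2 := norm_star_apply_le (N_le_A (star_mem hx)) (by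
    rw [star_star]; exact apply_Ω_mem_of_mem_N hx)
  rw [star_star] at h2
  exact le_antisymm h1 h2

lemma norm_star_apply_of_mem_A {x : H →L[ℂ] H} (hx : x ∈ S.A) (h1 : S.p * x = x)
    (h2 : x * S.p = x) : ‖star x S.Ω‖ = ‖x S.Ω‖ := by
  have h3 : x S.Ω ∈ S.mirrorSpace.topologicalClosure := by
    rw [← h1]; exact p_apply_Ω_mem_of_mem_A hx
  have h4 : star x S.Ω ∈ S.mirrorSpace.topologicalClosure := by
    have := congrArg star h2
    rw [star_mul, star_p] at this
    rw [← this]; exact p_apply_Ω_mem_of_mem_A (star_mem hx)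
  have h5 := norm_star_apply_le hx h4
  have h6 := norm_star_apply_le (star_mem hx) (by rwa [star_star])
  rw [star_star] at h6
  exact le_antisymm h5 h6

end LocalSystem
end Happy

/-! ### Partitions of small trace; the types of the cut algebra and of the whole algebra. -/

namespace Happy
namespace LocalSystem
variable {H : Type} [NormedAddCommGroup H] [InnerProductSpace ℂ H] [CompleteSpace H]
variable {S : LocalSystem H}

variable (S) in
/-- Infinitely many of the cut algebras contain matrix units of size at least two. -/
def HasCutUnits : Prop := ∀ N, ∃ n, N ≤ n ∧ ∃ (ι : Type) (_ : Fintype ι) (w : ι → ι → H →L[ℂ] H),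
  1 < Fintype.card ι ∧ (∀ j k, w j k ∈ S.cut n) ∧ (∀ j k, star (w j k) = w k j) ∧
  (∀ j k l, w j k * w k l = w j l) ∧ ∑ j, w j j = 1

variable (S) in
/-- Infinitely many of the bulk algebras contain a partial isometry from the minimal projection
`q n` to an orthogonal one. -/
def HasBulkUnits : Prop := ∀ N, ∃ n, N ≤ n ∧ ∃ u ∈ S.bulk n, star u * u = S.q n ∧ S.q n * u = 0

lemma norm_sq_apply_of_isStarProjection {f : H →L[ℂ] H} (hf : IsStarProjection f) (v : H) :
    ((‖f v‖ ^ 2 : ℝ) : ℂ) = inner ℂ v (f v) := by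
  rw [norm_apply_sq, star_mul_self_of_isStarProjection hf]

/-- Each projection is divided by matrix units of a later cut algebra into at least two pieces of
equal trace, so the trace at least halves. Commutation with all cut algebras from stage n on is
carried along to make the next division possible. -/
lemma exists_partition (h : S.HasCutUnits) (k : ℕ) : ∃ (n : ℕ) (ι : Type) (_ : Fintype ι)
    (f : ι → H →L[ℂ] H), (∀ i, f i ∈ S.N ∧ IsStarProjection (f i) ∧
      (∀ m, n ≤ m → ∀ x ∈ S.cut m, x * f i = f i * x) ∧ ‖f i S.Ω‖ ^ 2 ≤ (1 / 2) ^ k) ∧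
      ∑ i, f i = 1 := by
  induction k with
  | zero =>
    refine ⟨0, Unit, inferInstance, fun _ => 1, fun _ => ⟨one_mem _, .one _, ?_, ?_⟩, ?_⟩
    · simp
    · simp [S.norm_Ω]
    · simp
  | succ k ih =>
    obtain ⟨n, ι, _, f, hf, hsum⟩ := ih
    obtain ⟨m, hm, κ, _, w, hcard, hw, hstar, hmul, hsumw⟩ := h n
    refine ⟨m + 1, ι × κ, inferInstance, fun i => f i.1 * w i.2 i.2, ?_, ?_⟩
    · rintro ⟨i, j⟩
      obtain ⟨hfN, hfp, hfc, hfn⟩ := hf i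
      have hcomm : ∀ j l, w j l * f i = f i * w j l := fun j l => hfc m hm _ (hw j l)
      have hff : f i * f i = f i := hfp.isIdempotentElem
      have hfs : star (f i) = f i := hfp.isSelfAdjoint.star_eq
      have hproj : ∀ j, IsStarProjection (f i * w j j) := by
        refine fun j => ⟨?_, ?_⟩
        · change f i * w j j * (f i * w j j) = f i * w j j
          calc f i * w j j * (f i * w j j) = f i * (w j j * f i) * w j j := by noncomm_ring
            _ = f i * f i * (w j j * w j j) := by rw [hcomm]; noncomm_ring
            _ = _ := by rw [hff, hmul]
        · rw [isSelfAdjoint_iff, star_mul, hstar, hfs, hcomm]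
      -- The element f i * w j l is a partial isometry of N between these two projections, and the
      -- trace does not distinguish its two ends.
      have heq : ∀ j l, ‖(f i * w l l) S.Ω‖ = ‖(f i * w j j) S.Ω‖ := by
        intro j l
        have hx : f i * w j l ∈ S.N := mul_mem hfN (cut_le_N (hw j l))
        have h1 : star (f i * w j l) * (f i * w j l) = f i * w l l := by
          rw [star_mul, hstar, hfs]
          calc w l j * f i * (f i * w j l) = w l j * (f i * f i) * w j l := by noncomm_ring
            _ = f i * (w l j * w j l) := by rw [hff, hcomm, mul_assoc]
            _ = _ := by rw [hmul]
        have h2 : f i * w j l * star (f i * w j l) = f i * w j j := by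
          rw [star_mul, hstar, hfs]
          calc f i * w j l * (w l j * f i) = f i * (w j l * w l j) * f i := by noncomm_ring
            _ = f i * (w j j * f i) := by rw [hmul, mul_assoc]
            _ = _ := by rw [hcomm, ← mul_assoc, hff]
        have h3 : ‖(f i * w j l) S.Ω‖ = ‖(f i * w l l) S.Ω‖ :=
          norm_apply_eq_of_star_mul_self
            (by rw [h1, star_mul_self_of_isStarProjection (hproj l)]) _
        have h4 : ‖star (f i * w j l) S.Ω‖ = ‖(f i * w j j) S.Ω‖ :=
          norm_apply_eq_of_star_mul_self
            (by rw [star_star, h2, star_mul_self_of_isStarProjection (hproj j)]) _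
        rw [← h3, ← h4, norm_star_apply_of_mem_N hx]
      refine ⟨mul_mem hfN (cut_le_N (hw j j)), hproj j, ?_, ?_⟩
      · intro m' hm' x hx
        rw [← mul_assoc, hfc m' (by omega) x hx, mul_assoc, mul_assoc,
          S.cut_comm m' m (by omega) x hx _ (hw j j)]
      · have h5 : ‖f i S.Ω‖ ^ 2 = Fintype.card κ * ‖(f i * w j j) S.Ω‖ ^ 2 := by
          have h6 : ((‖f i S.Ω‖ ^ 2 : ℝ) : ℂ) = ∑ l, ((‖(f i * w l l) S.Ω‖ ^ 2 : ℝ) : ℂ) := by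
            simp only [norm_sq_apply_of_isStarProjection hfp,
              norm_sq_apply_of_isStarProjection (hproj _)]
            rw [← inner_sum, ← sum_apply, ← Finset.mul_sum, hsumw, mul_one]
          simp only [heq j] at h6
          rw [Finset.sum_const, Finset.card_univ, nsmul_eq_mul] at h6
          exact_mod_cast h6
        have h7 : (2 : ℝ) ≤ Fintype.card κ := by exact_mod_cast hcard
        have h8 : 0 ≤ ‖(f i * w j j) S.Ω‖ ^ 2 := by positivity
        change ‖(f i * w j j) S.Ω‖ ^ 2 ≤ _
        have h9 := mul_le_mul_of_nonneg_right h7 h8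
        rw [h5] at hfn
        rw [pow_succ (1 / 2 : ℝ) k]
        linarith
    · rw [Fintype.sum_prod_type]
      simp only [← Finset.mul_sum, hsumw, mul_one, hsum]

lemma exists_small_partition (h : S.HasCutUnits) {ε : ℝ} (hε : 0 < ε) :
    ∃ (ι : Type) (_ : Fintype ι) (f : ι → H →L[ℂ] H),
      (∀ i, f i ∈ S.N ∧ IsStarProjection (f i) ∧ ‖f i S.Ω‖ ≤ ε) ∧ ∑ i, f i = 1 := by
  obtain ⟨k, hk⟩ := exists_pow_lt_of_lt_one (pow_pos hε 2) (by norm_num : (1 / 2 : ℝ) < 1)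
  obtain ⟨_, ι, hι, f, hf, hsum⟩ := exists_partition h k
  exact ⟨ι, hι, f, fun i => ⟨(hf i).1, (hf i).2.1,
    le_of_sq_le_sq ((hf i).2.2.2.trans hk.le) hε.le⟩, hsum⟩

theorem isTypeIIOne_N (h : S.HasCutUnits) : IsTypeIIOne S.N := by
  refine isTypeII_of_trace isFactor_N (g := 1) ⟨one_mem _, .one _⟩ Ω_ne_zero rfl
    (fun x hx _ _ => norm_star_apply_of_mem_N hx) (fun x hx _ => eq_zero_of_mem_N hx) ?_
  intro ε hε
  obtain ⟨ι, hι, f, hf, hsum⟩ := exists_small_partition h hε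
  exact ⟨ι, hι, f, fun i => ⟨(hf i).1, (hf i).2.1, by rw [one_mul, mul_one], (hf i).2.2⟩, hsum⟩

/-- Ω is tracial only on p A p, so the criterion is used below p. The partition is taken from N,
whose elements commute with p. -/
theorem isTypeII_A (h : S.HasCutUnits) : IsTypeII S.A := by
  refine (isTypeII_of_trace isFactor_A (g := S.p) ⟨M_le_A p_mem_M, p_proj⟩ Ω_ne_zero p_Ω
    (fun x hx => norm_star_apply_of_mem_A hx) (fun x hx => eq_zero_of_mem_A hx) ?_).1
  intro ε hε
  obtain ⟨ι, hι, f, hf, hsum⟩ := exists_small_partition h hε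
  exact ⟨ι, hι, f, fun i => ⟨N_le_A (hf i).1, (hf i).2.1,
    commutant_comm (N_le_M_commutant (hf i).1) p_mem_M, (hf i).2.2⟩, hsum⟩

end LocalSystem
end Happy

/-! ### Operators on a completed tensor product, and amplification. -/

namespace Happy
section tensorOps
variable {H K L : Type} [NormedAddCommGroup H] [InnerProductSpace ℂ H] [CompleteSpace H]
  [NormedAddCommGroup K] [InnerProductSpace ℂ K]
  [NormedAddCommGroup L] [InnerProductSpace ℂ L]
  {W : K ⊗[ℂ] L →ₗᵢ[ℂ] H}

lemma ext_of_denseRange (hW : DenseRange W) {T T' : H →L[ℂ] H}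
    (h : ∀ k l, T (W (k ⊗ₜ[ℂ] l)) = T' (W (k ⊗ₜ[ℂ] l))) : T = T' := by
  have h1 : ∀ t, T (W t) = T' (W t) := by
    intro t
    induction t with
    | zero => simp
    | tmul k l => exact h k l
    | add a b ha hb => simp only [map_add, ha, hb]
  ext v
  exact congrFun (hW.equalizer T.continuous T'.continuous (funext h1)) v

lemma eq_of_inner_denseRange (hW : DenseRange W) {a b : H}
    (h : ∀ t, inner ℂ (W t) a = inner ℂ (W t) b) : a = b := by
  refine ext_inner_left ℂ fun v => ?_
  have : (fun v => inner ℂ v a) = fun v => inner ℂ v b :=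
    hW.equalizer (by fun_prop) (by fun_prop) (funext h)
  exact congrFun this v

lemma ext_inner_of_denseRange (hW : DenseRange W) {T T' : H →L[ℂ] H}
    (h : ∀ k l k' l', inner ℂ (W (k ⊗ₜ[ℂ] l)) (T (W (k' ⊗ₜ[ℂ] l'))) =
      inner ℂ (W (k ⊗ₜ[ℂ] l)) (T' (W (k' ⊗ₜ[ℂ] l')))) : T = T' := by
  refine ext_of_denseRange hW fun k' l' => ?_
  have h1 : ∀ t, inner ℂ (W t) (T (W (k' ⊗ₜ[ℂ] l'))) = inner ℂ (W t) (T' (W (k' ⊗ₜ[ℂ] l'))) := by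
    intro t
    induction t with
    | zero => simp
    | tmul k l => exact h k l k' l'
    | add a b ha hb => simp only [map_add, inner_add_left, ha, hb]
  exact eq_of_inner_denseRange hW h1

lemma IsTensorOp.unique (hW : DenseRange W) {x : K →L[ℂ] K} {y : L →L[ℂ] L} {T T' : H →L[ℂ] H}
    (h : IsTensorOp W x y T) (h' : IsTensorOp W x y T') : T = T' :=
  ext_of_denseRange hW fun k l => by rw [h, h']

lemma IsTensorOp.mul {x x' : K →L[ℂ] K} {y y' : L →L[ℂ] L} {T T' : H →L[ℂ] H}
    (h : IsTensorOp W x y T) (h' : IsTensorOp W x' y' T') :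
    IsTensorOp W (x * x') (y * y') (T * T') := fun k l => by
  rw [mul_apply_eq_comp, h', h]; rfl

lemma IsTensorOp.star [CompleteSpace K] [CompleteSpace L] (hW : DenseRange W) {x : K →L[ℂ] K}
    {y : L →L[ℂ] L} {T : H →L[ℂ] H}
    (h : IsTensorOp W x y T) : IsTensorOp W (star x) (star y) (star T) := by
  intro k l
  have h1 : ∀ t, inner ℂ (W t) (Star.star T (W (k ⊗ₜ[ℂ] l))) =
      inner ℂ (W t) (W (Star.star x k ⊗ₜ[ℂ] Star.star y l)) := by
    intro t
    induction t with
    | zero => simp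
    | tmul k' l' =>
      rw [inner_star_right, h, W.inner_map_map, W.inner_map_map, TensorProduct.inner_tmul,
        TensorProduct.inner_tmul, inner_star_right, inner_star_right]
    | add a b ha hb => simp only [map_add, inner_add_left, ha, hb]
  exact eq_of_inner_denseRange hW h1

lemma exists_extend (hW : DenseRange W) (V : K ⊗[ℂ] L →L[ℂ] H) :
    ∃ T : H →L[ℂ] H, ∀ t, T (W t) = V t :=
  ⟨V.extend W.toContinuousLinearMap, fun t =>
    ContinuousLinearMap.extend_eq V hW W.isometry.isUniformInducing t⟩

lemma exists_isTensorOp_isometry (hW : DenseRange W) (v : K →ₗᵢ[ℂ] K) (u : L →ₗᵢ[ℂ] L) :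
    ∃ T, IsTensorOp W v.toContinuousLinearMap u.toContinuousLinearMap T := by
  obtain ⟨T, hT⟩ := exists_extend hW
    (W.comp (TensorProduct.mapIsometry v u)).toContinuousLinearMap
  exact ⟨T, fun k l => hT (k ⊗ₜ[ℂ] l)⟩

/-- Every bounded operator is a linear combination of unitaries, and for a unitary u the map 1 ⊗ u
is isometric on the algebraic tensor product, so it extends by density. No bound for 1 ⊗ y with
general y has to be proved. -/
lemma exists_isTensorOp_one [CompleteSpace L] (hW : DenseRange W) (y : L →L[ℂ] L) :
    ∃ T, IsTensorOp W 1 y T := by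
  have hy : y ∈ Submodule.span ℂ (unitary (L →L[ℂ] L) : Set (L →L[ℂ] L)) := by
    rw [CStarAlgebra.span_unitary]; trivial
  induction hy using Submodule.span_induction with
  | mem u hu =>
    have hn : ∀ l, ‖u l‖ = ‖l‖ := by
      intro l
      have := norm_apply_eq_of_star_mul_self (T := u) (S := 1)
        (by rw [(Unitary.mem_iff.1 hu).1, star_one, one_mul]) l
      exact this
    exact exists_isTensorOp_isometry hW LinearIsometry.id ⟨u.toLinearMap, hn⟩
  | zero => exact ⟨0, fun k l => by simp⟩
  | add a b _ _ ha hb =>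
    obtain ⟨T, hT⟩ := ha
    obtain ⟨T', hT'⟩ := hb
    exact ⟨T + T', fun k l => by
      rw [add_apply, hT, hT', ← map_add, ← TensorProduct.tmul_add]; rfl⟩
  | smul c a _ ha =>
    obtain ⟨T, hT⟩ := ha
    exact ⟨c • T, fun k l => by
      rw [smul_apply, hT, ← map_smul, ← TensorProduct.tmul_smul]; rfl⟩

variable [CompleteSpace K] [CompleteSpace L]

/-- The amplification `y ↦ 1 ⊗ y`. -/
noncomputable def ampl (hW : DenseRange W) : (L →L[ℂ] L) →⋆ₐ[ℂ] (H →L[ℂ] H) where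
  toFun y := (exists_isTensorOp_one hW y).choose
  map_one' := IsTensorOp.unique hW (exists_isTensorOp_one hW 1).choose_spec fun k l => rfl
  map_mul' y z := IsTensorOp.unique hW (exists_isTensorOp_one hW _).choose_spec (by
    have := (exists_isTensorOp_one hW y).choose_spec.mul (exists_isTensorOp_one hW z).choose_spec
    rwa [one_mul] at this)
  map_zero' := IsTensorOp.unique hW (exists_isTensorOp_one hW 0).choose_spec fun k l => by simp
  map_add' y z := IsTensorOp.unique hW (exists_isTensorOp_one hW _).choose_spec fun k l => by
    rw [add_apply, (exists_isTensorOp_one hW y).choose_spec,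
      (exists_isTensorOp_one hW z).choose_spec, ← map_add, ← TensorProduct.tmul_add]; rfl
  commutes' c := IsTensorOp.unique hW (exists_isTensorOp_one hW _).choose_spec fun k l => by
    rw [Algebra.algebraMap_eq_smul_one, Algebra.algebraMap_eq_smul_one, smul_apply, smul_apply,
      TensorProduct.tmul_smul, map_smul]; rfl
  map_star' y := IsTensorOp.unique hW (exists_isTensorOp_one hW _).choose_spec (by
    have := (exists_isTensorOp_one hW y).choose_spec.star hW
    rwa [star_one] at this)

lemma isTensorOp_ampl (hW : DenseRange W) (y : L →L[ℂ] L) : IsTensorOp W 1 y (ampl hW y) :=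
  (exists_isTensorOp_one hW y).choose_spec

lemma ampl_injective [Nontrivial K] (hW : DenseRange W) : Function.Injective (ampl hW) := by
  intro y z h
  obtain ⟨k, hk⟩ := exists_ne (0 : K)
  ext l
  have h1 := isTensorOp_ampl hW y k l
  rw [h, isTensorOp_ampl hW z k l] at h1
  have h2 := W.injective h1
  have h3 : k ⊗ₜ[ℂ] (z l - y l) = 0 := by
    rw [TensorProduct.tmul_sub, sub_eq_zero]; exact h2
  have h4 : ‖k‖ * ‖z l - y l‖ = 0 := by rw [← TensorProduct.norm_tmul (𝕜 := ℂ), h3, norm_zero]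
  have h5 := (mul_eq_zero.1 h4).resolve_left (norm_ne_zero_iff.2 hk)
  exact (sub_eq_zero.1 (norm_eq_zero.1 h5)).symm

/-- The map `l ↦ W (k ⊗ l)`. -/
noncomputable def leg (W : K ⊗[ℂ] L →ₗᵢ[ℂ] H) (k : K) : L →L[ℂ] H :=
  W.toContinuousLinearMap.comp (TensorProduct.mkL ℂ K L k)

lemma ampl_leg (hW : DenseRange W) (y : L →L[ℂ] L) (k : K) (l : L) :
    ampl hW y (leg W k l) = leg W k (y l) := isTensorOp_ampl hW y k l

/-- The operators `y` for which `1 ⊗ y` belongs to a given von Neumann algebra. -/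
noncomputable def comapAmpl (hW : DenseRange W) (N : VonNeumannAlgebra H) : VonNeumannAlgebra L where
  toStarSubalgebra := N.toStarSubalgebra.comap (ampl hW)
  centralizer_centralizer' := by
    refine Set.Subset.antisymm ?_ Set.subset_centralizer_centralizer
    intro z hz
    change ampl hW z ∈ N
    refine mem_of_commute_commutant fun t ht => ?_
    refine ext_inner_of_denseRange hW fun k l k' l' => ?_
    -- A slice of t: its matrix coefficients are those of t between k ⊗ · and k' ⊗ ·. Slices of an
    -- element of the commutant of N commute with every admissible y, so z commutes with them;
    -- comparing coefficients, 1 ⊗ z commutes with t.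
    let s : L →L[ℂ] L := (ContinuousLinearMap.adjoint (leg W k)).comp (t.comp (leg W k'))
    have hs : s ∈ Set.centralizer (N.toStarSubalgebra.comap (ampl hW)).carrier := by
      rw [Set.mem_centralizer_iff]
      intro y hy
      have hy : ampl hW y ∈ N := hy
      ext l
      refine ext_inner_left ℂ fun w => ?_
      change inner ℂ w (y (ContinuousLinearMap.adjoint (leg W k) (t (leg W k' l)))) =
        inner ℂ w (ContinuousLinearMap.adjoint (leg W k) (t (leg W k' (y l))))
      rw [← inner_star_left, ContinuousLinearMap.adjoint_inner_right,
        ContinuousLinearMap.adjoint_inner_right, ← ampl_leg hW, ← ampl_leg hW, map_star,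
        inner_star_left]
      rw [LocalSystem.commutant_comm_apply ht hy]
    have hzs := congrArg (fun T : L →L[ℂ] L => inner ℂ l (T l'))
      ((Set.mem_centralizer_iff.1 hz) s hs)
    change inner ℂ l (ContinuousLinearMap.adjoint (leg W k) (t (leg W k' (z l')))) =
      inner ℂ l (z (ContinuousLinearMap.adjoint (leg W k) (t (leg W k' l')))) at hzs
    rw [← inner_star_left, ContinuousLinearMap.adjoint_inner_right,
      ContinuousLinearMap.adjoint_inner_right, ← ampl_leg hW, ← ampl_leg hW, map_star,
      inner_star_left] at hzs
    exact hzs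

lemma mem_comapAmpl {hW : DenseRange W} {N : VonNeumannAlgebra H} {y : L →L[ℂ] L} :
    y ∈ comapAmpl hW N ↔ ampl hW y ∈ N := Iff.rfl

/-- If `N` consists of operators `1 ⊗ y`, then it has the same type as the algebra of these `y`. -/
theorem isTypeIIOne_comapAmpl [Nontrivial K] {hW : DenseRange W} {N : VonNeumannAlgebra H}
    (hN : ∀ T ∈ N, ∃ y, ampl hW y = T) (h : IsTypeIIOne N) : IsTypeIIOne (comapAmpl hW N) := by
  have hinj := ampl_injective hW
  have hproj : ∀ y, IsProj (comapAmpl hW N) y ↔ IsProj N (ampl hW y) := by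
    intro y
    refine and_congr Iff.rfl ⟨fun h => h.map (ampl hW), fun h => ⟨?_, ?_⟩⟩
    · exact hinj (by rw [map_mul]; exact h.isIdempotentElem)
    · exact hinj (by rw [map_star]; exact h.isSelfAdjoint)
  -- Because N lies in the range of the injective amplification, an implementing partial isometry in
  -- N can be pulled back.
  have hmvn : ∀ y z, MvNEquiv (comapAmpl hW N) y z ↔ MvNEquiv N (ampl hW y) (ampl hW z) := by
    intro y z
    constructor
    · rintro ⟨u, hu, rfl, rfl⟩
      exact ⟨ampl hW u, hu, by rw [map_mul, map_star], by rw [map_mul, map_star]⟩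
    · rintro ⟨u, hu, h1, h2⟩
      obtain ⟨u, rfl⟩ := hN u hu
      exact ⟨u, hu, hinj (by rw [map_mul, map_star, h1]), hinj (by rw [map_mul, map_star, h2])⟩
  have hfin : ∀ y, IsFiniteProj N (ampl hW y) → IsFiniteProj (comapAmpl hW N) y := by
    intro y hy
    refine ⟨(hproj y).2 hy.1, fun z hz hyz hm => hinj ?_⟩
    exact hy.2 _ ((hproj z).1 hz) (by rw [← map_mul, hyz]) ((hmvn y z).1 hm)
  obtain ⟨⟨hfac, hmin, p, hp0, hp⟩, hone⟩ := h
  refine ⟨⟨?_, ?_, ?_⟩, hfin 1 (by rwa [map_one])⟩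
  · intro x hx hx'
    obtain ⟨c, hc⟩ := hfac (ampl hW x) hx (VonNeumannAlgebra.mem_commutant_iff.2 fun T hT => by
      obtain ⟨y, rfl⟩ := hN T hT
      rw [← map_mul, ← map_mul, VonNeumannAlgebra.mem_commutant_iff.1 hx' y hT])
    exact ⟨c, hinj (by rw [hc, map_smul, map_one])⟩
  · intro y hy
    refine hmin (ampl hW y) ⟨(hproj y).1 hy.1, fun h0 => hy.2.1 (hinj (by rw [h0, map_zero])), ?_⟩
    intro T hT hyT
    obtain ⟨z, rfl⟩ := hN T hT.1
    rcases hy.2.2 z ((hproj z).2 hT) (hinj (by rw [map_mul, hyT])) with rfl | rfl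
    · exact Or.inl (map_zero _)
    · exact Or.inr rfl
  · obtain ⟨y, rfl⟩ := hN p hp.1.1
    exact ⟨y, fun h0 => hp0 (by rw [h0, map_zero]), hfin y hp⟩

end tensorOps
end Happy

/-! ### The splitting of the Hilbert space into K and L. -/

namespace Happy

section shift
variable {K : Type} [NormedAddCommGroup K] [InnerProductSpace ℂ K] [CompleteSpace K]

/-- An infinite-dimensional Hilbert space has a non-surjective isometry. -/
lemma exists_isometry_orthogonal (h : ¬ FiniteDimensional ℂ K) :
    ∃ (v : K →ₗᵢ[ℂ] K) (e : K), e ≠ 0 ∧ ∀ k, inner ℂ (v k) e = 0 := by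
  obtain ⟨w, b, -⟩ := exists_hilbertBasis ℂ K
  have hw : Infinite w := by
    by_contra hfin
    rw [not_infinite_iff_finite] at hfin
    apply h
    have := b.dense_span
    have hfd : FiniteDimensional ℂ (Submodule.span ℂ (Set.range b)) :=
      FiniteDimensional.span_of_finite ℂ (Set.finite_range b)
    rw [(Submodule.closed_of_finiteDimensional _).submodule_topologicalClosure_eq] at this
    refine Module.Finite.of_fg_top ?_
    rw [← this]
    exact Submodule.fg_span (Set.finite_range b)
  -- Hilbert's hotel on the index set: f shifts an embedded copy of ℕ by one, fixes all other
  -- indices, and misses the image of 0.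
  obtain ⟨f, hf, i₀, hi⟩ : ∃ f : w → w, Function.Injective f ∧ ∃ i₀, ∀ i, f i ≠ i₀ := by
    let g := Infinite.natEmbedding w
    classical
    refine ⟨fun i => if h : ∃ n, g n = i then g (h.choose + 1) else i, ?_, g 0, ?_⟩
    · intro i j hij
      by_cases hi : ∃ n, g n = i <;> by_cases hj : ∃ n, g n = j
      · simp only [hi, hj, dif_pos] at hij
        have := g.injective hij
        rw [← hi.choose_spec, ← hj.choose_spec, Nat.succ.inj this]
      · simp only [hi, hj, dif_pos, dif_neg, not_false_eq_true] at hij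
        exact absurd ⟨_, hij⟩ hj
      · simp only [hi, hj, dif_pos, dif_neg, not_false_eq_true] at hij
        exact absurd ⟨_, hij.symm⟩ hi
      · simpa only [hi, hj, dif_neg, not_false_eq_true] using hij
    · intro i
      by_cases hi : ∃ n, g n = i
      · simp only [hi, dif_pos]
        intro h0
        exact absurd (g.injective h0) (Nat.succ_ne_zero _)
      · simp only [hi, dif_neg, not_false_eq_true]
        exact fun h0 => hi ⟨0, h0.symm⟩
  have hon : Orthonormal ℂ (b ∘ f) := b.orthonormal.comp f hf
  have hofam := hon.orthogonalFamily
  refine ⟨hofam.linearIsometry.comp b.repr.toLinearIsometry, b i₀, b.orthonormal.ne_zero i₀, ?_⟩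
  intro k
  have h1 := (hofam.hasSum_linearIsometry (b.repr k)).mapL (innerSL ℂ (b i₀))
  have h2 : ∀ i, innerSL ℂ (b i₀) (LinearIsometry.toSpanSingleton ℂ K (hon.1 i) (b.repr k i)) = 0 := by
    intro i
    simp only [LinearIsometry.toSpanSingleton_apply, innerSL_apply_apply, inner_smul_right,
      Function.comp_apply]
    rw [b.orthonormal.2 (hi i).symm, mul_zero]
  have h3 := h1.unique (by simpa only [h2] using hasSum_zero)
  rw [inner_eq_zero_symm]
  exact h3

end shift

namespace LocalSystem
variable {H : Type} [NormedAddCommGroup H] [InnerProductSpace ℂ H] [CompleteSpace H]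
variable {S : LocalSystem H}

lemma norm_p : ‖S.p‖ = 1 := by
  refine le_antisymm (Submodule.starProjection_norm_le _) ?_
  have := S.p.le_opNorm S.Ω
  rwa [p_Ω, S.norm_Ω, mul_one] at this

variable (S) in
/-- The left ideal `M p`. -/
noncomputable def leftIdeal : Submodule ℂ (H →L[ℂ] H) where
  carrier := {x | x ∈ S.M ∧ x * S.p = x}
  zero_mem' := ⟨zero_mem _, zero_mul _⟩
  add_mem' := by
    rintro x y ⟨hx, hx'⟩ ⟨hy, hy'⟩
    exact ⟨add_mem hx hy, by rw [add_mul, hx', hy']⟩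
  smul_mem' := by
    rintro c x ⟨hx, hx'⟩
    exact ⟨smul_mem_vn c hx, by rw [smul_mul_assoc, hx']⟩

/-- Here x* y = p x* y p, a multiple of p, and applying it to Ω identifies the scalar. So the
operator norm on M p is the Hilbert norm of x Ω; as M p is norm closed, M Ω is complete without
taking a closure. -/
lemma star_mul_leftIdeal {x y : H →L[ℂ] H} (hx : x ∈ S.leftIdeal) (hy : y ∈ S.leftIdeal) :
    star x * y = (inner ℂ (x S.Ω) (y S.Ω) : ℂ) • S.p := by
  obtain ⟨c, hc⟩ := p_mul_mul_p (mul_mem (star_mem hx.1) hy.1)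
  have h1 : star x * y = c • S.p := by
    have hpx : S.p * star x = star x := by
      have := congrArg star hx.2
      rwa [star_mul, star_p] at this
    rw [← hc, ← mul_assoc, hpx, mul_assoc, hy.2]
  have h2 : inner ℂ (x S.Ω) (y S.Ω) = c := by
    rw [← inner_star_right, ← mul_apply_eq_comp, h1, smul_apply, p_Ω, inner_smul_right,
      inner_self_eq_norm_sq_to_K, S.norm_Ω]
    simp
  rw [h1, h2]

variable (S) in
/-- The isometry `x ↦ x Ω` on `M p`. -/
noncomputable def evalΩ : S.leftIdeal →ₗᵢ[ℂ] H where
  toFun x := x.1 S.Ω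
  map_add' _ _ := rfl
  map_smul' _ _ := rfl
  norm_map' x := by
    change ‖x.1 S.Ω‖ = ‖x.1‖
    have h1 := congrArg norm (star_mul_leftIdeal x.2 x.2)
    rw [CStarRing.norm_star_mul_self, norm_smul, norm_p, mul_one, inner_self_eq_norm_sq_to_K] at h1
    have h2 : ‖x.1‖ ^ 2 = ‖x.1 S.Ω‖ ^ 2 := by
      rw [sq, h1]; simp
    exact ((sq_eq_sq₀ (norm_nonneg _) (norm_nonneg _)).1 h2).symm

variable (S) in
/-- The subspace `M Ω`. -/
noncomputable def K : Submodule ℂ H := LinearMap.range S.evalΩ.toLinearMap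

lemma isClosed_vn (B : VonNeumannAlgebra H) : IsClosed (B : Set (H →L[ℂ] H)) := by
  rw [← B.centralizer_centralizer]
  exact Set.isClosed_centralizer _

lemma isClosed_leftIdeal : IsClosed (S.leftIdeal : Set (H →L[ℂ] H)) :=
  (isClosed_vn S.M).inter (isClosed_eq (continuous_id.mul continuous_const) continuous_id)

instance : CompleteSpace S.leftIdeal := isClosed_leftIdeal.completeSpace_coe

instance : CompleteSpace S.K := by
  have : IsComplete (Set.range S.evalΩ) := S.evalΩ.isometry.isUniformInducing.isComplete_range
  exact IsComplete.completeSpace_coe this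

variable (S) in
/-- The Hilbert space `M Ω`. -/
def KType : Type := S.K

variable (S) in
/-- The Hilbert space of the vectors that are fixed by all the projections `q n`. -/
def LType : Type := S.L

noncomputable instance : NormedAddCommGroup S.KType := inferInstanceAs (NormedAddCommGroup S.K)
noncomputable instance : InnerProductSpace ℂ S.KType := inferInstanceAs (InnerProductSpace ℂ S.K)
instance : CompleteSpace S.KType := inferInstanceAs (CompleteSpace S.K)
noncomputable instance : NormedAddCommGroup S.LType := inferInstanceAs (NormedAddCommGroup S.L)
noncomputable instance : InnerProductSpace ℂ S.LType := inferInstanceAs (InnerProductSpace ℂ S.L)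
instance : CompleteSpace S.LType := inferInstanceAs (CompleteSpace S.L)

variable (S) in
/-- The inclusion of `K` into `H`. -/
noncomputable def inclK : S.KType →ₗᵢ[ℂ] H := S.K.subtypeₗᵢ

variable (S) in
/-- The inclusion of `L` into `H`. -/
noncomputable def inclL : S.LType →ₗᵢ[ℂ] H := S.L.subtypeₗᵢ

lemma inclL_mem (l : S.LType) : S.inclL l ∈ S.L := (l : S.L).2

/-- A vector of `M Ω` as an element of `K`. -/
def toK (v : H) (hv : v ∈ S.K) : S.KType := ⟨v, hv⟩

/-- A vector fixed by all the projections `q n` as an element of `L`. -/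
def toL (v : H) (hv : v ∈ S.L) : S.LType := ⟨v, hv⟩

lemma inclK_toK (v : H) (hv : v ∈ S.K) : S.inclK (toK v hv) = v := rfl

variable (S) in
/-- The element `x` of `M p` with a given `x Ω`. -/
noncomputable def lift : S.KType ≃ₗᵢ[ℂ] S.leftIdeal := S.evalΩ.equivRange.symm

lemma lift_apply_Ω (k : S.KType) : (S.lift k).1 S.Ω = S.inclK k :=
  congrArg Subtype.val (S.evalΩ.equivRange.apply_symm_apply k)

lemma apply_Ω_mem_K {x : H →L[ℂ] H} (hx : x ∈ S.M) : x S.Ω ∈ S.K :=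
  ⟨⟨x * S.p, mul_mem hx p_mem_M, by rw [mul_assoc, p_mul_p]⟩, congrArg x p_Ω⟩

lemma apply_mem_K {x : H →L[ℂ] H} (hx : x ∈ S.M) (k : S.KType) : x (S.inclK k) ∈ S.K := by
  rw [← lift_apply_Ω]
  exact apply_Ω_mem_K (mul_mem hx (S.lift k).2.1)

lemma lift_mul {x : H →L[ℂ] H} (hx : x ∈ S.M) (k : S.KType) :
    (S.lift (toK _ (apply_mem_K hx k))).1 = x * (S.lift k).1 := by
  have h1 : x * (S.lift k).1 ∈ S.leftIdeal :=
    ⟨mul_mem hx (S.lift k).2.1, by rw [mul_assoc, (S.lift k).2.2]⟩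
  have h2 : S.lift (toK _ (apply_mem_K hx k)) = ⟨_, h1⟩ := by
    apply S.evalΩ.injective
    change (S.lift _).1 S.Ω = x ((S.lift k).1 S.Ω)
    rw [lift_apply_Ω, lift_apply_Ω, inclK_toK]
  rw [h2]

variable (S) in
/-- The map `k ⊗ l ↦ x l`, where `x` is the element of `M p` with `x Ω = k`. -/
noncomputable def preW : S.KType ⊗[ℂ] S.LType →ₗ[ℂ] H :=
  TensorProduct.lift (LinearMap.mk₂ ℂ (fun k l => (S.lift k).1 (S.inclL l))
    (fun k k' l => by rw [map_add]; rfl) (fun c k l => by rw [map_smul]; rfl)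
    (fun k l l' => by rw [map_add, map_add]) (fun c k l => by rw [map_smul, map_smul]))

lemma preW_tmul (k : S.KType) (l : S.LType) : S.preW (k ⊗ₜ[ℂ] l) = (S.lift k).1 (S.inclL l) := rfl

/-- For x, x' in M p and l, l' in L, ⟨x l, x' l'⟩ = ⟨l, x* x' l'⟩, where x* x' is ⟨x Ω, x' Ω⟩ times
p and p fixes l'. -/
lemma inner_preW (s t : S.KType ⊗[ℂ] S.LType) : inner ℂ (S.preW s) (S.preW t) = inner ℂ s t := by
  induction s with
  | zero => simp
  | add a b ha hb => simp only [map_add, inner_add_left, ha, hb]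
  | tmul k l =>
    induction t with
    | zero => simp
    | add a b ha hb => simp only [map_add, inner_add_right, ha, hb]
    | tmul k' l' =>
      rw [preW_tmul, preW_tmul, TensorProduct.inner_tmul, ← inner_star_right,
        ← mul_apply_eq_comp, star_mul_leftIdeal (S.lift k).2 (S.lift k').2, smul_apply,
        p_apply (inclL_mem l'), inner_smul_right, lift_apply_Ω, lift_apply_Ω,
        LinearIsometry.inner_map_map, LinearIsometry.inner_map_map]

variable (S) in
/-- The identification of `K ⊗ L` with a dense subspace of `H`. -/
noncomputable def W : S.KType ⊗[ℂ] S.LType →ₗᵢ[ℂ] H := S.preW.isometryOfInner inner_preW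

lemma W_tmul (k : S.KType) (l : S.LType) : S.W (k ⊗ₜ[ℂ] l) = (S.lift k).1 (S.inclL l) := rfl

/-- The restriction to `K` of an element of `M`. -/
noncomputable def restrictK {x : H →L[ℂ] H} (hx : x ∈ S.M) : S.KType →L[ℂ] S.KType :=
  (x.comp S.inclK.toContinuousLinearMap).codRestrict S.K (apply_mem_K hx)

lemma apply_mem_L {t : H →L[ℂ] H} (ht : t ∈ S.M.commutant) (l : S.LType) : t (S.inclL l) ∈ S.L :=
  mem_L.2 fun n => by
    rw [commutant_comm_apply ht (bulk_le_M (S.q_mem n)), mem_L.1 (inclL_mem l)]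

/-- The restriction to `L` of an element of the commutant of `M`. -/
noncomputable def restrictL {t : H →L[ℂ] H} (ht : t ∈ S.M.commutant) : S.LType →L[ℂ] S.LType :=
  (t.comp S.inclL.toContinuousLinearMap).codRestrict S.L (apply_mem_L ht)

lemma isTensorOp_of_mem_M {x : H →L[ℂ] H} (hx : x ∈ S.M) : IsTensorOp S.W (restrictK hx) 1 x := by
  intro k l
  rw [W_tmul, W_tmul]
  change x ((S.lift k).1 (S.inclL l)) = (S.lift (toK _ (apply_mem_K hx k))).1 (S.inclL l)
  rw [lift_mul hx]
  rfl

/-- Since t commutes with the x in M p that represents the first factor, t x l = x t l. -/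
lemma isTensorOp_of_mem_M_commutant {t : H →L[ℂ] H} (ht : t ∈ S.M.commutant) :
    IsTensorOp S.W 1 (restrictL ht) t := by
  intro k l
  rw [W_tmul, W_tmul]
  exact (commutant_comm_apply ht (S.lift k).2.1 (S.inclL l)).symm

/-- The closed range contains Ω and is preserved by M, acting on K, and by the commutant of M,
acting on L. Every operator of the system belongs to one of the two, and Ω is cyclic. -/
lemma denseRange_W : DenseRange S.W := by
  let V : Submodule ℂ H := (LinearMap.range S.W.toLinearMap).topologicalClosure
  have hV : IsClosed (V : Set H) := Submodule.isClosed_topologicalClosure _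
  have hinv : ∀ T : H →L[ℂ] H, (∀ k l, ∃ k' l', T (S.W (k ⊗ₜ[ℂ] l)) = S.W (k' ⊗ₜ[ℂ] l')) →
      ∀ v ∈ V, T v ∈ V := by
    intro T hT
    have : V ≤ V.comap T.toLinearMap := by
      refine Submodule.topologicalClosure_minimal _ ?_ (hV.preimage T.continuous)
      rintro _ ⟨t, rfl⟩
      change T (S.W t) ∈ V
      induction t with
      | zero => rw [map_zero, map_zero]; exact zero_mem _
      | tmul k l =>
        obtain ⟨k', l', h⟩ := hT k l
        rw [h]
        exact Submodule.le_topologicalClosure _ ⟨_, rfl⟩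
      | add a b ha hb => rw [map_add, map_add]; exact add_mem ha hb
    exact this
  have hM' : ∀ t ∈ S.M.commutant, ∀ v ∈ V, t v ∈ V := fun t ht =>
    hinv t fun k l => ⟨_, _, isTensorOp_of_mem_M_commutant ht k l⟩
  have hΩ : S.Ω ∈ V := by
    refine Submodule.le_topologicalClosure _
      ⟨toK S.Ω (apply_Ω_mem_K (one_mem _)) ⊗ₜ[ℂ] toL S.Ω Ω_mem_L, ?_⟩
    exact lift_apply_Ω _
  have := mem_of_invariant (S := S) hV hΩ
    (fun n x hx => hinv x fun k l => ⟨_, _, isTensorOp_of_mem_M (bulk_le_M hx) k l⟩)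
    (fun n x hx => hM' x (cut_le_M_commutant hx))
    (fun T hT => hM' T (A_commutant_le_M (rest_mem_A_commutant hT)))
  intro v
  exact this v

/-- The vectors u n Ω over infinitely many layers are orthonormal: for k ≠ n the projection q n
fixes u k Ω, because it commutes with u k and fixes Ω, but it annihilates u n Ω. -/
lemma not_finiteDimensional_K (h : S.HasBulkUnits) : ¬ FiniteDimensional ℂ S.KType := by
  intro hfin
  let X : Set ℕ := {n | ∃ u ∈ S.bulk n, star u * u = S.q n ∧ S.q n * u = 0}
  have hX : X.Infinite := Set.infinite_of_forall_exists_gt fun n => by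
    obtain ⟨k, hk, hu⟩ := h (n + 1)
    exact ⟨k, hu, hk⟩
  have : Infinite X := hX.to_subtype
  have hu : ∀ n : X, ∃ u ∈ S.bulk n, star u * u = S.q n ∧ S.q n * u = 0 := fun n => n.2
  choose u hub huu hqu using hu
  have hon : Orthonormal ℂ fun n : X => toK (u n S.Ω) (apply_Ω_mem_K (bulk_le_M (hub n))) := by
    refine ⟨fun n => ?_, fun n k hnk => ?_⟩
    · change ‖u n S.Ω‖ = 1
      rw [norm_apply_eq_of_star_mul_self (T := u n) (S := S.q n), S.q_fix, S.norm_Ω]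
      rw [huu, star_mul_self_of_isStarProjection (S.q_proj _)]
    · change inner ℂ (u n S.Ω) (u k S.Ω) = 0
      have hne : (n : ℕ) ≠ k := fun h => hnk (Subtype.ext h)
      have h1 : u k S.Ω = star (S.q n) (u k S.Ω) := by
        rw [(S.q_proj n).isSelfAdjoint.star_eq, ← mul_apply_eq_comp,
          S.bulk_comm n k hne _ (S.q_mem n) _ (hub k), mul_apply_eq_comp, S.q_fix]
      rw [h1, inner_star_right, ← mul_apply_eq_comp, hqu]
      simp
  have := hon.linearIndependent.finite
  exact not_finite X

end LocalSystem
end Happy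

/-! ### The three algebras in the tensor splitting. -/

namespace Happy
namespace LocalSystem
variable {H : Type} [NormedAddCommGroup H] [InnerProductSpace ℂ H] [CompleteSpace H]
variable {S : LocalSystem H}

instance : Nontrivial S.KType :=
  ⟨toK S.Ω (apply_Ω_mem_K (one_mem _)), 0, fun h => Ω_ne_zero (congrArg Subtype.val h)⟩

/-- All of B(K) occurs because an operator x ⊗ 1 commutes with the commutant of M, which acts on L
only. -/
theorem coe_M : (S.M : Set (H →L[ℂ] H)) = {T | ∃ x : S.KType →L[ℂ] S.KType, IsTensorOp S.W x 1 T} := by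
  ext T
  refine ⟨fun hT => ⟨_, isTensorOp_of_mem_M hT⟩, ?_⟩
  rintro ⟨x, hx⟩
  refine mem_of_commute_commutant fun t ht => ext_of_denseRange (denseRange_W (S := S)) fun k l => ?_
  have h := isTensorOp_of_mem_M_commutant ht
  rw [mul_apply_eq_comp, mul_apply_eq_comp, hx, h, h, hx]
  rfl

variable (S) in
/-- The cut algebra, as an algebra of operators on `L`. -/
noncomputable def R : VonNeumannAlgebra S.LType := comapAmpl (denseRange_W (S := S)) S.N

lemma ampl_restrictL {T : H →L[ℂ] H} (hT : T ∈ S.M.commutant) :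
    ampl denseRange_W (restrictL hT) = T :=
  IsTensorOp.unique denseRange_W (isTensorOp_ampl _ _) (isTensorOp_of_mem_M_commutant hT)

lemma restrictL_mem_R {T : H →L[ℂ] H} (hT : T ∈ S.N) : restrictL (N_le_M_commutant hT) ∈ S.R := by
  rw [R, mem_comapAmpl, ampl_restrictL]; exact hT

theorem coe_N : (S.N : Set (H →L[ℂ] H)) = {T | ∃ y ∈ S.R, IsTensorOp S.W 1 y T} := by
  ext T
  constructor
  · exact fun hT => ⟨_, restrictL_mem_R hT, isTensorOp_of_mem_M_commutant (N_le_M_commutant hT)⟩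
  · rintro ⟨y, hy, hyT⟩
    rw [hyT.unique denseRange_W (isTensorOp_ampl denseRange_W y)]
    exact hy

/-- One inclusion is checked on generators, which are x ⊗ 1 or 1 ⊗ y. For the other, an element of
the commutant of A has the form 1 ⊗ s with s commuting with R, so it commutes with each x ⊗ y. -/
theorem A_eq : S.A = vnGen {T | ∃ x : S.KType →L[ℂ] S.KType, ∃ y ∈ S.R, IsTensorOp S.W x y T} := by
  apply VonNeumannAlgebra.ext
  intro T
  constructor
  · refine vnGen_mono ?_
    rintro T (hT | hT)
    · obtain ⟨n, hn⟩ := Set.mem_iUnion.1 hT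
      exact ⟨_, 1, one_mem _, isTensorOp_of_mem_M (bulk_le_M hn)⟩
    · obtain ⟨n, hn⟩ := Set.mem_iUnion.1 hT
      exact ⟨1, _, restrictL_mem_R (cut_le_N hn), isTensorOp_of_mem_M_commutant _⟩
  · intro hT
    refine mem_of_commute_commutant fun t ht => mem_vnGen_iff.1 hT t ?_
    have key : ∀ s ∈ {T | ∃ x : S.KType →L[ℂ] S.KType, ∃ y ∈ S.R, IsTensorOp S.W x y T},
        s * t = t * s := by
      rintro s ⟨x, y, hy, hs⟩
      refine ext_of_denseRange (denseRange_W (S := S)) fun k l => ?_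
      have h := isTensorOp_of_mem_M_commutant (A_commutant_le_M ht)
      have h2 : y * restrictL (A_commutant_le_M ht) = restrictL (A_commutant_le_M ht) * y := by
        apply ampl_injective (denseRange_W (S := S))
        rw [map_mul, map_mul, ampl_restrictL]
        exact commutant_comm (A_commutant_le_N ht) hy
      have h3 := congrArg (fun T : S.LType →L[ℂ] S.LType => T l) h2
      simp only [mul_apply_eq_comp] at h3
      rw [mul_apply_eq_comp, mul_apply_eq_comp, hs, h, h, hs, h3]
      rfl
    intro s hs
    refine ⟨key s hs, key _ ?_⟩
    obtain ⟨x, y, hy, hs⟩ := hs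
    exact ⟨star x, star y, star_mem hy, hs.star denseRange_W⟩

theorem isTypeIIOne_R (h : S.HasCutUnits) : IsTypeIIOne S.R :=
  isTypeIIOne_comapAmpl (fun _ hT => ⟨_, ampl_restrictL (N_le_M_commutant hT)⟩) (isTypeIIOne_N h)

/-- For a non-surjective isometry v of K, T = v ⊗ 1 lies in M and T* T = 1, while T T* kills e ⊗ Ω
for a nonzero e orthogonal to the range of v. -/
theorem not_isFiniteProj_one (h : S.HasBulkUnits) : ¬ IsFiniteProj S.A 1 := by
  intro hfin
  obtain ⟨v, e, he, hve⟩ := exists_isometry_orthogonal (not_finiteDimensional_K h)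
  obtain ⟨T, hT⟩ := exists_isTensorOp_isometry denseRange_W v (LinearIsometry.id : S.LType →ₗᵢ[ℂ] S.LType)
  have hT : IsTensorOp S.W v.toContinuousLinearMap 1 T := hT
  have hTM : T ∈ S.M := by
    rw [← SetLike.mem_coe, coe_M]; exact ⟨_, hT⟩
  have hs := hT.star denseRange_W
  have hvv : star v.toContinuousLinearMap * v.toContinuousLinearMap = 1 := by
    ext k : 1
    refine ext_inner_left ℂ fun w => ?_
    rw [mul_apply_eq_comp, inner_star_right]
    exact v.inner_map_map w k
  have h1 : star T * T = 1 := by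
    have h2 := hs.mul hT
    rw [hvv, star_one, one_mul] at h2
    exact h2.unique denseRange_W fun k l => rfl
  have hq := isStarProjection_mul_star (e := 1) (.one _) h1
  have h3 := hfin.2 (T * star T) ⟨M_le_A (mul_mem hTM (star_mem hTM)), hq⟩ (one_mul _)
    ⟨T, M_le_A hTM, h1, rfl⟩
  have hve' : star v.toContinuousLinearMap e = 0 := by
    refine ext_inner_left ℂ fun w => ?_
    rw [inner_star_right, inner_zero_right]
    exact hve w
  let l : S.LType := toL S.Ω Ω_mem_L
  have h4 : (T * star T) (S.W (e ⊗ₜ[ℂ] l)) = 0 := by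
    rw [mul_apply_eq_comp, hs, hve', TensorProduct.zero_tmul, map_zero, map_zero]
  rw [h3] at h4
  have h5 : ‖S.W (e ⊗ₜ[ℂ] l)‖ = 0 := by rw [← norm_zero (E := H)]; exact congrArg norm h4
  rw [S.W.norm_map, TensorProduct.norm_tmul] at h5
  have h6 : ‖l‖ = 1 := S.norm_Ω
  rw [h6, mul_one, norm_eq_zero] at h5
  exact he h5

theorem isTypeIIInfty_A (h : S.HasCutUnits) (h' : S.HasBulkUnits) : IsTypeIIInfty S.A :=
  ⟨isTypeII_A h, not_isFiniteProj_one h'⟩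

end LocalSystem
end Happy

/-! ### Inductive limits: embeddings of the stages and operators on the limit. -/

namespace IndLim
variable {E : ℕ → Type} [∀ n, NormedAddCommGroup (E n)] [∀ n, InnerProductSpace ℂ (E n)]
variable (g : ∀ n, E n →ₗᵢ[ℂ] E (n + 1))

/-- The composite embedding `E m → E k`. -/
noncomputable def emb (m k : ℕ) (h : m ≤ k) : E m →ₗᵢ[ℂ] E k :=
  Nat.leRec (motive := fun k _ => E m →ₗᵢ[ℂ] E k) LinearIsometry.id (fun k _ f => (g k).comp f) h

lemma emb_self (m : ℕ) (v : E m) : emb g m m le_rfl v = v := by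
  rw [emb, Nat.leRec_self]; rfl

lemma emb_succ {m k : ℕ} (h : m ≤ k) (v : E m) :
    emb g m (k + 1) (Nat.le_succ_of_le h) v = g k (emb g m k h v) := by
  rw [emb, Nat.leRec_succ _ _ h]; rfl

lemma emb_left {m k : ℕ} (h : m + 1 ≤ k) (v : E m) :
    emb g (m + 1) k h (g m v) = emb g m k (Nat.le_of_succ_le h) v := by
  induction k, h using Nat.le_induction with
  | base => rw [emb_self, emb_succ g le_rfl, emb_self]
  | succ k hk ih => rw [emb_succ g hk, ih, ← emb_succ]

/-- The eventually coherent sequence of a vector of `E m`. -/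
noncomputable def preIncl (m : ℕ) (v : E m) : PreLimit g :=
  -- The value 0 before stage m is arbitrary: only the tail determines the class.
  ⟨fun k => if h : m ≤ k then emb g m k h v else 0, m, fun k hk => by
    simp only
    rw [dif_pos hk, dif_pos (Nat.le_succ_of_le hk), emb_succ]⟩

lemma preIncl_apply {m k : ℕ} (h : m ≤ k) (v : E m) : (preIncl g m v).1 k = emb g m k h v :=
  dif_pos h

variable {g}

lemma coe_eq_of_eventually {x y : PreLimit g} (h : ∀ᶠ k in Filter.atTop, x.1 k = y.1 k) :
    (x : Limit g) = y := by
  obtain ⟨k, h1, h2⟩ := (h.and (norm_eq (x - y))).exists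
  rw [← sub_eq_zero, ← UniformSpace.Completion.coe_sub, ← norm_eq_zero,
    UniformSpace.Completion.norm_coe, h2]
  change ‖x.1 k - y.1 k‖ = 0
  rw [h1, sub_self, norm_zero]

variable (g) in
/-- The embedding of `E m` into the inductive limit. -/
noncomputable def incl (m : ℕ) : E m →ₗᵢ[ℂ] Limit g where
  toFun v := (preIncl g m v : Limit g)
  map_add' v w := by
    rw [← UniformSpace.Completion.coe_add]
    refine coe_eq_of_eventually ?_
    filter_upwards [Filter.eventually_ge_atTop m] with k hk
    change _ = (preIncl g m v).1 k + (preIncl g m w).1 k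
    simp only [preIncl_apply g hk, map_add]
  map_smul' c v := by
    rw [RingHom.id_apply, ← UniformSpace.Completion.coe_smul]
    refine coe_eq_of_eventually ?_
    filter_upwards [Filter.eventually_ge_atTop m] with k hk
    change _ = c • (preIncl g m v).1 k
    simp only [preIncl_apply g hk, map_smul]
  norm_map' v := by
    change ‖(preIncl g m v : Limit g)‖ = ‖v‖
    obtain ⟨k, h1, h2⟩ := ((norm_eq (preIncl g m v)).and (Filter.eventually_ge_atTop m)).exists
    rw [UniformSpace.Completion.norm_coe, h1, preIncl_apply g h2, LinearIsometry.norm_map]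

lemma incl_def (m : ℕ) (v : E m) : incl g m v = (preIncl g m v : Limit g) := rfl

lemma incl_succ (m : ℕ) (v : E m) : incl g (m + 1) (g m v) = incl g m v := by
  refine coe_eq_of_eventually ?_
  filter_upwards [Filter.eventually_ge_atTop (m + 1)] with k hk
  rw [preIncl_apply g hk, preIncl_apply g (Nat.le_of_succ_le hk), emb_left]

lemma incl_emb {m k : ℕ} (h : m ≤ k) (v : E m) : incl g k (emb g m k h v) = incl g m v := by
  induction k, h using Nat.le_induction with
  | base => rw [emb_self]
  | succ k hk ih => rw [emb_succ g hk, incl_succ, ih]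

/-- The stage can be chosen beyond any N, so that operators defined from stage N on act on a
representative. -/
lemma exists_incl_eq (x : PreLimit g) (N : ℕ) : ∃ m, N ≤ m ∧ ∃ v, (x : Limit g) = incl g m v := by
  obtain ⟨M, hM⟩ := x.2
  refine ⟨max N M, le_max_left _ _, x.1 (max N M), coe_eq_of_eventually ?_⟩
  filter_upwards [Filter.eventually_ge_atTop (max N M)] with k hk
  induction k, hk using Nat.le_induction with
  | base => rw [preIncl_apply g le_rfl, emb_self]
  | succ k hk ih =>
    rw [preIncl_apply g (Nat.le_succ_of_le hk), emb_succ g hk,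
      hM k (le_trans (le_max_right _ _) hk), ih, preIncl_apply g hk]

lemma limit_induction {p : Limit g → Prop} (N : ℕ) (hp : IsClosed {x | p x})
    (h : ∀ m, N ≤ m → ∀ v, p (incl g m v)) (x : Limit g) : p x := by
  refine UniformSpace.Completion.induction_on x hp fun x => ?_
  obtain ⟨m, hm, v, hv⟩ := exists_incl_eq x N
  rw [hv]; exact h m hm v

lemma op_incl {T : ∀ n, E n →L[ℂ] E n}
    {hT : ∃ N, ∀ n, N ≤ n → ∀ v, T (n + 1) (g n v) = g n (T n v)}
    {hb : ∃ C, ∀ n, ‖T n‖ ≤ C} {m : ℕ} (h : ∀ n, m ≤ n → ∀ v, T (n + 1) (g n v) = g n (T n v))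
    (v : E m) : op T hT hb (incl g m v) = incl g m (T m v) := by
  rw [incl_def, op, ContinuousLinearMap.completion_apply_coe, incl_def]
  refine coe_eq_of_eventually ?_
  filter_upwards [Filter.eventually_ge_atTop m] with k hk
  change T k ((preIncl g m v).1 k) = _
  rw [preIncl_apply g hk, preIncl_apply g hk]
  induction k, hk using Nat.le_induction with
  | base => rw [emb_self, emb_self]
  | succ k hk ih => rw [emb_succ g hk, emb_succ g hk, h k hk, ih]

lemma ext_incl (N : ℕ) {S T : Limit g →L[ℂ] Limit g}
    (h : ∀ m, N ≤ m → ∀ v, S (incl g m v) = T (incl g m v)) : S = T := by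
  ext x
  exact limit_induction N (isClosed_eq S.continuous T.continuous) h x

/-- Both vectors can be moved to a common later stage. This form suits identities about adjoints and
compressions, where the image of a stage need not stay in that stage. -/
lemma ext_inner_incl (N : ℕ) {S T : Limit g →L[ℂ] Limit g}
    (h : ∀ m, N ≤ m → ∀ w v, inner ℂ (incl g m w) (S (incl g m v)) =
      inner ℂ (incl g m w) (T (incl g m v))) : S = T := by
  refine ext_incl N fun m hm v => ext_inner_left ℂ fun w => ?_
  refine limit_induction (g := g) m (p := fun w => inner ℂ w (S (incl g m v)) =
    inner ℂ w (T (incl g m v))) (isClosed_eq (by fun_prop) (by fun_prop)) (fun k hk w => ?_) w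
  rw [← incl_emb hk]
  exact h k (hm.trans hk) w _

theorem separableSpace_limit [∀ n, TopologicalSpace.SeparableSpace (E n)] :
    TopologicalSpace.SeparableSpace (Limit g) := by
  rw [← TopologicalSpace.isSeparable_univ_iff]
  have h1 : TopologicalSpace.IsSeparable (⋃ m, Set.range (incl g m)) :=
    TopologicalSpace.IsSeparable.iUnion fun m =>
      TopologicalSpace.isSeparable_range (incl g m).continuous
  refine h1.closure.mono fun x _ => ?_
  exact limit_induction (p := fun x => x ∈ closure (⋃ m, Set.range (incl g m))) 0 isClosed_closure
    (fun m _ v => subset_closure (Set.mem_iUnion.2 ⟨m, v, rfl⟩)) x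

/-! ### Matrix algebras of the stages acting on the limit. -/

section matrixAlgebras
variable [∀ n, CompleteSpace (E n)] {X : ℕ → Type} [∀ n, Fintype (X n)] [∀ n, DecidableEq (X n)]
variable (push : ∀ n, Matrix (X n) (X n) ℂ →⋆ₐ[ℂ] Matrix (X (n + 1)) (X (n + 1)) ℂ)
variable (loc : ∀ n, Matrix (X n) (X n) ℂ →⋆ₐ[ℂ] (E n →L[ℂ] E n))

/-- The composite of the maps `push`. -/
noncomputable def pushes (n k : ℕ) (h : n ≤ k) : Matrix (X n) (X n) ℂ →⋆ₐ[ℂ] Matrix (X k) (X k) ℂ :=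
  Nat.leRec (motive := fun k _ => Matrix (X n) (X n) ℂ →⋆ₐ[ℂ] Matrix (X k) (X k) ℂ)
    (StarAlgHom.id ℂ _) (fun k _ f => (push k).comp f) h

lemma pushes_self (n : ℕ) (O : Matrix (X n) (X n) ℂ) : pushes push n n le_rfl O = O := by
  rw [pushes, Nat.leRec_self]; rfl

lemma pushes_succ {n k : ℕ} (h : n ≤ k) (O : Matrix (X n) (X n) ℂ) :
    pushes push n (k + 1) (Nat.le_succ_of_le h) O = push k (pushes push n k h O) := by
  rw [pushes, Nat.leRec_succ _ _ h]; rfl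

lemma pushes_left {n k : ℕ} (h : n + 1 ≤ k) (O : Matrix (X n) (X n) ℂ) :
    pushes push (n + 1) k h (push n O) = pushes push n k (Nat.le_of_succ_le h) O := by
  induction k, h using Nat.le_induction with
  | base => rw [pushes_self, pushes_succ push le_rfl, pushes_self]
  | succ k hk ih => rw [pushes_succ push hk, ih, ← pushes_succ]

/-- The action of the pushed operator on all later stages. -/
noncomputable def matFamily (n : ℕ) (O : Matrix (X n) (X n) ℂ) (k : ℕ) : E k →L[ℂ] E k :=
  if h : n ≤ k then loc k (pushes push n k h O) else 0

variable {push loc}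

lemma matFamily_compat (hloc : ∀ n O v, loc (n + 1) (push n O) (g n v) = g n (loc n O v))
    (n : ℕ) (O : Matrix (X n) (X n) ℂ) (k : ℕ) (hk : n ≤ k) (v : E k) :
    matFamily push loc n O (k + 1) (g k v) = g k (matFamily push loc n O k v) := by
  rw [matFamily, matFamily, dif_pos hk, dif_pos (Nat.le_succ_of_le hk), pushes_succ, hloc]

open scoped Matrix.Norms.L2Operator in
-- Star homomorphisms between C*-algebras are contractive, so the operator norm of O bounds all
-- stages.
lemma matFamily_bound (n : ℕ) (O : Matrix (X n) (X n) ℂ) :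
    ∃ B, ∀ k, ‖matFamily push loc n O k‖ ≤ B := by
  refine ⟨‖O‖, fun k => ?_⟩
  unfold matFamily
  split_ifs with h
  · exact NonUnitalStarAlgHom.norm_apply_le ((loc k).comp (pushes push n k h)) O
  · simp

/-- The action on the limit of a matrix of stage `n`. -/
noncomputable def matOp (hloc : ∀ n O v, loc (n + 1) (push n O) (g n v) = g n (loc n O v))
    (n : ℕ) (O : Matrix (X n) (X n) ℂ) : Limit g →L[ℂ] Limit g :=
  op (matFamily push loc n O) ⟨n, matFamily_compat hloc n O⟩ (matFamily_bound n O)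

variable (hloc : ∀ n O v, loc (n + 1) (push n O) (g n v) = g n (loc n O v))

lemma matOp_incl {n m : ℕ} (h : n ≤ m) (O : Matrix (X n) (X n) ℂ) (v : E m) :
    matOp hloc n O (incl g m v) = incl g m (loc m (pushes push n m h O) v) := by
  rw [matOp, op_incl fun k hk => matFamily_compat hloc n O k (h.trans hk), matFamily, dif_pos h]

/-- The star homomorphism from the matrices of stage `n` to the operators on the limit. -/
noncomputable def matHom (n : ℕ) : Matrix (X n) (X n) ℂ →⋆ₐ[ℂ] (Limit g →L[ℂ] Limit g) where
  toFun := matOp hloc n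
  map_one' := ext_incl n fun m hm v => by
    rw [matOp_incl hloc hm, map_one, map_one]; rfl
  map_mul' O O' := ext_incl n fun m hm v => by
    rw [mul_apply_eq_comp, matOp_incl hloc hm, matOp_incl hloc hm, matOp_incl hloc hm, map_mul, map_mul]
    rfl
  map_zero' := ext_incl n fun m hm v => by
    rw [matOp_incl hloc hm, map_zero, map_zero]; simp
  map_add' O O' := ext_incl n fun m hm v => by
    rw [add_apply, matOp_incl hloc hm, matOp_incl hloc hm, matOp_incl hloc hm, map_add (pushes push n m hm), map_add (loc m), add_apply, map_add]
  commutes' c := ext_incl n fun m hm v => by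
    rw [matOp_incl hloc hm, Algebra.algebraMap_eq_smul_one, Algebra.algebraMap_eq_smul_one,
      map_smul, map_smul, map_one, map_one, smul_apply, smul_apply, map_smul]
    rfl
  map_star' O := ext_inner_incl n fun m hm w v => by
    rw [Happy.inner_star_right, matOp_incl hloc hm, matOp_incl hloc hm, map_star, map_star,
      LinearIsometry.inner_map_map, LinearIsometry.inner_map_map, Happy.inner_star_right]

lemma matHom_incl {n m : ℕ} (h : n ≤ m) (O : Matrix (X n) (X n) ℂ) (v : E m) :
    matHom hloc n O (incl g m v) = incl g m (loc m (pushes push n m h O) v) :=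
  matOp_incl hloc h O v

lemma matHom_incl_self {n : ℕ} (O : Matrix (X n) (X n) ℂ) (v : E n) :
    matHom hloc n O (incl g n v) = incl g n (loc n O v) := by
  rw [matHom_incl hloc le_rfl, pushes_self]

lemma matHom_succ (n : ℕ) (O : Matrix (X n) (X n) ℂ) :
    matHom hloc (n + 1) (push n O) = matHom hloc n O :=
  ext_incl (n + 1) fun m hm v => by
    rw [matHom_incl hloc hm, matHom_incl hloc (Nat.le_of_succ_le hm), pushes_left]

lemma matHom_pushes {n k : ℕ} (h : n ≤ k) (O : Matrix (X n) (X n) ℂ) :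
    matHom hloc k (pushes push n k h O) = matHom hloc n O := by
  induction k, h using Nat.le_induction with
  | base => rw [pushes_self]
  | succ k hk ih => rw [pushes_succ push hk, matHom_succ, ih]

end matrixAlgebras
end IndLim

/-! ### One layer of the network: matrix units, reference projection, mirrored bonds. -/

namespace Happy

section matrixLemmas
variable {X Z : Type} [Fintype X] [DecidableEq X] [Fintype Z] [DecidableEq Z]

lemma ampLeft_apply (O : Matrix X X ℂ) :
    ampLeft X Z O = Matrix.kroneckerMap (· * ·) O (1 : Matrix Z Z ℂ) := rfl

lemma ampRight_apply (O : Matrix Z Z ℂ) :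
    ampRight X Z O = Matrix.kroneckerMap (· * ·) (1 : Matrix X X ℂ) O := rfl

lemma ampLeft_mul_ampRight (O : Matrix X X ℂ) (O' : Matrix Z Z ℂ) :
    ampLeft X Z O * ampRight X Z O' = Matrix.kroneckerMap (· * ·) O O' := by
  rw [ampLeft_apply, ampRight_apply, ← Matrix.mul_kronecker_mul, Matrix.mul_one, Matrix.one_mul]

lemma ampRight_mul_ampLeft (O : Matrix X X ℂ) (O' : Matrix Z Z ℂ) :
    ampRight X Z O' * ampLeft X Z O = Matrix.kroneckerMap (· * ·) O O' := by
  rw [ampLeft_apply, ampRight_apply, ← Matrix.mul_kronecker_mul, Matrix.mul_one, Matrix.one_mul]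

lemma ampLeft_comm_ampRight (O : Matrix X X ℂ) (O' : Matrix Z Z ℂ) :
    ampLeft X Z O * ampRight X Z O' = ampRight X Z O' * ampLeft X Z O := by
  rw [ampLeft_mul_ampRight, ampRight_mul_ampLeft]

lemma ampLeft_single_mul_ampRight_single (x x' : X) (z z' : Z) :
    ampLeft X Z (Matrix.single x x' 1) * ampRight X Z (Matrix.single z z' 1) =
      Matrix.single (x, z) (x', z') 1 := by
  rw [ampLeft_mul_ampRight]
  have := Matrix.single_kronecker_single x x' z z' (1 : ℂ) (1 : ℂ)
  rwa [mul_one] at this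

lemma conjBy_apply (U : Matrix X Z ℂ) (h : U.conjTranspose * U = 1) (h' : U * U.conjTranspose = 1)
    (O : Matrix Z Z ℂ) : conjBy U h h' O = U * O * U.conjTranspose := rfl

lemma conjBy_surjective (U : Matrix X Z ℂ) (h : U.conjTranspose * U = 1)
    (h' : U * U.conjTranspose = 1) : Function.Surjective (conjBy U h h') := by
  intro O
  refine ⟨U.conjTranspose * O * U, ?_⟩
  rw [conjBy_apply]
  calc U * (U.conjTranspose * O * U) * U.conjTranspose
      = (U * U.conjTranspose) * O * (U * U.conjTranspose) := by simp only [Matrix.mul_assoc]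
    _ = O := by rw [h', Matrix.one_mul, Matrix.mul_one]

/-- If a linear map sends all matrix units into a subspace, its range is contained in the subspace. -/
lemma mem_of_single_mem {Y : Type} [AddCommGroup Y] [Module ℂ Y] (V : Submodule ℂ Y)
    (f : Matrix X X ℂ →ₗ[ℂ] Y) (h : ∀ i j, f (Matrix.single i j 1) ∈ V) (O : Matrix X X ℂ) :
    f O ∈ V := by
  rw [Matrix.matrix_eq_sum_single O, map_sum]
  refine sum_mem fun i _ => ?_
  rw [map_sum]
  refine sum_mem fun j _ => ?_
  have : Matrix.single i j (O i j) = O i j • Matrix.single i j (1 : ℂ) := by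
    rw [Matrix.smul_single, smul_eq_mul, mul_one]
  rw [this, map_smul]
  exact V.smul_mem _ (h i j)

end matrixLemmas

lemma rtState_eq {d r : ℕ} (p p' : Fin r → Fin d) :
    rtState p p' = if p = p' then (((Real.sqrt d : ℝ) : ℂ)⁻¹) ^ r else 0 := by
  by_cases h : p = p'
  · subst h; simp [rtState]
  · rw [if_neg h]
    obtain ⟨a, ha⟩ := Function.ne_iff.1 h
    exact Finset.prod_eq_zero (Finset.mem_univ a) (by simp [ha])

namespace LayeredCode
variable {d m : ℕ} (C : LayeredCode d m)

/-- Operator pushing by one layer for operators on `B`. -/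
noncomputable def pushB (n : ℕ) :
    Matrix (C.XB n) (C.XB n) ℂ →⋆ₐ[ℂ] Matrix (C.XB (n + 1)) (C.XB (n + 1)) ℂ :=
  (conjBy (C.wedgeB n).network ((C.wedgeB n).network_isometry C.d_pos)
    ((C.wedgeB n).network_unitary C.d_pos)).comp
    (ampLeft (C.XB n) ((C.wedgeB n).Fresh × (Fin (C.r n) → Fin d)))

/-- Operators on `B` as operators on the boundary Hilbert space. -/
noncomputable def localOpB (n : ℕ) :
    Matrix (C.XB n) (C.XB n) ℂ →⋆ₐ[ℂ] (C.Hilb n →L[ℂ] C.Hilb n) :=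
  (Matrix.toEuclideanCLM (n := C.XA n × C.XB n) (𝕜 := ℂ) : _ →⋆ₐ[ℂ] _).comp
    (ampRight (C.XA n) (C.XB n))

/-- Operators on the new inputs of the wedge of `A`, represented on the boundary. -/
noncomputable def freshOp (n : ℕ) :
    Matrix ((C.wedgeA n).Fresh × (Fin (C.r n) → Fin d))
      ((C.wedgeA n).Fresh × (Fin (C.r n) → Fin d)) ℂ →⋆ₐ[ℂ]
      Matrix (C.XA (n + 1)) (C.XA (n + 1)) ℂ :=
  (conjBy (C.wedgeA n).network ((C.wedgeA n).network_isometry C.d_pos)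
    ((C.wedgeA n).network_unitary C.d_pos)).comp
    (ampRight (C.XA n) ((C.wedgeA n).Fresh × (Fin (C.r n) → Fin d)))

/-- Operators on the new inputs of the wedge of `B`, represented on the boundary. -/
noncomputable def freshOpB (n : ℕ) :
    Matrix ((C.wedgeB n).Fresh × (Fin (C.r n) → Fin d))
      ((C.wedgeB n).Fresh × (Fin (C.r n) → Fin d)) ℂ →⋆ₐ[ℂ]
      Matrix (C.XB (n + 1)) (C.XB (n + 1)) ℂ :=
  (conjBy (C.wedgeB n).network ((C.wedgeB n).network_isometry C.d_pos)
    ((C.wedgeB n).network_unitary C.d_pos)).comp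
    (ampRight (C.XB n) ((C.wedgeB n).Fresh × (Fin (C.r n) → Fin d)))

lemma wedgeOp_apply (n : ℕ) (O : Matrix (C.wedgeA n).Fresh (C.wedgeA n).Fresh ℂ) :
    C.wedgeOp n O = C.freshOp n (ampLeft _ _ O) := rfl

lemma rtOp_apply (n : ℕ) (O : Matrix (Fin (C.r n) → Fin d) (Fin (C.r n) → Fin d) ℂ) :
    C.rtOp n O = C.freshOp n (ampRight _ _ O) := rfl

/-- The two are O ⊗ 1 and 1 ⊗ Q, conjugated by the same unitary. This is the source of all
commutation between different layers. -/
lemma push_comm_freshOp (n : ℕ) (O : Matrix (C.XA n) (C.XA n) ℂ)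
    (Q : Matrix ((C.wedgeA n).Fresh × (Fin (C.r n) → Fin d))
      ((C.wedgeA n).Fresh × (Fin (C.r n) → Fin d)) ℂ) :
    C.push n O * C.freshOp n Q = C.freshOp n Q * C.push n O := by
  simp only [push, freshOp, StarAlgHom.comp_apply]
  rw [← map_mul, ← map_mul, ampLeft_comm_ampRight]

lemma wedgeOp_comm_rtOp (n : ℕ) (O : Matrix (C.wedgeA n).Fresh (C.wedgeA n).Fresh ℂ)
    (O' : Matrix (Fin (C.r n) → Fin d) (Fin (C.r n) → Fin d) ℂ) :
    C.wedgeOp n O * C.rtOp n O' = C.rtOp n O' * C.wedgeOp n O := by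
  rw [wedgeOp_apply, rtOp_apply, ← map_mul, ← map_mul, ampLeft_comm_ampRight]

/-- The coefficients of the state of the new degrees of freedom. -/
noncomputable def freshCoeff (n : ℕ) (q : (C.wedgeA n).Fresh × (Fin (C.r n) → Fin d))
    (q' : (C.wedgeB n).Fresh × (Fin (C.r n) → Fin d)) : ℂ :=
  (C.inA n q.1.1 * C.inB n q'.1.1) * ((C.wedgeA n).ancilla q.1.2 * (C.wedgeB n).ancilla q'.1.2) *
    rtState q.2 q'.2

lemma insertFresh_apply (n : ℕ) (x : C.XA n) (q : (C.wedgeA n).Fresh × (Fin (C.r n) → Fin d))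
    (y : C.XB n) (q' : (C.wedgeB n).Fresh × (Fin (C.r n) → Fin d)) (a : C.XA n × C.XB n) :
    C.insertFresh n ((x, q), (y, q')) a = if (x, y) = a then C.freshCoeff n q q' else 0 := rfl

lemma ampRight_mul_insertFresh (n : ℕ)
    (Q : Matrix ((C.wedgeA n).Fresh × (Fin (C.r n) → Fin d))
      ((C.wedgeA n).Fresh × (Fin (C.r n) → Fin d)) ℂ) (x : C.XA n)
    (q : (C.wedgeA n).Fresh × (Fin (C.r n) → Fin d))
    (y : C.XB n) (q' : (C.wedgeB n).Fresh × (Fin (C.r n) → Fin d)) (a : C.XA n × C.XB n) :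
    (Matrix.kroneckerMap (· * ·) (ampRight (C.XA n) _ Q)
      (1 : Matrix (C.wedgeB n).Inp (C.wedgeB n).Inp ℂ) * C.insertFresh n) ((x, q), (y, q')) a =
      if (x, y) = a then ∑ p, Q q p * C.freshCoeff n p q' else 0 := by
  rw [Matrix.mul_apply, Fintype.sum_prod_type]
  rw [Fintype.sum_prod_type]
  rw [Fintype.sum_eq_single x]
  · by_cases h : (x, y) = a
    · rw [if_pos h]
      refine Finset.sum_congr rfl fun p _ => ?_
      rw [Fintype.sum_eq_single (y, q')]
      · rw [insertFresh_apply, if_pos h]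
        simp [ampRight_apply]
      · intro z hz
        simp [Ne.symm hz]
    · rw [if_neg h]
      refine Finset.sum_eq_zero fun p _ => ?_
      rw [Fintype.sum_eq_single (y, q')]
      · rw [insertFresh_apply, if_neg h, mul_zero]
      · intro z hz
        simp [Ne.symm hz]
  · intro x' hx'
    refine Finset.sum_eq_zero fun p _ => Finset.sum_eq_zero fun z _ => ?_
    simp [ampRight_apply, Matrix.one_apply, Ne.symm hx']

lemma ampRightB_mul_insertFresh (n : ℕ)
    (Q : Matrix ((C.wedgeB n).Fresh × (Fin (C.r n) → Fin d))
      ((C.wedgeB n).Fresh × (Fin (C.r n) → Fin d)) ℂ) (x : C.XA n)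
    (q : (C.wedgeA n).Fresh × (Fin (C.r n) → Fin d))
    (y : C.XB n) (q' : (C.wedgeB n).Fresh × (Fin (C.r n) → Fin d)) (a : C.XA n × C.XB n) :
    (Matrix.kroneckerMap (· * ·) (1 : Matrix (C.wedgeA n).Inp (C.wedgeA n).Inp ℂ)
      (ampRight (C.XB n) _ Q) * C.insertFresh n) ((x, q), (y, q')) a =
      if (x, y) = a then ∑ p, Q q' p * C.freshCoeff n q p else 0 := by
  rw [Matrix.mul_apply, Fintype.sum_prod_type]
  rw [Fintype.sum_eq_single (x, q)]
  · rw [Fintype.sum_prod_type, Fintype.sum_eq_single y]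
    · by_cases h : (x, y) = a
      · rw [if_pos h]
        refine Finset.sum_congr rfl fun p _ => ?_
        rw [insertFresh_apply, if_pos h]
        simp [ampRight_apply]
      · rw [if_neg h]
        refine Finset.sum_eq_zero fun p _ => ?_
        rw [insertFresh_apply, if_neg h, mul_zero]
    · intro y' hy'
      refine Finset.sum_eq_zero fun p _ => ?_
      simp [ampRight_apply, Ne.symm hy']
  · intro z hz
    refine Finset.sum_eq_zero fun p _ => ?_
    simp [Ne.symm hz]

lemma ampLeftB_mul_insertFresh (n : ℕ) (O : Matrix (C.XB n) (C.XB n) ℂ) :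
    Matrix.kroneckerMap (· * ·) (1 : Matrix (C.wedgeA n).Inp (C.wedgeA n).Inp ℂ)
      (ampLeft (C.XB n) ((C.wedgeB n).Fresh × (Fin (C.r n) → Fin d)) O) * C.insertFresh n =
    C.insertFresh n * ampRight (C.XA n) (C.XB n) O := by
  ext ⟨⟨x, q⟩, ⟨y, q'⟩⟩ ⟨a, c⟩
  rw [Matrix.mul_apply, Matrix.mul_apply]
  rw [Fintype.sum_eq_single ((x, q), (c, q')), Fintype.sum_eq_single (x, y)]
  · rw [insertFresh_apply, insertFresh_apply, if_pos rfl]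
    by_cases h : x = a
    · simp [ampLeft_apply, ampRight_apply, h, mul_comm]
    · simp [ampRight_apply, h]
  · rintro ⟨z, z'⟩ hz
    rw [insertFresh_apply, if_neg (Ne.symm hz), zero_mul]
  · rintro ⟨⟨z, p⟩, ⟨z', p'⟩⟩ hz
    rw [insertFresh_apply]
    by_cases h1 : (x, q) = (z, p)
    · by_cases h2 : (z, z') = (a, c)
      · by_cases h3 : q' = p'
        · obtain ⟨rfl, rfl⟩ := Prod.mk.inj h2
          rw [h1, h3] at hz
          exact absurd rfl hz
        · simp [ampLeft_apply, Matrix.one_apply, h3]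
      · rw [if_neg h2, mul_zero]
    · rw [Matrix.kroneckerMap_apply, Matrix.one_apply, if_neg h1, zero_mul, zero_mul]

/-- The adjoint network in the conjugated operator cancels the network in the growth map, so O acts
directly on the freshly inserted state. -/
lemma ampLeft_conjBy_mul_growMatrix (n : ℕ)
    (O : Matrix (C.wedgeA n).Inp (C.wedgeA n).Inp ℂ) :
    ampLeft (C.XA (n + 1)) (C.XB (n + 1)) (conjBy (C.wedgeA n).network
      ((C.wedgeA n).network_isometry C.d_pos) ((C.wedgeA n).network_unitary C.d_pos) O) *
      C.growMatrix n =
    Matrix.kroneckerMap (· * ·) (C.wedgeA n).network (C.wedgeB n).network *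
      (Matrix.kroneckerMap (· * ·) O (1 : Matrix (C.wedgeB n).Inp (C.wedgeB n).Inp ℂ) *
        C.insertFresh n) := by
  rw [ampLeft_apply, conjBy_apply, growMatrix, ← Matrix.mul_assoc, ← Matrix.mul_kronecker_mul,
    Matrix.mul_assoc _ _ (C.wedgeA n).network, (C.wedgeA n).network_isometry C.d_pos,
    Matrix.mul_one, Matrix.one_mul, ← Matrix.mul_assoc, ← Matrix.mul_kronecker_mul, Matrix.mul_one]

lemma ampRight_conjBy_mul_growMatrix (n : ℕ)
    (O : Matrix (C.wedgeB n).Inp (C.wedgeB n).Inp ℂ) :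
    ampRight (C.XA (n + 1)) (C.XB (n + 1)) (conjBy (C.wedgeB n).network
      ((C.wedgeB n).network_isometry C.d_pos) ((C.wedgeB n).network_unitary C.d_pos) O) *
      C.growMatrix n =
    Matrix.kroneckerMap (· * ·) (C.wedgeA n).network (C.wedgeB n).network *
      (Matrix.kroneckerMap (· * ·) (1 : Matrix (C.wedgeA n).Inp (C.wedgeA n).Inp ℂ) O *
        C.insertFresh n) := by
  rw [ampRight_apply, conjBy_apply, growMatrix, ← Matrix.mul_assoc, ← Matrix.mul_kronecker_mul,
    Matrix.mul_assoc _ _ (C.wedgeB n).network, (C.wedgeB n).network_isometry C.d_pos,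
    Matrix.mul_one, Matrix.one_mul, ← Matrix.mul_assoc, ← Matrix.mul_kronecker_mul, Matrix.mul_one]

lemma pushB_growMatrix (n : ℕ) (O : Matrix (C.XB n) (C.XB n) ℂ) :
    ampRight (C.XA (n + 1)) (C.XB (n + 1)) (C.pushB n O) * C.growMatrix n =
      C.growMatrix n * ampRight (C.XA n) (C.XB n) O := by
  refine (C.ampRight_conjBy_mul_growMatrix n (ampLeft _ _ O)).trans ?_
  rw [ampLeftB_mul_insertFresh, ← Matrix.mul_assoc]
  rfl

lemma toEuclideanCLM_grow {n : ℕ}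
    {O : Matrix (C.XA (n + 1) × C.XB (n + 1)) (C.XA (n + 1) × C.XB (n + 1)) ℂ}
    {O' : Matrix (C.XA (n + 1) × C.XB (n + 1)) (C.XA n × C.XB n) ℂ}
    (h : O * C.growMatrix n = O') (v : C.Hilb n) :
    Matrix.toEuclideanCLM (n := C.XA (n + 1) × C.XB (n + 1)) (𝕜 := ℂ) O (C.grow n v) =
      WithLp.toLp 2 (O'.mulVec v.ofLp) := by
  rw [← h, ← Matrix.mulVec_mulVec]
  rfl

lemma pushB_grow (n : ℕ) (O : Matrix (C.XB n) (C.XB n) ℂ) (v : C.Hilb n) :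
    C.localOpB (n + 1) (C.pushB n O) (C.grow n v) = C.grow n (C.localOpB n O v) := by
  refine (C.toEuclideanCLM_grow (C.pushB_growMatrix n O) v).trans ?_
  rw [← Matrix.mulVec_mulVec]
  rfl

/-- The coefficients of the reference state of the new bulk inputs and ancillas in the wedge of `A`. -/
noncomputable def refState (n : ℕ) (f : (C.wedgeA n).Fresh) : ℂ :=
  C.inA n f.1 * (C.wedgeA n).ancilla f.2

lemma refState_norm (n : ℕ) : star (C.refState n) ⬝ᵥ C.refState n = 1 := by
  have h1 := sum_norm_sq _ (C.norm_inA n)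
  have h2 := (C.wedgeA n).ancilla_norm C.d_pos
  calc star (C.refState n) ⬝ᵥ C.refState n
      = (∑ i, (starRingEnd ℂ) (C.inA n i) * C.inA n i) *
        ∑ k, (starRingEnd ℂ) ((C.wedgeA n).ancilla k) * (C.wedgeA n).ancilla k := by
        rw [dotProduct, Fintype.sum_prod_type, Finset.sum_mul_sum]
        refine Finset.sum_congr rfl fun i _ => Finset.sum_congr rfl fun k _ => ?_
        simp only [refState, Pi.star_apply, RCLike.star_def, map_mul]
        ring
    _ = 1 := by rw [h1, h2, one_mul]

/-- The projection onto the reference state. -/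
noncomputable def refProj (n : ℕ) : Matrix (C.wedgeA n).Fresh (C.wedgeA n).Fresh ℂ :=
  Matrix.vecMulVec (C.refState n) (star (C.refState n))

lemma refProj_sandwich (n : ℕ) (O : Matrix (C.wedgeA n).Fresh (C.wedgeA n).Fresh ℂ) :
    C.refProj n * O * C.refProj n =
      (star (C.refState n) ⬝ᵥ O.mulVec (C.refState n)) • C.refProj n := by
  rw [refProj, Matrix.mul_assoc, Matrix.mul_vecMulVec, Matrix.vecMulVec_mul_vecMulVec,
    Matrix.vecMulVec_smul]

lemma isStarProjection_refProj (n : ℕ) : IsStarProjection (C.refProj n) := by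
  refine ⟨?_, ?_⟩
  · change C.refProj n * C.refProj n = C.refProj n
    have := C.refProj_sandwich n 1
    rwa [Matrix.mul_one, Matrix.one_mulVec, refState_norm, one_smul] at this
  · rw [isSelfAdjoint_iff, refProj, Matrix.star_eq_conjTranspose, Matrix.conjTranspose_vecMulVec,
      star_star]

/-- The inserted state is a product of the reference state of A's bulk and ancilla legs and the
rest, and the projection reproduces its first factor. Both ends of an opened internal bond lie in
this wedge, so the ancilla state is pure here. -/
lemma refProj_grow (n : ℕ) (v : C.Hilb n) :
    C.localOp (n + 1) (C.wedgeOp n (C.refProj n)) (C.grow n v) = C.grow n v := by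
  have h : ampLeft (C.XA (n + 1)) (C.XB (n + 1)) (C.wedgeOp n (C.refProj n)) * C.growMatrix n =
      C.growMatrix n := by
    refine (C.ampLeft_conjBy_mul_growMatrix n (ampRight _ _ (ampLeft _ _ (C.refProj n)))).trans ?_
    rw [growMatrix]
    congr 1
    ext ⟨⟨x, q⟩, ⟨y, q'⟩⟩ a
    refine (C.ampRight_mul_insertFresh n (ampLeft _ _ (C.refProj n)) x q y q' a).trans ?_
    rw [insertFresh_apply]
    refine if_congr Iff.rfl ?_ rfl
    obtain ⟨f, t⟩ := q
    rw [Fintype.sum_prod_type]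
    have h1 : ∀ f', ∑ t', ampLeft (C.wedgeA n).Fresh (Fin (C.r n) → Fin d) (C.refProj n) (f, t)
        (f', t') * C.freshCoeff n (f', t') q' =
        (star (C.refState n) f' * C.refState n f') * C.freshCoeff n (f, t) q' := by
      intro f'
      rw [Fintype.sum_eq_single t]
      · rw [ampLeft_apply, Matrix.kroneckerMap_apply, Matrix.one_apply_eq, refProj,
          Matrix.vecMulVec_apply]
        simp only [freshCoeff, refState]
        ring
      · intro t' ht'
        rw [ampLeft_apply, Matrix.kroneckerMap_apply, Matrix.one_apply_ne (Ne.symm ht')]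
        simp
    simp only [h1]
    rw [← Finset.sum_mul]
    have := C.refState_norm n
    rw [dotProduct] at this
    rw [this, one_mul]
  exact C.toEuclideanCLM_grow h v

/-- The operators on the `B`-ends of the new bonds across the cut. -/
noncomputable def rtOpB (n : ℕ) (O : Matrix (Fin (C.r n) → Fin d) (Fin (C.r n) → Fin d) ℂ) :
    Matrix (C.XB (n + 1)) (C.XB (n + 1)) ℂ :=
  C.freshOpB n (ampRight (C.wedgeB n).Fresh (Fin (C.r n) → Fin d) O)

lemma star_rtOpB (n : ℕ) (O : Matrix (Fin (C.r n) → Fin d) (Fin (C.r n) → Fin d) ℂ) :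
    star (C.rtOpB n O) = C.rtOpB n (star O) := by
  rw [rtOpB, rtOpB, map_star, map_star]

/-- The bonds across the cut are maximally entangled: operators on one side are mirrored on the other. -/
lemma rtOp_grow (n : ℕ) (O : Matrix (Fin (C.r n) → Fin d) (Fin (C.r n) → Fin d) ℂ)
    (v : C.Hilb n) : C.localOp (n + 1) (C.rtOp n O) (C.grow n v) =
      C.localOpB (n + 1) (C.rtOpB n O.transpose) (C.grow n v) := by
  have h : ampLeft (C.XA (n + 1)) (C.XB (n + 1)) (C.rtOp n O) * C.growMatrix n =
      ampRight (C.XA (n + 1)) (C.XB (n + 1)) (C.rtOpB n O.transpose) * C.growMatrix n := by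
    refine (C.ampLeft_conjBy_mul_growMatrix n (ampRight _ _ (ampRight _ _ O))).trans
      (Eq.trans ?_ (C.ampRight_conjBy_mul_growMatrix n
        (ampRight _ _ (ampRight _ _ O.transpose))).symm)
    congr 1
    ext ⟨⟨x, q⟩, ⟨y, q'⟩⟩ a
    refine (C.ampRight_mul_insertFresh n (ampRight _ _ O) x q y q' a).trans
      (Eq.trans ?_ (C.ampRightB_mul_insertFresh n (ampRight _ _ O.transpose) x q y q' a).symm)
    refine if_congr Iff.rfl ?_ rfl
    obtain ⟨f, t⟩ := q
    obtain ⟨f', t'⟩ := q'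
    -- The bond state is supported on equal indices at both ends, so both sums collapse to the entry
    -- of O at t, t'. The remaining coefficients agree because the bond state takes the same value
    -- at all equal pairs.
    have h1 : ∑ p, ampRight (C.wedgeA n).Fresh (Fin (C.r n) → Fin d) O (f, t) p *
        C.freshCoeff n p (f', t') = O t t' * C.freshCoeff n (f, t') (f', t') := by
      rw [Fintype.sum_eq_single (f, t')]
      · rw [ampRight_apply, Matrix.kroneckerMap_apply, Matrix.one_apply_eq, one_mul]
      · rintro ⟨g, s⟩ hgs
        rw [ampRight_apply, Matrix.kroneckerMap_apply]
        by_cases hg : f = g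
        · have hs : s ≠ t' := fun hs => hgs (by rw [hg, hs])
          simp [freshCoeff, rtState_eq, hs]
        · simp [Matrix.one_apply_ne hg]
    have h2 : ∑ p, ampRight (C.wedgeB n).Fresh (Fin (C.r n) → Fin d) O.transpose (f', t') p *
        C.freshCoeff n (f, t) p = O t t' * C.freshCoeff n (f, t) (f', t) := by
      rw [Fintype.sum_eq_single (f', t)]
      · rw [ampRight_apply, Matrix.kroneckerMap_apply, Matrix.one_apply_eq, one_mul,
          Matrix.transpose_apply]
      · rintro ⟨g, s⟩ hgs
        rw [ampRight_apply, Matrix.kroneckerMap_apply]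
        by_cases hg : f' = g
        · have hs : t ≠ s := fun hs => hgs (by rw [hg, hs])
          simp [freshCoeff, rtState_eq, hs]
        · simp [Matrix.one_apply_ne hg]
    rw [h1, h2]
    simp only [freshCoeff, rtState_eq, if_true]
  exact (C.toEuclideanCLM_grow h v).trans (C.toEuclideanCLM_grow rfl v).symm

end LayeredCode
end Happy

/-! ### Both regions on the limit space: commutation, generation, irreducibility. -/

namespace Happy
namespace LayeredCode
variable {d m : ℕ} (C : LayeredCode d m)

/-- The operators on `A` after `n` layers, acting on the limit space. -/
noncomputable def homA (n : ℕ) : Matrix (C.XA n) (C.XA n) ℂ →⋆ₐ[ℂ] (C.LimitSpace →L[ℂ] C.LimitSpace) :=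
  IndLim.matHom C.push_grow n

/-- The operators on `B` after `n` layers, acting on the limit space. -/
noncomputable def homB (n : ℕ) : Matrix (C.XB n) (C.XB n) ℂ →⋆ₐ[ℂ] (C.LimitSpace →L[ℂ] C.LimitSpace) :=
  IndLim.matHom C.pushB_grow n

lemma homA_incl (n : ℕ) (O : Matrix (C.XA n) (C.XA n) ℂ) (v : C.Hilb n) :
    C.homA n O (IndLim.incl C.grow n v) = IndLim.incl C.grow n (C.localOp n O v) :=
  IndLim.matHom_incl_self _ O v

lemma homB_incl (n : ℕ) (O : Matrix (C.XB n) (C.XB n) ℂ) (v : C.Hilb n) :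
    C.homB n O (IndLim.incl C.grow n v) = IndLim.incl C.grow n (C.localOpB n O v) :=
  IndLim.matHom_incl_self _ O v

lemma homA_push (n : ℕ) (O : Matrix (C.XA n) (C.XA n) ℂ) :
    C.homA (n + 1) (C.push n O) = C.homA n O :=
  IndLim.matHom_succ _ n O

lemma exists_homA_eq {n k : ℕ} (h : n ≤ k) (O : Matrix (C.XA n) (C.XA n) ℂ) :
    ∃ O', C.homA n O = C.homA k O' :=
  ⟨_, (IndLim.matHom_pushes C.push_grow h O).symm⟩

lemma exists_homB_eq {n k : ℕ} (h : n ≤ k) (O : Matrix (C.XB n) (C.XB n) ℂ) :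
    ∃ O', C.homB n O = C.homB k O' :=
  ⟨_, (IndLim.matHom_pushes C.pushB_grow h O).symm⟩

/-- Matrices as operators on the boundary Hilbert space. -/
noncomputable def toOp (n : ℕ) :
    Matrix (C.XA n × C.XB n) (C.XA n × C.XB n) ℂ →⋆ₐ[ℂ] (C.Hilb n →L[ℂ] C.Hilb n) :=
  (Matrix.toEuclideanCLM (n := C.XA n × C.XB n) (𝕜 := ℂ) : _ →⋆ₐ[ℂ] _)

lemma toOp_injective (n : ℕ) : Function.Injective (C.toOp n) :=
  (Matrix.toEuclideanCLM (n := C.XA n × C.XB n) (𝕜 := ℂ)).injective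

lemma toOp_surjective (n : ℕ) : Function.Surjective (C.toOp n) :=
  (Matrix.toEuclideanCLM (n := C.XA n × C.XB n) (𝕜 := ℂ)).surjective

lemma localOp_apply (n : ℕ) (O : Matrix (C.XA n) (C.XA n) ℂ) :
    C.localOp n O = C.toOp n (ampLeft _ _ O) := rfl

lemma localOpB_apply (n : ℕ) (O : Matrix (C.XB n) (C.XB n) ℂ) :
    C.localOpB n O = C.toOp n (ampRight _ _ O) := rfl

lemma localOpB_mul_localOp (n : ℕ) (O : Matrix (C.XA n) (C.XA n) ℂ) (O' : Matrix (C.XB n) (C.XB n) ℂ) :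
    C.localOpB n O' * C.localOp n O = C.localOp n O * C.localOpB n O' := by
  rw [localOp_apply, localOpB_apply, ← map_mul, ← map_mul, ampLeft_comm_ampRight]

lemma homA_comm_homB (n k : ℕ) (O : Matrix (C.XA n) (C.XA n) ℂ) (O' : Matrix (C.XB k) (C.XB k) ℂ) :
    C.homA n O * C.homB k O' = C.homB k O' * C.homA n O := by
  refine IndLim.ext_incl (max n k) fun l hl v => ?_
  obtain ⟨P, hP⟩ := C.exists_homA_eq ((le_max_left n k).trans hl) O
  obtain ⟨P', hP'⟩ := C.exists_homB_eq ((le_max_right n k).trans hl) O'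
  rw [hP, hP', mul_apply_eq_comp, mul_apply_eq_comp, homA_incl, homB_incl, homB_incl, homA_incl,
    ← mul_apply_eq_comp, ← mul_apply_eq_comp, localOpB_mul_localOp]

/-- Anything present before growth step n is pushed to the form Z' ⊗ 1 there and does not meet the
new legs. -/
lemma homA_comm_freshOp {k n : ℕ} (h : k ≤ n) (Z : Matrix (C.XA k) (C.XA k) ℂ)
    (Q : Matrix ((C.wedgeA n).Fresh × (Fin (C.r n) → Fin d))
      ((C.wedgeA n).Fresh × (Fin (C.r n) → Fin d)) ℂ) :
    C.homA k Z * C.homA (n + 1) (C.freshOp n Q) = C.homA (n + 1) (C.freshOp n Q) * C.homA k Z := by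
  obtain ⟨Z', hZ⟩ := C.exists_homA_eq h Z
  rw [hZ, ← homA_push, ← map_mul, ← map_mul, push_comm_freshOp]

lemma freshOp_comm_freshOp {k n : ℕ} (h : k ≠ n)
    (P : Matrix ((C.wedgeA k).Fresh × (Fin (C.r k) → Fin d))
      ((C.wedgeA k).Fresh × (Fin (C.r k) → Fin d)) ℂ)
    (Q : Matrix ((C.wedgeA n).Fresh × (Fin (C.r n) → Fin d))
      ((C.wedgeA n).Fresh × (Fin (C.r n) → Fin d)) ℂ) :
    C.homA (k + 1) (C.freshOp k P) * C.homA (n + 1) (C.freshOp n Q) =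
      C.homA (n + 1) (C.freshOp n Q) * C.homA (k + 1) (C.freshOp k P) := by
  rcases lt_or_gt_of_ne h with h | h
  · exact C.homA_comm_freshOp h _ Q
  · exact (C.homA_comm_freshOp h _ P).symm

lemma isEmpty_A : IsEmpty (Fin (C.bA 0)) := by
  rw [C.bA_zero]; infer_instance
lemma isEmpty_B : IsEmpty (Fin (C.bB 0)) := by
  rw [C.bB_zero]; infer_instance

/-- The operators on the new bulk inputs, the ancillas and the bonds across the cut generate all
operators on `A`. -/
lemma homA_mem (𝔅 : Subalgebra ℂ (C.LimitSpace →L[ℂ] C.LimitSpace))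
    (h1 : ∀ n O, C.homA (n + 1) (C.wedgeOp n O) ∈ 𝔅) (h2 : ∀ n O, C.homA (n + 1) (C.rtOp n O) ∈ 𝔅)
    (n : ℕ) (O : Matrix (C.XA n) (C.XA n) ℂ) : C.homA n O ∈ 𝔅 := by
  induction n with
  | zero =>
    -- The empty network has no boundary legs, so at stage 0 every matrix is a scalar.
    have : Subsingleton (C.XA 0) :=
      ⟨fun f g => funext fun i => (C.isEmpty_A.false i).elim⟩
    refine mem_of_single_mem 𝔅.toSubmodule (C.homA 0).toAlgHom.toLinearMap (fun i j => ?_) O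
    have h : Matrix.single i j (1 : ℂ) = 1 := by
      ext a b
      rw [Subsingleton.elim a i, Subsingleton.elim b i, Subsingleton.elim j i]
      simp
    rw [h]
    change C.homA 0 1 ∈ 𝔅
    rw [map_one]
    exact one_mem _
  | succ n ih =>
    obtain ⟨O, rfl⟩ := conjBy_surjective _ ((C.wedgeA n).network_isometry C.d_pos)
      ((C.wedgeA n).network_unitary C.d_pos) O
    refine mem_of_single_mem 𝔅.toSubmodule (((C.homA (n + 1)).comp (conjBy _
      ((C.wedgeA n).network_isometry C.d_pos)
      ((C.wedgeA n).network_unitary C.d_pos))).toAlgHom.toLinearMap) (fun i j => ?_) O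
    obtain ⟨x, f, t⟩ := i
    obtain ⟨y, g, s⟩ := j
    -- A matrix unit of the layer's inputs is a product of matrix units of the old boundary, the
    -- bulk and ancilla legs, and the cut. The first is handled by induction, the other two by
    -- hypothesis.
    rw [← ampLeft_single_mul_ampRight_single, ← ampLeft_single_mul_ampRight_single]
    change C.homA (n + 1) (conjBy _ ((C.wedgeA n).network_isometry C.d_pos)
      ((C.wedgeA n).network_unitary C.d_pos) _) ∈ 𝔅
    rw [map_mul, map_mul, map_mul, map_mul, map_mul]
    refine mul_mem ?_ (mul_mem (h1 n (Matrix.single f g 1)) (h2 n (Matrix.single t s 1)))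
    have := ih (Matrix.single x y 1)
    rwa [← homA_push] at this

/-- The product vector of all reference states. -/
noncomputable def vac : C.LimitSpace :=
  IndLim.incl C.grow 0 (EuclideanSpace.single
    (fun i => (C.isEmpty_A.false i).elim, fun i => (C.isEmpty_B.false i).elim) 1)

lemma norm_vac : ‖C.vac‖ = 1 := by
  rw [vac, LinearIsometry.norm_map, PiLp.norm_single, norm_one]

lemma exists_vac_eq (n : ℕ) : ∃ v, C.vac = IndLim.incl C.grow n v :=
  ⟨_, (IndLim.incl_emb (Nat.zero_le n) _).symm⟩

lemma homA_refProj_vac (n : ℕ) : C.homA (n + 1) (C.wedgeOp n (C.refProj n)) C.vac = C.vac := by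
  obtain ⟨v, hv⟩ := C.exists_vac_eq n
  rw [hv, ← IndLim.incl_succ, homA_incl, refProj_grow]

lemma homA_rtOp_vac (n : ℕ) (O : Matrix (Fin (C.r n) → Fin d) (Fin (C.r n) → Fin d) ℂ) :
    C.homB (n + 1) (C.rtOpB n O.transpose) C.vac = C.homA (n + 1) (C.rtOp n O) C.vac := by
  obtain ⟨v, hv⟩ := C.exists_vac_eq n
  rw [hv, ← IndLim.incl_succ, homA_incl, homB_incl, rtOp_grow]

/-- T and T* both preserve the image of stage n, so compressing S to that stage keeps the
commutation. -/
lemma compress_comm {n : ℕ} {T S : C.LimitSpace →L[ℂ] C.LimitSpace} {t : C.Hilb n →L[ℂ] C.Hilb n}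
    (hT : ∀ v, T (IndLim.incl C.grow n v) = IndLim.incl C.grow n (t v))
    (hT' : ∀ v, star T (IndLim.incl C.grow n v) = IndLim.incl C.grow n (star t v))
    (hS : T * S = S * T) :
    t * ((IndLim.incl C.grow n).toContinuousLinearMap.adjoint ∘L S ∘L
      (IndLim.incl C.grow n).toContinuousLinearMap) =
    ((IndLim.incl C.grow n).toContinuousLinearMap.adjoint ∘L S ∘L
      (IndLim.incl C.grow n).toContinuousLinearMap) * t := by
  ext v : 1
  refine ext_inner_left ℂ fun w => ?_
  rw [mul_apply_eq_comp, mul_apply_eq_comp, ← inner_star_left]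
  simp only [ContinuousLinearMap.comp_apply, ContinuousLinearMap.adjoint_inner_right,
    LinearIsometry.coe_toContinuousLinearMap]
  rw [← hT', inner_star_left, ← mul_apply_eq_comp, hS, mul_apply_eq_comp, hT]

/-- At each stage the operators on A and on its complement generate the full matrix algebra, so the
compression of S there is a scalar. Every stage contains the vacuum, whose expectation value
identifies that scalar, so all stages share one constant. -/
lemma eq_smul_one_of_comm {S : C.LimitSpace →L[ℂ] C.LimitSpace}
    (hA : ∀ n O, C.homA n O * S = S * C.homA n O) (hB : ∀ n O, C.homB n O * S = S * C.homB n O) :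
    ∃ c : ℂ, S = c • 1 := by
  refine ⟨inner ℂ C.vac (S C.vac), IndLim.ext_inner_incl 0 fun n _ w v => ?_⟩
  set J := (IndLim.incl C.grow n).toContinuousLinearMap
  let s : C.Hilb n →L[ℂ] C.Hilb n := J.adjoint ∘L S ∘L J
  have hsA : ∀ O, C.localOp n O * s = s * C.localOp n O := fun O =>
    C.compress_comm (C.homA_incl n O) (fun v => by rw [← map_star, ← map_star, homA_incl]) (hA n O)
  have hsB : ∀ O, C.localOpB n O * s = s * C.localOpB n O := fun O =>
    C.compress_comm (C.homB_incl n O) (fun v => by rw [← map_star, ← map_star, homB_incl]) (hB n O)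
  obtain ⟨σ, hσ⟩ := C.toOp_surjective n s
  have hc : σ ∈ Set.range (Matrix.scalar (C.XA n × C.XB n)) := by
    refine Matrix.mem_range_scalar_of_commute_single fun i j _ => C.toOp_injective n ?_
    rw [map_mul, map_mul, hσ, ← ampLeft_single_mul_ampRight_single, map_mul, ← localOp_apply,
      ← localOpB_apply, mul_assoc, hsB, ← mul_assoc, hsA, mul_assoc]
  obtain ⟨c, rfl⟩ := hc
  have hs : ∀ v, s v = c • v := by
    intro v
    have h : Matrix.scalar (C.XA n × C.XB n) c = c • 1 := by
      rw [Matrix.scalar_apply, Matrix.smul_one_eq_diagonal]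
    rw [← hσ, h, map_smul, map_one, smul_apply, one_apply_eq_self]
  have key : ∀ w v, inner ℂ (IndLim.incl C.grow n w) (S (IndLim.incl C.grow n v)) = c * inner ℂ w v := by
    intro w v
    rw [← inner_smul_right, ← hs]
    exact (ContinuousLinearMap.adjoint_inner_right J w (S (J v))).symm
  obtain ⟨ω, hω⟩ := C.exists_vac_eq n
  have hc : inner ℂ C.vac (S C.vac) = c := by
    have h1 : ‖ω‖ = 1 := by rw [← C.norm_vac, hω, LinearIsometry.norm_map]
    rw [hω, key, inner_self_eq_norm_sq_to_K, h1]
    simp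
  rw [hc, key, smul_apply, inner_smul_right, one_apply_eq_self, LinearIsometry.inner_map_map]

end LayeredCode
end Happy

/-! ### The network as a local system, and the theorem. -/

namespace Happy
namespace LayeredCode
variable {d m : ℕ} (C : LayeredCode d m)

/-- The local system of the limit space: new bulk inputs and ancillas of `A`, new bonds across the
cut, and the operators on `B`. -/
noncomputable def system : LocalSystem C.LimitSpace where
  bulk n := ((C.homA (n + 1)).comp (C.wedgeOp n)).range
  cut n := ((C.homA (n + 1)).comp (C.rtOp n)).range
  rest := {T | ∃ n O, T = C.homB n O}
  Ω := C.vac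
  q n := C.homA (n + 1) (C.wedgeOp n (C.refProj n))
  rest_star := by
    rintro _ ⟨n, O, rfl⟩
    exact ⟨n, star O, (map_star _ _).symm⟩
  bulk_comm := by
    rintro n k h _ ⟨O, rfl⟩ _ ⟨O', rfl⟩
    exact C.freshOp_comm_freshOp h (ampLeft _ _ O) (ampLeft _ _ O')
  cut_comm := by
    rintro n k h _ ⟨O, rfl⟩ _ ⟨O', rfl⟩
    exact C.freshOp_comm_freshOp h (ampRight _ _ O) (ampRight _ _ O')
  bulk_cut_comm := by
    rintro n k _ ⟨O, rfl⟩ _ ⟨O', rfl⟩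
    by_cases h : n = k
    · subst h
      change C.homA (n + 1) _ * C.homA (n + 1) _ = C.homA (n + 1) _ * C.homA (n + 1) _
      rw [← map_mul, ← map_mul]
      exact congrArg _ (C.wedgeOp_comm_rtOp n O O')
    · exact C.freshOp_comm_freshOp h (ampLeft _ _ O) (ampRight _ _ O')
  bulk_rest_comm := by
    rintro n _ ⟨O, rfl⟩ _ ⟨k, O', rfl⟩
    exact C.homA_comm_homB _ _ _ _
  cut_rest_comm := by
    rintro n _ ⟨O, rfl⟩ _ ⟨k, O', rfl⟩
    exact C.homA_comm_homB _ _ _ _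
  irreducible S h1 h2 h3 := by
    refine C.eq_smul_one_of_comm (fun n O => ?_) fun n O => h3 _ ⟨n, O, rfl⟩
    have := C.homA_mem (Subalgebra.centralizer ℂ {S})
      (fun n O => Subalgebra.mem_centralizer_iff ℂ |>.2 fun _ hg => by
        rw [Set.mem_singleton_iff.1 hg]; exact (h1 n _ ⟨O, rfl⟩).symm)
      (fun n O => Subalgebra.mem_centralizer_iff ℂ |>.2 fun _ hg => by
        rw [Set.mem_singleton_iff.1 hg]; exact (h2 n _ ⟨O, rfl⟩).symm) n O
    exact (Subalgebra.mem_centralizer_iff ℂ |>.1 this S rfl).symm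
  mirror := by
    rintro n _ ⟨O, rfl⟩
    refine ⟨_, ⟨n + 1, C.rtOpB n O.transpose, rfl⟩, C.homA_rtOp_vac n O, ?_⟩
    have h := C.homA_rtOp_vac n (star O)
    -- Transposition commutes with the adjoint, so the adjoint of the mirror of O is the mirror of
    -- O*.
    have h' : (star O).transpose = star O.transpose := rfl
    rw [h', ← star_rtOpB, map_star] at h
    refine h.trans ?_
    change _ = star (C.homA (n + 1) (C.rtOp n O)) C.vac
    rw [← map_star, ← map_star]
  q_mem n := ⟨C.refProj n, rfl⟩
  q_proj n := ((C.isStarProjection_refProj n).map (C.wedgeOp n)).map (C.homA (n + 1))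
  q_min := by
    rintro n _ ⟨O, rfl⟩
    refine ⟨star (C.refState n) ⬝ᵥ O.mulVec (C.refState n), ?_⟩
    change C.homA (n + 1) _ * C.homA (n + 1) (C.wedgeOp n O) * C.homA (n + 1) _ = _
    rw [← map_mul, ← map_mul, ← map_mul, ← map_mul, refProj_sandwich, map_smul, map_smul]
  q_fix := C.homA_refProj_vac
  norm_Ω := C.norm_vac

lemma mem_bulk (n : ℕ) (O : Matrix (C.wedgeA n).Fresh (C.wedgeA n).Fresh ℂ) :
    C.homA (n + 1) (C.wedgeOp n O) ∈ C.system.bulk n := ⟨O, rfl⟩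

lemma mem_cut (n : ℕ) (O : Matrix (Fin (C.r n) → Fin d) (Fin (C.r n) → Fin d) ℂ) :
    C.homA (n + 1) (C.rtOp n O) ∈ C.system.cut n := ⟨O, rfl⟩

lemma hasCutUnits (h : ∀ N, ∃ n, N ≤ n ∧ 0 < C.r n) : C.system.HasCutUnits := by
  intro N
  obtain ⟨n, hn, hr⟩ := h N
  refine ⟨n, hn, Fin (C.r n) → Fin d, inferInstance,
    fun j k => C.homA (n + 1) (C.rtOp n (Matrix.single j k 1)), ?_, fun j k => C.mem_cut n _,
    fun j k => ?_, fun j k l => ?_, ?_⟩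
  · rw [Fintype.card_fun, Fintype.card_fin, Fintype.card_fin]
    exact Nat.one_lt_pow hr.ne' C.two_le
  · rw [← map_star, ← map_star, Matrix.star_eq_conjTranspose, Matrix.conjTranspose_single, star_one]
  · rw [← map_mul, ← map_mul, Matrix.single_mul_single_same, mul_one]
  · rw [← map_sum, ← map_sum, Matrix.sum_single_one, map_one, map_one]

lemma exists_orthogonal {ι : Type} [Fintype ι] (h : 1 < Fintype.card ι) (a : ι → ℂ) :
    ∃ b : ι → ℂ, star b ⬝ᵥ b = 1 ∧ star a ⬝ᵥ b = 0 := by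
  have h1 : (Submodule.span ℂ {WithLp.toLp 2 a} : Submodule ℂ (EuclideanSpace ℂ ι))ᗮ ≠ ⊥ := by
    intro h0
    rw [Submodule.orthogonal_eq_bot_iff] at h0
    have h2 := (finrank_span_le_card (R := ℂ) {(WithLp.toLp 2 a : EuclideanSpace ℂ ι)}).trans_eq
      (Set.toFinset_card _)
    rw [Set.card_singleton, h0, finrank_top, finrank_euclideanSpace] at h2
    omega
  obtain ⟨b, hb, hb0⟩ := Submodule.exists_mem_ne_zero_of_ne_bot h1
  rw [Submodule.mem_orthogonal_singleton_iff_inner_right] at hb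
  refine ⟨((‖b‖ : ℂ)⁻¹ • b).ofLp, ?_, ?_⟩
  · have h3 : inner ℂ ((‖b‖ : ℂ)⁻¹ • b) ((‖b‖ : ℂ)⁻¹ • b) = 1 := by
      have hb1 : (‖b‖ : ℂ) ≠ 0 := by exact_mod_cast norm_ne_zero_iff.2 hb0
      rw [inner_smul_left, inner_smul_right, inner_self_eq_norm_sq_to_K, map_inv₀, Complex.conj_ofReal]
      change (‖b‖ : ℂ)⁻¹ * ((‖b‖ : ℂ)⁻¹ * (‖b‖ : ℂ) ^ 2) = 1
      rw [sq, inv_mul_cancel_left₀ hb1, inv_mul_cancel₀ hb1]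
    rw [dotProduct_comm]
    exact h3
  · have h3 : inner ℂ (WithLp.toLp 2 a : EuclideanSpace ℂ ι) ((‖b‖ : ℂ)⁻¹ • b) = 0 := by
      rw [inner_smul_right, hb, mul_zero]
    rw [dotProduct_comm]
    exact h3

/-- A new bond across the cut ends in a tensor of the layer, and that tensor brings a bulk input of
dimension d ≥ 2. So there is a unit vector b orthogonal to the reference state a, and the rank-one
operator b a* is the partial isometry. -/
lemma hasBulkUnits (h : ∀ N, ∃ n, N ≤ n ∧ 0 < C.r n) : C.system.HasBulkUnits := by
  intro N
  obtain ⟨n, hn, hr⟩ := h N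
  have hcard : 1 < Fintype.card (C.wedgeA n).Fresh := by
    obtain ⟨⟨v, -⟩, -⟩ := (C.wedgeA n).rt_used ⟨0, hr⟩
    have hv : (C.wedgeA n).nV ≠ 0 := fun h0 => absurd v.2 (by omega)
    have h1 := Nat.one_lt_pow hv C.two_le
    have h2 := Nat.one_le_pow ((C.wedgeA n).nK * 2) d C.d_pos
    rw [Fintype.card_prod, Fintype.card_fun, Fintype.card_fun, Fintype.card_prod, Fintype.card_fin,
      Fintype.card_fin, Fintype.card_fin, Fintype.card_bool]
    nlinarith
  obtain ⟨b, hb, hab⟩ := exists_orthogonal hcard (C.refState n)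
  refine ⟨n, hn, _, C.mem_bulk n (Matrix.vecMulVec b (star (C.refState n))), ?_, ?_⟩
  · rw [← map_star, ← map_star, ← map_mul, ← map_mul, Matrix.star_eq_conjTranspose,
      Matrix.conjTranspose_vecMulVec, star_star, Matrix.vecMulVec_mul_vecMulVec, hb, one_smul]
    rfl
  · change C.homA (n + 1) (C.wedgeOp n (C.refProj n)) * _ = 0
    rw [← map_mul, ← map_mul, refProj, Matrix.vecMulVec_mul_vecMulVec, hab, zero_smul,
      Matrix.vecMulVec_zero, map_zero, map_zero]

/-- This is definitional because `IndLim.pushes` and `pushFrom` are the same recursion, so that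
`homA` unfolds to `limitOp`. -/
lemma wedgeAlgebra_eq : C.wedgeAlgebra = C.system.M := rfl

lemma rtAlgebra_eq : C.rtAlgebra = C.system.N := rfl

lemma homA_mem_A (n : ℕ) (O : Matrix (C.XA n) (C.XA n) ℂ) : C.homA n O ∈ C.system.A :=
  C.homA_mem C.system.A.toStarSubalgebra.toSubalgebra
    (fun n O => LocalSystem.M_le_A (LocalSystem.bulk_le_M (C.mem_bulk n O)))
    (fun n O => LocalSystem.N_le_A (LocalSystem.cut_le_N (C.mem_cut n O))) n O

lemma vnGen_eq_A {X : Set (C.LimitSpace →L[ℂ] C.LimitSpace)} (h1 : ∀ n O, C.homA n O ∈ X)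
    (h2 : ∀ x ∈ X, x ∈ C.system.A) : C.system.A = vnGen X := by
  apply VonNeumannAlgebra.ext
  intro T
  constructor
  · refine LocalSystem.vnGen_mono ?_
    rintro T (hT | hT)
    · obtain ⟨n, O, rfl⟩ := Set.mem_iUnion.1 hT
      exact h1 _ _
    · obtain ⟨n, O, rfl⟩ := Set.mem_iUnion.1 hT
      exact h1 _ _
  · intro hT
    refine mem_of_commute_commutant fun t ht => mem_vnGen_iff.1 hT t fun s hs => ?_
    exact ⟨LocalSystem.commutant_comm ht (h2 s hs), LocalSystem.commutant_comm ht (star_mem (h2 s hs))⟩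

/-- Every operator on A at a finite stage is a polynomial in bulk and cut operators, and a von
Neumann algebra is norm closed, so the C*-algebra adds nothing beyond A. -/
lemma regionAlgebra_eq : C.regionAlgebra = C.system.A := by
  refine (C.vnGen_eq_A (X := C.regionCStar)
    (fun n O => subset_closure (Set.mem_iUnion.2 ⟨n, O, rfl⟩)) ?_).symm
  refine closure_minimal (Set.iUnion_subset fun n => ?_) (LocalSystem.isClosed_vn C.system.A)
  rintro _ ⟨O, rfl⟩
  exact C.homA_mem_A n O

lemma isHyperfinite : IsHyperfinite C.system.A := by
  refine ⟨fun n => (C.homA n).range, monotone_nat_of_le_succ fun n => ?_, fun n => ?_,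
    C.vnGen_eq_A (fun n O => Set.mem_iUnion.2 ⟨n, O, rfl⟩) fun x hx => ?_⟩
  · rintro _ ⟨O, rfl⟩
    exact ⟨C.push n O, C.homA_push n O⟩
  · exact Module.Finite.of_surjective (C.homA n).rangeRestrict.toAlgHom.toLinearMap
      (C.homA n).rangeRestrict_surjective
  · obtain ⟨n, O, rfl⟩ := Set.mem_iUnion.1 hx
    exact C.homA_mem_A n O

end LayeredCode
end Happy

theorem theorem3 {d m : ℕ} (C : Happy.LayeredCode d m) (hRT : ∀ N, ∃ n, N ≤ n ∧ 0 < C.r n) :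
    (∃ (K L : Type) (_ : NormedAddCommGroup K) (_ : InnerProductSpace ℂ K) (_ : CompleteSpace K)
      (_ : NormedAddCommGroup L) (_ : InnerProductSpace ℂ L) (_ : CompleteSpace L)
      (W : K ⊗[ℂ] L →ₗᵢ[ℂ] C.LimitSpace) (R : VonNeumannAlgebra L),
      DenseRange W ∧ ¬ FiniteDimensional ℂ K ∧ Happy.IsTypeIIOne R ∧
      (C.wedgeAlgebra : Set (C.LimitSpace →L[ℂ] C.LimitSpace)) =
        {S | ∃ x : K →L[ℂ] K, Happy.IsTensorOp W x 1 S} ∧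
      (C.rtAlgebra : Set (C.LimitSpace →L[ℂ] C.LimitSpace)) =
        {S | ∃ y ∈ R, Happy.IsTensorOp W 1 y S} ∧
      C.regionAlgebra = Happy.vnGen {S | ∃ x : K →L[ℂ] K, ∃ y ∈ R, Happy.IsTensorOp W x y S}) ∧
    Happy.IsTypeI C.wedgeAlgebra ∧
    Happy.IsTypeIIOne C.rtAlgebra ∧
    Happy.IsTypeIIInfty C.regionAlgebra ∧
    Happy.IsHyperfinite C.regionAlgebra ∧
    TopologicalSpace.SeparableSpace C.LimitSpace := by
  have hcut := C.hasCutUnits hRT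
  have hbulk := C.hasBulkUnits hRT
  rw [C.regionAlgebra_eq, C.wedgeAlgebra_eq, C.rtAlgebra_eq]
  exact ⟨⟨C.system.KType, C.system.LType, inferInstance, inferInstance, inferInstance, inferInstance,
    inferInstance, inferInstance, C.system.W, C.system.R, Happy.LocalSystem.denseRange_W,
    Happy.LocalSystem.not_finiteDimensional_K hbulk, Happy.LocalSystem.isTypeIIOne_R hcut,
    Happy.LocalSystem.coe_M, Happy.LocalSystem.coe_N, Happy.LocalSystem.A_eq⟩,
    Happy.LocalSystem.isTypeI_M, Happy.LocalSystem.isTypeIIOne_N hcut,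
    Happy.LocalSystem.isTypeIIInfty_A hcut hbulk, C.isHyperfinite, IndLim.separableSpace_limit⟩
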